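/- Let $\mathcal R=(X,R,Y,R^\vee,\Delta)$ be a (reduced) based root datum with Weyl group $W$, let $q>1$ be real, and let $\lambda,\lambda^*:R\to\mathbb R$ be $W$-invariant functions with $\lambda^*(\alpha)=\lambda(\alpha)$ whenever $\alpha^\vee\notin 2Y$. Let $\mathcal H$ be the affine Hecke algebra of $(\mathcal R,\lambda,\lambda^*,q)$, with Iwahori--Matsumoto basis $\{N_w: w\in W\ltimes X\}$: $N_vN_w=N_{vw}$ if $\ell(vw)=\ell(v)+\ell(w)$, and $N_s^2=1+(q_s^{1/2}-q_s^{-1/2})N_s$ for the simple (affine) reflections $s$, where $q_{s_\alpha}=q^{\lambda(\alpha)}$ for $\alpha\in\Delta$, and $q_{s'_\alpha}=q^{\lambda^*(\alpha)}$ with $s'_\alpha=t_\alpha s_\alpha$ when $\alpha^\vee$ is maximal in $R^\vee$. Put $\theta_x=N_{t_y}N_{t_z}^{-1}$ if $x=y-z$ with $y,z\in X$ dominant. The conjugate-linear involution $*$ and the trace $\tau$ are given by $N_w^*=N_{w^{-1}}$, $\tau(N_w)=\delta_{w,1}$. For $P\subseteq\Delta$ let $W_P=W(R_P)$ be the parabolic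 subgroup, with longest element $w_P$, let $\mathcal H^P\subseteq\mathcal H$ be the subalgebra generated by the $N_w$ $(w\in W_P)$ and the $\theta_x$ $(x\in X)$, which is the affine Hecke algebra of $(X,R_P,Y,R_P^\vee,P,\lambda,\lambda^*,q)$ and as such has its own Iwahori--Matsumoto basis $\{N_w: w\in W_P\ltimes X\}$ and its own involution $*_P$, and put $P^{op}=w_\Delta(-P)$. Let $\Gamma$ be a finite group acting on $\mathcal R$, leaving $\lambda,\lambda^*$ invariant, and acting on $\mathbb C[X]$ by $\gamma(\theta_x)=z_\gamma(x)\theta_{\gamma(x)}$ with $z_\gamma\in T=\mathrm{Hom}(X,\mathbb C^\times)$, such that $N_w\theta_x\mapsto z_\gamma(x)N_{\gamma(w)}\theta_{\gamma(x)}$ $(w \in W)$ is a $*$-automorphism of $\mathcal H$ (that is: $z_\gamma$ is $W$-invariant and unitary, and $z_\gamma(\alpha)=1$ for all $\alpha\in R$ with $\lambda^*(\alpha)\neq 0$). Let $\natural:\Gamma^2\to\mathbb C^\times$ be a 2-cocycle with $\natural(1,1)=1$, and form $\mathcal H\rtimes\mathbb C[\Gamma,\natural]$, with $N_\gamma N_{\gamma'}=\natural(\gamma,\gamma')N_{\gamma\gamma'}$.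 Extend $*$ by $N_\gamma^*=c(\gamma)^2N_\gamma^{-1}$, where $c:\Gamma\to\mathbb R_{>0}$ is the function with $|\natural(\gamma,\gamma')|=c(\gamma)c(\gamma')/c(\gamma\gamma')$, and extend $\tau$ by $\tau(\mathcal H N_\gamma)=0$ for $\gamma\ne1$. For each $P\subseteq\Delta$ let $\Gamma_P\subseteq\Gamma$ be a subgroup, such that: (i) $\Gamma_P\subseteq\Gamma_Q$ if $P\subseteq Q$; (ii) $\Gamma_P$ stabilizes $P$ and the subtori $T^P=\mathrm{Hom}(X/(X\cap\mathbb QP),\mathbb C^\times)$ and $T_P=\mathrm{Hom}(X/(P^\vee)^\perp,\mathbb C^\times)$ of $T$; (iii) each element of $\Gamma_P$ acts on $T^P$ as multiplication by an element of $T_P\cap T^P$; (iv) $\gamma\Gamma_P\gamma^{-1}=\Gamma_{\gamma(P)}$ if $\gamma\in W\rtimes\Gamma$ and $\gamma(P)\subseteq\Delta$; (v) $\natural=1$ on $\Gamma_\emptyset^2$. Write $\mathcal B=\mathcal H\rtimes\mathbb C[\Gamma,\natural]$ and $\mathcal B_P=\mathcal H^P\rtimes\mathbb C[\Gamma_P,\natural]\subseteq\mathcal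 B$, with the involution on $\mathcal B_P$ that extends $*_P$ and $N_\gamma\mapsto N_\gamma^*$. (For $\Gamma=1$ these are $\mathcal H$ and $\mathcal H^P$.) The Hermitian dual of a module $V$ over one of these $*$-algebras is the space $V^\dagger$ of conjugate-linear functions $V\to\mathbb C$ with the action $(h\lambda)(v)=\lambda(h^*v)$. Theorem B. Let $P\subseteq\Delta$. Then $P^{op}\subseteq\Delta$, and there is a $*$-algebra isomorphism $\psi_{\Delta P}:\mathcal B_P\to\mathcal B_{P^{op}}$ with $\psi_{\Delta P}(N_w)=N_{w_\Delta w_Pww_Pw_\Delta}$ for $w\in W_P\ltimes X$ and $\psi_{\Delta P}(N_\gamma)=N_\gamma$ for $\gamma\in\Gamma_P$ (where $N_w$ and $N_{w_\Delta w_P w w_P w_\Delta}$ are Iwahori--Matsumoto basis elements of $\mathcal H^P$ and $\mathcal H^{P^{op}}$). (a) Let $(\rho,V)$ be a $\mathcal B_P$-module. There is an isomorphism of $\mathcal B$-modules $\mathrm{ind}_{\mathcal B_P}^{\mathcal B}(\rho^\dagger)\cong\mathrm{ind}_{\mathcal B_P}^{\mathcal B}(\rho)^\dagger$, where $\mathrm{ind}_{\mathcal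 B_P}^{\mathcal B}=\mathcal B\otimes_{\mathcal B_P}$, given by the sesquilinear pairing $$\langle h'\otimes\lambda,\,h\otimes v\rangle=\tau(h'h^*)\,\lambda(v)\qquad \lambda\in V^\dagger,\ v\in V,\ h,h'\in\mathrm{span}\{N_\gamma N_w:\gamma\in\Gamma^P,\ w\in W^P\},$$ where $W^P=\{w\in W:w(P)\subseteq R^+\}$ and $\Gamma^P$ is any set of representatives of $\Gamma/\Gamma_P$. (b) Let $(\pi,V)$ be a $\mathcal B$-module. There is an isomorphism of $\mathcal B_P$-modules $\mathrm{Res}_{\mathcal B_P}^{\mathcal B}(\pi^\dagger)\cong\mathrm{Res}_{\mathcal B_{P^{op}}}^{\mathcal B}(\pi)^\dagger\circ\psi_{\Delta P}$, given by the pairing $(\lambda,v)\mapsto\lambda(\pi(N_{w_Pw_\Delta})v)$. Likewise $\mathrm{Res}_{\mathcal B_{P^{op}}}^{\mathcal B}(\pi^\dagger)\circ\psi_{\Delta P}\cong\mathrm{Res}_{\mathcal B_P}^{\mathcal B}(\pi)^\dagger$, by the pairing $(\lambda,v)\mapsto\lambda(\pi(N_{w_\Delta w_P})v)$. -/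

import Mathlib

open scoped TensorProduct ComplexConjugate

set_option linter.unusedSectionVars false

noncomputable section

/-! ### Modules over complex algebras: Hermitian duals, restriction, induction -/

section Modules

variable {S A : Type*} [Ring S] [Algebra ℂ S] [Ring A] [Algebra ℂ A]

/-- The Hermitian dual `V†` of an `A`-module `V`, for a complex `*`-algebra `A`: the space of
conjugate-linear functions `V → ℂ`, with the action `(a • l) v = l (a* • v)`. -/
def HermitianDual (A V : Type*) [Ring A] [Algebra ℂ A] [AddCommGroup V] [Module ℂ V]
    [Module A V] : Type _ :=
  V →ₛₗ[starRingEnd ℂ] ℂ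

namespace HermitianDual

variable {V : Type*} [AddCommGroup V] [Module ℂ V] [Module A V]

instance : AddCommGroup (HermitianDual A V) :=
  inferInstanceAs (AddCommGroup (V →ₛₗ[starRingEnd ℂ] ℂ))

instance : Module ℂ (HermitianDual A V) :=
  inferInstanceAs (Module ℂ (V →ₛₗ[starRingEnd ℂ] ℂ))

instance : FunLike (HermitianDual A V) V ℂ :=
  inferInstanceAs (FunLike (V →ₛₗ[starRingEnd ℂ] ℂ) V ℂ)

instance : SemilinearMapClass (HermitianDual A V) (starRingEnd ℂ) V ℂ :=
  inferInstanceAs (SemilinearMapClass (V →ₛₗ[starRingEnd ℂ] ℂ) (starRingEnd ℂ) V ℂ)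

@[ext] theorem ext {l m : HermitianDual A V} (h : ∀ v, l v = m v) : l = m := DFunLike.ext _ _ h

theorem add_apply (l m : HermitianDual A V) (v : V) : (l + m) v = l v + m v := rfl

theorem smul_apply (c : ℂ) (l : HermitianDual A V) (v : V) : (c • l) v = c * l v := rfl

variable [StarRing A] [StarModule ℂ A] [IsScalarTower ℂ A V]

instance : SMul A (HermitianDual A V) where
  smul a l :=
    { toFun := fun v => l (star a • v)
      map_add' := fun v w => by rw [smul_add, map_add]
      map_smul' := fun c v => by
        rw [← algebraMap_smul A c v, smul_smul, ← Algebra.commutes, ← smul_smul,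
          algebraMap_smul, map_smulₛₗ] }

theorem action_apply (a : A) (l : HermitianDual A V) (v : V) : (a • l) v = l (star a • v) := rfl

instance : Module A (HermitianDual A V) where
  one_smul l := by ext v; rw [action_apply, star_one, one_smul]
  mul_smul a b l := by ext v; rw [action_apply, star_mul, mul_smul]; rfl
  smul_zero a := rfl
  smul_add a l m := rfl
  add_smul a b l := by
    ext v; rw [action_apply, star_add, add_smul, map_add]; rfl
  zero_smul l := by ext v; rw [action_apply, star_zero, zero_smul, map_zero]; rfl

instance : IsScalarTower ℂ A (HermitianDual A V) where
  smul_assoc c a l := by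
    ext v
    rw [action_apply, star_smul, smul_assoc, map_smulₛₗ, smul_apply, action_apply]
    simp

end HermitianDual

/-- The restriction of an `A`-module `V` along an algebra homomorphism `f : S → A`:
the module `V` with `s` acting as `f s`. -/
def Restricted (_f : S →ₐ[ℂ] A) (V : Type*) : Type _ := V

namespace Restricted

variable (f : S →ₐ[ℂ] A) (V : Type*) [AddCommGroup V] [Module ℂ V] [Module A V]

instance : AddCommGroup (Restricted f V) := inferInstanceAs (AddCommGroup V)

instance : Module ℂ (Restricted f V) := inferInstanceAs (Module ℂ V)

instance : Module S (Restricted f V) := Module.compHom V f.toRingHom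

/-- The identity map of the underlying vector spaces. -/
def of : V ≃ₗ[ℂ] Restricted f V := LinearEquiv.refl ℂ V

theorem action_of (s : S) (v : V) : s • of f V v = of f V (f s • v) := rfl

instance [IsScalarTower ℂ A V] : IsScalarTower ℂ S (Restricted f V) where
  smul_assoc c s v := by
    change f (c • s) • (show V from v) = c • (f s • (show V from v))
    rw [map_smul, smul_assoc]

end Restricted

/-- The submodule of `A ⊗[ℂ] V` that is divided out to obtain `A ⊗[S] V`. -/
def balancedRelations (f : S →ₐ[ℂ] A) (V : Type*) [AddCommGroup V] [Module ℂ V] [Module S V] :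
    Submodule A (A ⊗[ℂ] V) :=
  Submodule.span A {t | ∃ (a : A) (s : S) (v : V), t = (a * f s) ⊗ₜ[ℂ] v - a ⊗ₜ[ℂ] (s • v)}

/-- The induced module `A ⊗[S] V`, for an algebra homomorphism `f : S → A` and an `S`-module `V`
(Mathlib's tensor products are over commutative rings only). -/
def Induced (f : S →ₐ[ℂ] A) (V : Type*) [AddCommGroup V] [Module ℂ V] [Module S V] : Type _ :=
  (A ⊗[ℂ] V) ⧸ balancedRelations f V

namespace Induced

variable (f : S →ₐ[ℂ] A) (V : Type*) [AddCommGroup V] [Module ℂ V] [Module S V]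

instance : AddCommGroup (Induced f V) :=
  inferInstanceAs (AddCommGroup ((A ⊗[ℂ] V) ⧸ balancedRelations f V))

instance : Module A (Induced f V) :=
  inferInstanceAs (Module A ((A ⊗[ℂ] V) ⧸ balancedRelations f V))

instance : Module ℂ (Induced f V) :=
  inferInstanceAs (Module ℂ ((A ⊗[ℂ] V) ⧸ balancedRelations f V))

instance : IsScalarTower ℂ A (Induced f V) :=
  inferInstanceAs (IsScalarTower ℂ A ((A ⊗[ℂ] V) ⧸ balancedRelations f V))

/-- The class of the elementary tensor `a ⊗ v`. -/
def tmul (a : A) (v : V) : Induced f V :=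
  Submodule.Quotient.mk (p := balancedRelations f V) (a ⊗ₜ[ℂ] v)

end Induced

/-- The opposite algebra of `A`, with the complex conjugate scalar multiplication. A linear
antimultiplicative conjugate-linear map `S → A` is the same as a homomorphism `S →ₐ ConjOp A`. -/
def ConjOp (A : Type*) : Type _ := Aᵐᵒᵖ

namespace ConjOp

instance : Ring (ConjOp A) := inferInstanceAs (Ring Aᵐᵒᵖ)

instance : Algebra ℂ (ConjOp A) :=
  ((algebraMap ℂ Aᵐᵒᵖ).comp (starRingEnd ℂ)).toAlgebra' fun c x => by
    exact Algebra.commutes (A := Aᵐᵒᵖ) (conj c) x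

/-- The underlying element of `A`. -/
def un (x : ConjOp A) : A := MulOpposite.unop (show Aᵐᵒᵖ from x)

/-- The element of `ConjOp A` given by an element of `A`. -/
def mk (a : A) : ConjOp A := show Aᵐᵒᵖ from MulOpposite.op a

theorem un_mk (a : A) : un (mk a) = a := rfl

theorem un_add (x y : ConjOp A) : un (x + y) = un x + un y := rfl

theorem un_mul (x y : ConjOp A) : un (x * y) = un y * un x := rfl

theorem un_one : un (1 : ConjOp A) = 1 := rfl

theorem un_injective : Function.Injective (un : ConjOp A → A) := MulOpposite.unop_injective

theorem un_smul (c : ℂ) (x : ConjOp A) : un (c • x) = conj c • un x := by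
  rw [Algebra.smul_def, Algebra.smul_def, un_mul, Algebra.commutes]
  rfl

end ConjOp

end Modules

/-! ### Based root data with labels, and their (extended) affine Weyl groups -/

/-- A based root datum `(X, R, Y, R^∨, Δ)`, a base `q > 1` and label functions
`λ, λ* : R → ℝ`. Roots are indexed by `ι`. -/
structure HeckeDatum (ι X Y : Type*) [AddCommGroup X] [AddCommGroup Y] where
  /-- the root datum -/
  R : RootPairing ι ℤ X Y
  reduced : R.IsReduced
  /-- the basis `Δ` -/
  base : R.Base
  q : ℝ
  one_lt_q : 1 < q
  lam : ι → ℝ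
  lamStar : ι → ℝ
  lam_reflection : ∀ i j, lam (R.reflectionPerm i j) = lam j
  lamStar_reflection : ∀ i j, lamStar (R.reflectionPerm i j) = lamStar j
  lamStar_eq : ∀ i, (¬ ∃ y : Y, R.coroot i = (2 : ℤ) • y) → lamStar i = lam i

namespace HeckeDatum

variable {ι X Y : Type*} [Fintype ι] [AddCommGroup X] [AddCommGroup Y] (D : HeckeDatum ι X Y)

/-- The set `Δ` of simple roots. -/
def simple : Set ι := D.base.support

/-- The parabolic root subsystem `R_P = R ∩ ℤP`. -/
def sub (P : Set ι) : Set ι := {i | D.R.root i ∈ AddSubgroup.closure (D.R.root '' P)}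

/-- The parabolic subgroup `W_P = W(R_P)`; for `P = Δ` it is the Weyl group `W`. -/
def weyl (P : Set ι) : Subgroup D.R.Aut :=
  Subgroup.closure (RootPairing.Equiv.reflection D.R '' D.sub P)

/-- The action of the automorphisms of the root datum on the (multiplicatively written) lattice. -/
def autHom : D.R.Aut →* MulAut (Multiplicative X) where
  toFun u := AddEquiv.toMultiplicative (RootPairing.Equiv.weightHom D.R u).toAddEquiv
  map_one' := by ext x; rfl
  map_mul' u v := by ext x; rfl

/-- The group `X ⋊ Aut(R)`, which contains `W_P ⋉ X` for all `P`. The element with components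
`x` and `u` is `t_x u`, where `t_x` denotes the translation by `x`. -/
abbrev Ext : Type _ := Multiplicative X ⋊[D.autHom] D.R.Aut

/-- The translation `t_x`. -/
def trans (x : X) : D.Ext := SemidirectProduct.inl (Multiplicative.ofAdd x)

/-- An automorphism of the root datum as element of `X ⋊ Aut(R)`. -/
def lin (u : D.R.Aut) : D.Ext := SemidirectProduct.inr u

/-- The extended affine Weyl group `W_P ⋉ X`. -/
def aff (P : Set ι) : Subgroup D.Ext := (D.weyl P).comap SemidirectProduct.rightHom

open Classical in
/-- The length function of `W_P ⋉ X`. It counts the hyperplanes `⟨·, α^∨⟩ = k`, with `k ∈ ℤ` and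
`α ∈ R_P^+`, that separate the fundamental alcove `A` from `w A`: if `w = t_x u`, then there are
`|⟨x, α^∨⟩|` of them if `u⁻¹ α > 0`, and `|⟨x, α^∨⟩ - 1|` of them if `u⁻¹ α < 0`. -/
def len (P : Set ι) (w : D.Ext) : ℕ :=
  ∑ i with i ∈ D.sub P ∧ D.base.IsPos i,
    (D.R.toLinearMap w.left.toAdd (D.R.coroot i)
      - if D.base.IsPos (w.right⁻¹ • i) then 0 else 1).natAbs

/-- `α^∨` is maximal in `R_P^∨` for the partial order determined by the basis `P^∨`. -/
def IsMaxCoroot (P : Set ι) (i : ι) : Prop :=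
  i ∈ D.sub P ∧ ∀ j ∈ D.sub P,
    D.R.coroot j - D.R.coroot i ∈ AddSubmonoid.closure (D.R.coroot '' P) → j = i

/-- The simple affine reflection `s'_α = t_α s_α`. -/
def affRefl (i : ι) : D.Ext := D.trans (D.R.root i) * D.lin (RootPairing.Equiv.reflection D.R i)

/-- `x` is dominant. -/
def Dominant (x : X) : Prop := ∀ i ∈ D.simple, 0 ≤ D.R.toLinearMap x (D.R.coroot i)

/-- The number `q^{c/2} - q^{-c/2}`, that is, `q_s^{1/2} - q_s^{-1/2}` for `q_s = q^c`. -/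
def quad (c : ℝ) : ℂ := ((D.q ^ (c / 2) - D.q ^ (-(c / 2)) : ℝ) : ℂ)

/-! The length of an inverse -/

theorem smul_mem_sub {P : Set ι} {u : D.R.Aut} (hu : u ∈ D.weyl P) {i : ι} (hi : i ∈ D.sub P) :
    u • i ∈ D.sub P := by
  induction hu using Subgroup.closure_induction generalizing i with
  | mem v hv =>
    obtain ⟨j, hj, rfl⟩ := hv
    change D.R.root (D.R.reflectionPerm j i) ∈ AddSubgroup.closure (D.R.root '' P)
    rw [D.R.root_reflectionPerm, D.R.reflection_apply_root]
    exact AddSubgroup.sub_mem _ hi (AddSubgroup.zsmul_mem _ hj _)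
  | one => simpa using hi
  | mul v w _ _ hv hw => rw [mul_smul]; exact hv (hw hi)
  | inv v _ hv =>
    have : Function.Surjective fun j : D.sub P => (⟨v • (j : ι), hv j.2⟩ : D.sub P) :=
      Finite.surjective_of_injective fun a b hab =>
        Subtype.ext (MulAction.injective v (congrArg Subtype.val hab))
    obtain ⟨j, hj⟩ := this ⟨i, hi⟩
    have hj' : v • (j : ι) = i := congrArg Subtype.val hj
    rw [← hj', inv_smul_smul]
    exact j.2

theorem pair_smul (u : D.R.Aut) (x : X) (i : ι) :
    D.R.toLinearMap (u • x) (D.R.coroot (u • i)) = D.R.toLinearMap x (D.R.coroot i) := by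
  have h := congrArg (fun f => f x)
    (u.toHom.weight_coweight_transpose_apply D.R D.R (D.R.coroot (u • i)))
  have h2 : u.toHom.coweightMap (D.R.coroot (u • i)) = D.R.coroot i := by
    rw [RootPairing.Hom.coroot_coweightMap_apply]
    exact congrArg _ (Equiv.symm_apply_apply _ i)
  rw [h2] at h
  exact h

open Classical in
theorem two_mul_len (P : Set ι) (w : D.Ext) :
    2 * D.len P w = ∑ i with i ∈ D.sub P,
      (D.R.toLinearMap w.left.toAdd (D.R.coroot i)
        + (if D.base.IsPos i then 0 else 1)
        - if D.base.IsPos (w.right⁻¹ • i) then 0 else 1).natAbs := by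
  let := D.R.indexNeg
  have hneg : ∀ (u : D.R.Aut) (i : ι), u • (-i) = -(u • i) := fun u i => by
    apply D.R.root.injective
    have h : ∀ j, D.R.root (-j) = -D.R.root j := fun j => by simp
    have h' : ∀ j, D.R.root (u • j) = u • D.R.root j := fun j =>
      RootPairing.Equiv.root_indexEquiv_eq_smul (P := D.R) j u
    rw [h', h, h, h', smul_neg]
  have hsub : ∀ i, i ∈ D.sub P → -i ∈ D.sub P := fun i hi => by
    change D.R.root (-i) ∈ AddSubgroup.closure (D.R.root '' P)
    have h : D.R.root (-i) = -D.R.root i := by simp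
    rw [h]
    exact AddSubgroup.neg_mem _ hi
  have hco : ∀ i, D.R.coroot (-i) = -D.R.coroot i := fun i => by simp
  rw [← Finset.sum_filter_add_sum_filter_not _ (fun i => D.base.IsPos i),
    Finset.filter_filter, Finset.filter_filter, two_mul]
  congr 1
  · refine Finset.sum_congr rfl fun i hi => ?_
    rw [Finset.mem_filter] at hi
    rw [if_pos hi.2.2, add_zero]
  · refine Finset.sum_nbij' (fun i => -i) (fun i => -i) ?_ ?_ ?_ ?_ ?_
    · intro i hi
      simp only [Finset.mem_filter, Finset.mem_univ, true_and] at hi ⊢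
      exact ⟨hsub i hi.1, fun h => (RootPairing.Base.IsPos.neg_iff_not D.base i).1 h hi.2⟩
    · intro i hi
      simp only [Finset.mem_filter, Finset.mem_univ, true_and] at hi ⊢
      exact ⟨hsub i hi.1, (RootPairing.Base.IsPos.neg_iff_not D.base i).2 hi.2⟩
    · intro i _; exact neg_neg i
    · intro i _; exact neg_neg i
    · intro i hi
      simp only [Finset.mem_filter, Finset.mem_univ, true_and] at hi
      have h1 := (RootPairing.Base.IsPos.neg_iff_not D.base i)
      have h2 := (RootPairing.Base.IsPos.neg_iff_not D.base (w.right⁻¹ • i))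
      rw [hneg, hco, map_neg]
      by_cases h3 : D.base.IsPos (w.right⁻¹ • i)
      · rw [if_pos h3, if_neg fun h => h1.1 h hi.2, if_neg fun h => h2.1 h h3]
        omega
      · rw [if_neg h3, if_neg fun h => h1.1 h hi.2, if_pos (h2.2 h3)]
        omega

theorem len_inv (P : Set ι) {w : D.Ext} (hw : w ∈ D.aff P) : D.len P w⁻¹ = D.len P w := by
  classical
  have hw' : w.right ∈ D.weyl P := hw
  suffices h : 2 * D.len P w⁻¹ = 2 * D.len P w by omega
  rw [two_mul_len, two_mul_len]
  refine Finset.sum_nbij' (fun i => w.right • i) (fun i => w.right⁻¹ • i) ?_ ?_ ?_ ?_ ?_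
  · intro i hi
    simp only [Finset.mem_filter, Finset.mem_univ, true_and] at hi ⊢
    exact D.smul_mem_sub hw' hi
  · intro i hi
    simp only [Finset.mem_filter, Finset.mem_univ, true_and] at hi ⊢
    exact D.smul_mem_sub (inv_mem hw') hi
  · intro i _; exact inv_smul_smul _ i
  · intro i _; exact smul_inv_smul _ i
  · intro i _
    have h1 : (w⁻¹).left.toAdd = -(w.right⁻¹ • w.left.toAdd) := by
      rw [← smul_neg]; rfl
    have h2 : (w⁻¹).right = w.right⁻¹ := rfl
    have h3 := D.pair_smul w.right (w.right⁻¹ • w.left.toAdd) i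
    rw [smul_inv_smul] at h3
    rw [h1, h2, h3, inv_inv, inv_smul_smul, map_neg, LinearMap.neg_apply]
    omega

/-- The set `W^P = {w ∈ W : w(P) ⊆ R^+}`. -/
def minReps (P : Set ι) : Set D.R.Aut :=
  {w | w ∈ D.weyl D.simple ∧ ∀ i ∈ P, D.base.IsPos (w • i)}

theorem len_lin_le (P : Set ι) (u : D.R.Aut) : D.len P (D.lin u) ≤ Fintype.card ι := by
  classical
  unfold len
  refine (Finset.sum_le_card_nsmul _ _ 1 fun i _ => ?_).trans ?_
  · have : D.R.toLinearMap (Multiplicative.toAdd (D.lin u).left) (D.R.coroot i) = 0 := by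
      change D.R.toLinearMap 0 _ = 0
      simp
    rw [this]
    split_ifs <;> simp
  · simpa using Finset.card_le_univ _

theorem exists_longest (P : Set ι) :
    ∃ w ∈ D.weyl P, ∀ v ∈ D.weyl P, D.len P (D.lin v) ≤ D.len P (D.lin w) := by
  let s : Set ℕ := (fun v => D.len P (D.lin v)) '' (D.weyl P : Set D.R.Aut)
  have hb : BddAbove s := ⟨Fintype.card ι, by rintro _ ⟨v, _, rfl⟩; exact D.len_lin_le P v⟩
  obtain ⟨w, hw, h⟩ := Nat.sSup_mem (s := s) ⟨_, 1, one_mem (D.weyl P), rfl⟩ hb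
  exact ⟨w, hw, fun v hv => (le_csSup hb ⟨v, hv, rfl⟩).trans_eq h.symm⟩

/-- The longest element `w_P` of `W_P`. -/
def longest (P : Set ι) : D.R.Aut := (D.exists_longest P).choose

/-- The set of simple roots `P^op = w_Δ(-P)`. -/
def op (P : Set ι) : Set ι :=
  {i | ∃ j ∈ P, D.R.root i = -D.R.root (D.longest D.simple • j)}

end HeckeDatum

/-- The data for a twisted affine Hecke algebra `H ⋊ ℂ[Γ, ♮]`: a finite group `Γ` that acts on the
based root datum and on `ℂ[X]`, preserving all the structure that is used to define `H`,
and a 2-cocycle `♮`. -/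
structure TwistedDatum (ι X Y Γ : Type*) [AddCommGroup X] [AddCommGroup Y] [Group Γ]
    extends HeckeDatum ι X Y where
  /-- the action on the root datum -/
  act : Γ →* R.Aut
  act_simple : ∀ g, ∀ i ∈ base.support, act g • i ∈ base.support
  lam_act : ∀ g i, lam (act g • i) = lam i
  lamStar_act : ∀ g i, lamStar (act g • i) = lamStar i
  /-- the action on `ℂ[X]` is `g(θ_x) = z_g(x) θ_{g(x)}` -/
  z : Γ → (Multiplicative X →* ℂˣ)
  z_mul : ∀ g h x, z (g * h) (.ofAdd x) = z h (.ofAdd x) * z g (.ofAdd (act h • x))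
  /-- `z_g` is `W`-invariant. This field and the next one say precisely that
  `N_w θ_x ↦ z_g(x) N_{g(w)} θ_{g(x)}` is an algebra automorphism of `H`. -/
  z_reflection : ∀ g i x, z g (.ofAdd (R.reflection i x)) = z g (.ofAdd x)
  z_root : ∀ g i, lamStar i ≠ 0 → z g (.ofAdd (R.root i)) = 1
  /-- `z_g` is unitary, that is, the automorphism of `H` given by `g` preserves the `*` -/
  z_norm : ∀ g x, ‖(z g (.ofAdd x) : ℂ)‖ = 1
  /-- the 2-cocycle `♮` -/
  coc : Γ → Γ → ℂˣ
  coc_assoc : ∀ g h k, coc g h * coc (g * h) k = coc g (h * k) * coc h k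
  coc_one : coc 1 1 = 1

namespace TwistedDatum

variable {ι X Y Γ : Type*} [Fintype ι] [AddCommGroup X] [AddCommGroup Y] [Group Γ] [Fintype Γ]
  (D : TwistedDatum ι X Y Γ)

/-! ### Twisted affine Hecke algebras -/

/-- Generators of `H^P ⋊ ℂ[K, ♮]`: elements `N_w` with `w ∈ W_P ⋉ X` and `N_g` with `g ∈ K`. -/
abbrev Gen (P : Set ι) (K : Subgroup Γ) : Type _ := D.aff P ⊕ K

/-- The generator `N_w` of the free algebra. -/
abbrev genW {P : Set ι} {K : Subgroup Γ} (w : D.aff P) : FreeAlgebra ℂ (D.Gen P K) :=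
  FreeAlgebra.ι ℂ (Sum.inl w)

/-- The generator `N_g` of the free algebra. -/
abbrev genK {P : Set ι} {K : Subgroup Γ} (g : K) : FreeAlgebra ℂ (D.Gen P K) :=
  FreeAlgebra.ι ℂ (Sum.inr g)

/-- The defining relations of `H^P ⋊ ℂ[K, ♮]`. The first four are the Iwahori--Matsumoto
presentation of the affine Hecke algebra `H^P = H(X, R_P, Y, R_P^∨, P, λ, λ*, q)`, the next two
present `ℂ[K, ♮]` and the last one gives the action of `K` on `H^P`. -/
inductive Rel (P : Set ι) (K : Subgroup Γ) :
    FreeAlgebra ℂ (D.Gen P K) → FreeAlgebra ℂ (D.Gen P K) → Prop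
  | one : Rel P K (D.genW 1) 1
  | mul (v w : D.aff P) (h : D.len P (v * w : D.Ext) = D.len P v + D.len P w) :
      Rel P K (D.genW v * D.genW w) (D.genW (v * w))
  | simple (i : ι) (hi : i ∈ P) (s : D.aff P)
      (hs : (s : D.Ext) = D.lin (RootPairing.Equiv.reflection D.R i)) :
      Rel P K (D.genW s * D.genW s) (1 + D.quad (D.lam i) • D.genW s)
  | affine (i : ι) (hi : D.IsMaxCoroot P i) (s : D.aff P) (hs : (s : D.Ext) = D.affRefl i) :
      Rel P K (D.genW s * D.genW s) (1 + D.quad (D.lamStar i) • D.genW s)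
  | group_one : Rel P K (D.genK 1) 1
  | group_mul (g h : K) :
      Rel P K (D.genK g * D.genK h) ((D.coc g h : ℂ) • D.genK (g * h))
  | cross (g : K) (w w' : D.aff P)
      (h : (w' : D.Ext) = D.lin (D.act g) * w * (D.lin (D.act g))⁻¹) :
      Rel P K (D.genK g * D.genW w) ((D.z g (w : D.Ext).left : ℂ) • (D.genW w' * D.genK g))

/-- The algebra `H^P ⋊ ℂ[K, ♮]`. For `P = Δ` and `Γ` trivial this is the affine Hecke algebra `H`
itself. -/
def Alg (P : Set ι) (K : Subgroup Γ) : Type _ := RingQuot (D.Rel P K)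

instance (P : Set ι) (K : Subgroup Γ) : Ring (D.Alg P K) :=
  inferInstanceAs (Ring (RingQuot (D.Rel P K)))

instance (P : Set ι) (K : Subgroup Γ) : Algebra ℂ (D.Alg P K) :=
  inferInstanceAs (Algebra ℂ (RingQuot (D.Rel P K)))

/-! ### The involution -/

section Star

/-- The positive function `c` on `Γ` with `|♮(g, h)| = c(g) c(h) / c(gh)`. Thus `c(g)⁻¹ N_g`
multiply with a unitary cocycle. -/
def absNorm (g : Γ) : ℝ := (∏ h, ‖(D.coc g h : ℂ)‖) ^ ((Fintype.card Γ : ℝ)⁻¹)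

theorem absNorm_pos (g : Γ) : 0 < D.absNorm g :=
  Real.rpow_pos_of_pos (Finset.prod_pos fun h _ => norm_pos_iff.2 (D.coc g h).ne_zero) _

theorem absNorm_mul (g h : Γ) :
    ‖(D.coc g h : ℂ)‖ * D.absNorm (g * h) = D.absNorm g * D.absNorm h := by
  have hc : (Fintype.card Γ : ℝ) ≠ 0 := by exact_mod_cast Fintype.card_ne_zero
  have hp : ∀ g : Γ, 0 ≤ ∏ k, ‖(D.coc g k : ℂ)‖ := fun g =>
    Finset.prod_nonneg fun h _ => norm_nonneg _
  have h1 : ‖(D.coc g h : ℂ)‖ = (‖(D.coc g h : ℂ)‖ ^ (Fintype.card Γ)) ^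
      ((Fintype.card Γ : ℝ)⁻¹) := by
    rw [← Real.rpow_natCast, ← Real.rpow_mul (norm_nonneg _), mul_inv_cancel₀ hc, Real.rpow_one]
  rw [h1, absNorm, absNorm, absNorm, ← Real.mul_rpow (by positivity) (hp _),
    ← Real.mul_rpow (hp _) (hp _)]
  congr 1
  have h2 : ∏ k, ‖(D.coc g k : ℂ)‖ = ∏ k, ‖(D.coc g (h * k) : ℂ)‖ :=
    (Equiv.prod_comp (Equiv.mulLeft h) fun k => ‖(D.coc g k : ℂ)‖).symm
  rw [h2, ← Finset.card_univ, ← Finset.prod_const, ← Finset.prod_mul_distrib,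
    ← Finset.prod_mul_distrib]
  refine Finset.prod_congr rfl fun k _ => ?_
  rw [← norm_mul, ← norm_mul, ← Units.val_mul, ← Units.val_mul, D.coc_assoc]

variable (P : Set ι) (K : Subgroup Γ)

/-- The quotient map from the free algebra. -/
def toAlg : FreeAlgebra ℂ (D.Gen P K) →ₐ[ℂ] D.Alg P K := RingQuot.mkAlgHom ℂ (D.Rel P K)

/-- The element `N_w` of `H^P ⋊ ℂ[K, ♮]`. -/
def nW (w : D.aff P) : D.Alg P K := D.toAlg P K (D.genW w)

/-- The element `N_g` of `H^P ⋊ ℂ[K, ♮]`. -/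
def nK (g : K) : D.Alg P K := D.toAlg P K (D.genK g)

variable {P K}

theorem toAlg_rel {a b : FreeAlgebra ℂ (D.Gen P K)} (h : D.Rel P K a b) :
    D.toAlg P K a = D.toAlg P K b := RingQuot.mkAlgHom_rel ℂ h

theorem nW_one : D.nW P K 1 = 1 := by
  rw [nW, D.toAlg_rel .one, map_one]

theorem nK_one : D.nK P K 1 = 1 := by
  rw [nK, D.toAlg_rel .group_one, map_one]

theorem nW_mul {v w : D.aff P} (h : D.len P (v * w : D.Ext) = D.len P v + D.len P w) :
    D.nW P K v * D.nW P K w = D.nW P K (v * w) := by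
  rw [nW, nW, ← map_mul, D.toAlg_rel (.mul v w h)]; rfl

theorem nK_mul (g h : K) :
    D.nK P K g * D.nK P K h = (D.coc g h : ℂ) • D.nK P K (g * h) := by
  rw [nK, nK, ← map_mul, D.toAlg_rel (.group_mul g h), map_smul]; rfl

theorem nK_mul_nW (g : K) (w w' : D.aff P)
    (h : (w' : D.Ext) = D.lin (D.act g) * w * (D.lin (D.act g))⁻¹) :
    D.nK P K g * D.nW P K w =
      (D.z g (w : D.Ext).left : ℂ) • (D.nW P K w' * D.nK P K g) := by
  rw [nK, nW, ← map_mul, D.toAlg_rel (.cross g w w' h), map_smul, map_mul]; rfl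

/-- The scalar `κ_g` such that `N_g^* = κ_g N_{g⁻¹}`, namely `c(g)^2 ♮(g, g⁻¹)⁻¹`. -/
def starCoeff (g : Γ) : ℂ := (D.absNorm g : ℂ) ^ 2 * ((D.coc g g⁻¹ : ℂ))⁻¹

/-- The images of the generators under the involution: `N_w^* = N_{w⁻¹}` and
`N_g^* = c(g)^2 N_g⁻¹`. -/
def starGen : D.Gen P K → ConjOp (D.Alg P K)
  | .inl w => ConjOp.mk (D.nW P K w⁻¹)
  | .inr g => ConjOp.mk (D.starCoeff g • D.nK P K g⁻¹)

theorem coc_one_left (g : Γ) : D.coc 1 g = 1 := by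
  have h := D.coc_assoc 1 1 g
  rw [one_mul, one_mul, D.coc_one, one_mul] at h
  exact (mul_eq_left.1 h.symm)

theorem starCoeff_mul (g h : Γ) :
    D.starCoeff g * D.starCoeff h * (D.coc h⁻¹ g⁻¹ : ℂ)
      = conj (D.coc g h : ℂ) * D.starCoeff (g * h) := by
  have e1 : (D.coc g h : ℂ) * D.coc (g * h) (g * h)⁻¹
      = D.coc g g⁻¹ * D.coc h (h⁻¹ * g⁻¹) := by
    have := D.coc_assoc g h (g * h)⁻¹
    rw [mul_inv_rev, mul_inv_cancel_left] at this
    rw [mul_inv_rev]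
    exact_mod_cast this
  have e2 : (D.coc h h⁻¹ : ℂ) = D.coc h (h⁻¹ * g⁻¹) * D.coc h⁻¹ g⁻¹ := by
    have := D.coc_assoc h h⁻¹ g⁻¹
    rw [mul_inv_cancel, coc_one_left, mul_one] at this
    exact_mod_cast this
  have e3 : (D.absNorm g : ℂ) * D.absNorm h = (‖(D.coc g h : ℂ)‖ : ℂ) * D.absNorm (g * h) := by
    exact_mod_cast (D.absNorm_mul g h).symm
  have e4 : (‖(D.coc g h : ℂ)‖ : ℂ) ^ 2 = conj (D.coc g h : ℂ) * D.coc g h := by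
    rw [mul_comm, Complex.mul_conj, Complex.normSq_eq_norm_sq]; push_cast; rfl
  have n1 := (D.coc g g⁻¹).ne_zero
  have n2 := (D.coc h h⁻¹).ne_zero
  have n3 := (D.coc (g * h) (g * h)⁻¹).ne_zero
  have n4 := (D.coc h (h⁻¹ * g⁻¹)).ne_zero
  have n5 := (D.coc h⁻¹ g⁻¹).ne_zero
  have e5 : D.starCoeff g * D.starCoeff h * (D.coc h⁻¹ g⁻¹ : ℂ)
      = ((D.absNorm g : ℂ) * D.absNorm h) ^ 2 *
        ((D.coc g g⁻¹ : ℂ)⁻¹ * (D.coc h h⁻¹ : ℂ)⁻¹ * D.coc h⁻¹ g⁻¹) := by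
    rw [starCoeff, starCoeff]; ring
  have e6 : (D.coc g g⁻¹ : ℂ)⁻¹ * (D.coc h h⁻¹ : ℂ)⁻¹ * D.coc h⁻¹ g⁻¹ * D.coc g h
      = (D.coc (g * h) (g * h)⁻¹ : ℂ)⁻¹ := by
    rw [e2]
    field_simp
    linear_combination e1
  rw [e5, e3, mul_pow, e4, starCoeff, ← e6]
  ring

theorem starCoeff_one : D.starCoeff 1 = 1 := by
  have h := D.absNorm_mul 1 1
  rw [D.coc_one, mul_one, Units.val_one, norm_one, one_mul] at h
  have h' : D.absNorm 1 = 1 := mul_left_cancel₀ (D.absNorm_pos 1).ne' (by rw [mul_one]; exact h.symm)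
  rw [starCoeff, h', inv_one, D.coc_one]
  simp

theorem starCoeff_inv (g : Γ) : conj (D.starCoeff g) * D.starCoeff g⁻¹ = 1 := by
  have h := D.starCoeff_mul g g⁻¹
  rw [inv_inv, mul_inv_cancel, starCoeff_one, mul_one] at h
  have n1 := (D.coc g g⁻¹).ne_zero
  have n2 : (D.absNorm g : ℂ) ≠ 0 := by exact_mod_cast (D.absNorm_pos g).ne'
  have n3 : conj (D.coc g g⁻¹ : ℂ) ≠ 0 := (map_ne_zero _).2 n1
  have e : conj (D.starCoeff g) = (D.absNorm g : ℂ) ^ 2 * (conj (D.coc g g⁻¹ : ℂ))⁻¹ := by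
    rw [starCoeff, map_mul, map_pow, map_inv₀, Complex.conj_ofReal]
  have e' : (D.absNorm g : ℂ) ^ 2 * D.starCoeff g⁻¹ = conj (D.coc g g⁻¹ : ℂ) := by
    have eg : D.starCoeff g * (D.coc g g⁻¹ : ℂ) = (D.absNorm g : ℂ) ^ 2 := by
      rw [starCoeff, mul_assoc, inv_mul_cancel₀ n1, mul_one]
    rw [← h, ← eg]
    ring
  rw [e, mul_right_comm, e', mul_inv_cancel₀ n3]

theorem z_weyl (g : Γ) {u : D.R.Aut} (hu : u ∈ D.weyl P) (x : X) :
    D.z g (.ofAdd (u • x)) = D.z g (.ofAdd x) := by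
  induction hu using Subgroup.closure_induction generalizing x with
  | mem v hv =>
    obtain ⟨j, _, rfl⟩ := hv
    exact D.z_reflection g j x
  | one => rw [one_smul]
  | mul v w _ _ hv hw => rw [mul_smul, hv, hw]
  | inv v _ hv => rw [← hv (v⁻¹ • x), smul_inv_smul]

theorem z_inv_conj (g : Γ) {w w' : D.Ext} (hw' : w' ∈ D.aff P)
    (h : w' = D.lin (D.act g) * w * (D.lin (D.act g))⁻¹) :
    D.z g⁻¹ (w'⁻¹).left * conj (D.z g w.left : ℂ) = 1 := by
  have h0 : w'.left = .ofAdd (D.act g • w.left.toAdd) := by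
    have e : (D.lin (D.act g))⁻¹ = D.lin (D.act g)⁻¹ := (map_inv SemidirectProduct.inr _).symm
    rw [h, e]
    simp only [HeckeDatum.lin, SemidirectProduct.mul_left, SemidirectProduct.left_inr, map_one,
      mul_one, one_mul, SemidirectProduct.right_inr]
    rfl
  have h1 : (w'⁻¹).left = (.ofAdd (w'.right⁻¹ • w'.left.toAdd))⁻¹ := by
    rw [SemidirectProduct.inv_left, map_inv]; rfl
  have h2 : w'.right⁻¹ ∈ D.weyl P := inv_mem (show w'.right ∈ D.weyl P from hw')
  have h3 := D.z_mul g⁻¹ g w.left.toAdd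
  rw [inv_mul_cancel] at h3
  have h4 : ∀ x, D.z 1 (.ofAdd x) = 1 := fun x => by
    have := D.z_mul 1 1 x
    rw [one_mul, map_one, one_smul] at this
    exact mul_eq_left.1 this.symm
  rw [h4] at h3
  rw [h1, map_inv, D.z_weyl g⁻¹ h2, h0, toAdd_ofAdd,
    ← eq_inv_of_mul_eq_one_left h3.symm, ofAdd_toAdd, Complex.mul_conj, Complex.normSq_eq_norm_sq]
  rw [show ‖(D.z g w.left : ℂ)‖ = 1 from D.z_norm g w.left.toAdd]
  simp

theorem quad_conj (c : ℝ) : conj (D.quad c) = D.quad c := Complex.conj_ofReal _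

theorem lin_reflection_inv (i : ι) :
    (D.lin (RootPairing.Equiv.reflection D.R i))⁻¹ = D.lin (RootPairing.Equiv.reflection D.R i) := by
  rw [HeckeDatum.lin, ← map_inv, RootPairing.Equiv.reflection_inv]

theorem affRefl_inv (i : ι) : (D.affRefl i)⁻¹ = D.affRefl i := by
  rw [HeckeDatum.affRefl, mul_inv_rev, lin_reflection_inv]
  refine SemidirectProduct.ext ?_ ?_
  · have e : (D.trans (D.R.root i))⁻¹ = D.trans (-D.R.root i) :=
      (map_inv SemidirectProduct.inl _).symm
    rw [e]
    simp only [HeckeDatum.lin, HeckeDatum.trans, SemidirectProduct.mul_left,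
      SemidirectProduct.left_inr, SemidirectProduct.left_inl, map_one, mul_one, one_mul,
      SemidirectProduct.right_inr]
    change Multiplicative.ofAdd (D.R.reflection i (-D.R.root i)) = _
    rw [map_neg, RootPairing.reflection_apply_self, neg_neg]
  · change RootPairing.Equiv.reflection D.R i * 1⁻¹ = 1 * RootPairing.Equiv.reflection D.R i
    simp

theorem starGen_rel {a b : FreeAlgebra ℂ (D.Gen P K)} (h : D.Rel P K a b) :
    FreeAlgebra.lift ℂ D.starGen a = FreeAlgebra.lift ℂ D.starGen b := by
  apply ConjOp.un_injective
  induction h with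
  | one =>
    simp only [genW, FreeAlgebra.lift_ι_apply, map_one, starGen, ConjOp.un_mk, ConjOp.un_one,
      inv_one, nW_one]
  | mul v w h =>
    simp only [genW, FreeAlgebra.lift_ι_apply, map_mul, starGen, ConjOp.un_mk, ConjOp.un_mul,
      mul_inv_rev]
    apply D.nW_mul
    have h' := D.len_inv P (mul_mem v.2 w.2)
    rw [mul_inv_rev] at h'
    rw [InvMemClass.coe_inv, InvMemClass.coe_inv, h', D.len_inv P v.2, D.len_inv P w.2, h,
      add_comm]
  | simple i hi s hs =>
    have e : s⁻¹ = s := Subtype.ext (by rw [InvMemClass.coe_inv, hs, lin_reflection_inv])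
    simp only [genW, FreeAlgebra.lift_ι_apply, map_mul, map_add, map_smul, map_one, starGen,
      ConjOp.un_mk, ConjOp.un_mul, ConjOp.un_add, ConjOp.un_smul, ConjOp.un_one, e, quad_conj]
    rw [nW, ← map_mul, D.toAlg_rel (.simple i hi s hs), map_add, map_smul, map_one]
  | affine i hi s hs =>
    have e : s⁻¹ = s := Subtype.ext (by rw [InvMemClass.coe_inv, hs, affRefl_inv])
    simp only [genW, FreeAlgebra.lift_ι_apply, map_mul, map_add, map_smul, map_one, starGen,
      ConjOp.un_mk, ConjOp.un_mul, ConjOp.un_add, ConjOp.un_smul, ConjOp.un_one, e, quad_conj]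
    rw [nW, ← map_mul, D.toAlg_rel (.affine i hi s hs), map_add, map_smul, map_one]
  | group_one =>
    simp only [genK, FreeAlgebra.lift_ι_apply, map_one, starGen, ConjOp.un_mk, ConjOp.un_one,
      inv_one, nK_one, OneMemClass.coe_one, starCoeff_one, one_smul]
  | group_mul g h =>
    simp only [genK, FreeAlgebra.lift_ι_apply, map_mul, map_smul, starGen, ConjOp.un_mk,
      ConjOp.un_mul, ConjOp.un_smul, smul_mul_smul_comm, nK_mul, mul_inv_rev, smul_smul,
      MulMemClass.coe_mul, InvMemClass.coe_inv]
    rw [← D.starCoeff_mul, mul_comm (D.starCoeff (h : Γ))]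
  | cross g w w' h =>
    have e : ((w⁻¹ : D.aff P) : D.Ext) =
        D.lin (D.act (g⁻¹ : K)) * (w'⁻¹ : D.aff P) * (D.lin (D.act (g⁻¹ : K)))⁻¹ := by
      have e' : D.lin (D.act (g⁻¹ : K)) = (D.lin (D.act g))⁻¹ := by
        rw [InvMemClass.coe_inv, map_inv, HeckeDatum.lin, map_inv]; rfl
      rw [e', InvMemClass.coe_inv, InvMemClass.coe_inv, h]
      group
    simp only [genK, genW, FreeAlgebra.lift_ι_apply, map_mul, map_smul, starGen, ConjOp.un_mk,
      ConjOp.un_mul, ConjOp.un_smul, smul_mul_assoc, mul_smul_comm]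
    rw [D.nK_mul_nW g⁻¹ w'⁻¹ w⁻¹ e, smul_smul, smul_smul]
    have e2 := D.z_inv_conj g w'.2 h
    simp only [InvMemClass.coe_inv]
    rw [mul_assoc, mul_comm (conj _), mul_assoc, e2, mul_one]

/-- The involution as a homomorphism to the conjugate opposite algebra. -/
def starHom : D.Alg P K →ₐ[ℂ] ConjOp (D.Alg P K) :=
  RingQuot.liftAlgHom ℂ ⟨FreeAlgebra.lift ℂ D.starGen, fun _ _ h => D.starGen_rel h⟩

theorem starHom_toAlg (a : FreeAlgebra ℂ (D.Gen P K)) :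
    D.starHom (D.toAlg P K a) = FreeAlgebra.lift ℂ D.starGen a :=
  RingQuot.liftAlgHom_mkAlgHom_apply ..

/-- The conjugate-linear involution `*_P` of `H^P ⋊ ℂ[K, ♮]`, with `N_w^* = N_{w⁻¹}` for
`w ∈ W_P ⋉ X`. -/
instance : Star (D.Alg P K) where
  star a := ConjOp.un (D.starHom a)

theorem star_def (a : D.Alg P K) : star a = ConjOp.un (D.starHom a) := rfl

theorem star_nW (w : D.aff P) : star (D.nW P K w) = D.nW P K w⁻¹ := by
  rw [star_def, nW, starHom_toAlg, genW, FreeAlgebra.lift_ι_apply]; rfl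

theorem star_nK (g : K) : star (D.nK P K g) = D.starCoeff g • D.nK P K g⁻¹ := by
  rw [star_def, nK, starHom_toAlg, genK, FreeAlgebra.lift_ι_apply]; rfl

theorem star_smul' (c : ℂ) (a : D.Alg P K) : star (c • a) = conj c • star a := by
  rw [star_def, map_smul, ConjOp.un_smul]; rfl

theorem star_mul' (a b : D.Alg P K) : star (a * b) = star b * star a := by
  rw [star_def, map_mul, ConjOp.un_mul]; rfl

theorem star_add' (a b : D.Alg P K) : star (a + b) = star a + star b := by
  rw [star_def, map_add, ConjOp.un_add]; rfl

theorem star_star' (a : D.Alg P K) : star (star a) = a := by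
  obtain ⟨a, rfl⟩ : ∃ b, D.toAlg P K b = a := RingQuot.mkAlgHom_surjective ℂ (D.Rel P K) a
  induction a using FreeAlgebra.induction with
  | grade0 c =>
    rw [AlgHom.commutes, Algebra.algebraMap_eq_smul_one, star_smul', star_smul', Complex.conj_conj]
    have h : star (1 : D.Alg P K) = 1 := by rw [star_def, map_one, ConjOp.un_one]
    rw [h, h]
  | grade1 x =>
    cases x with
    | inl w =>
      change star (star (D.nW P K w)) = D.nW P K w
      rw [star_nW, star_nW, inv_inv]
    | inr g =>
      change star (star (D.nK P K g)) = D.nK P K g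
      rw [star_nK, star_smul', star_nK, smul_smul, inv_inv, InvMemClass.coe_inv, starCoeff_inv,
        one_smul]
  | mul a b ha hb => rw [map_mul, star_mul', star_mul', ha, hb]
  | add a b ha hb => rw [map_add, star_add', star_add', ha, hb]

instance : StarRing (D.Alg P K) where
  star_involutive := D.star_star'
  star_mul := D.star_mul'
  star_add := D.star_add'

instance : StarModule ℂ (D.Alg P K) where
  star_smul c a := D.star_smul' c a

end Star

/-! ### Parabolic subalgebras -/

section Parabolic

open Classical in
/-- The element `N_w` of `H^P ⋊ ℂ[K, ♮]` for `w ∈ W_P ⋉ X` (and zero for other `w`). -/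
def N (P : Set ι) (K : Subgroup Γ) (w : D.Ext) : D.Alg P K :=
  if h : w ∈ D.aff P then D.nW P K ⟨w, h⟩ else 0

open Classical in
/-- The element `N_g` of `H^P ⋊ ℂ[K, ♮]` for `g ∈ K` (and zero for other `g`). -/
def NG (P : Set ι) (K : Subgroup Γ) (g : Γ) : D.Alg P K :=
  if h : g ∈ K then D.nK P K ⟨g, h⟩ else 0

/-- The torus `T = Hom(X, ℂˣ) = Irr(ℂ[X])`. -/
abbrev Torus (_D : TwistedDatum ι X Y Γ) : Type _ := Multiplicative X →* ℂˣ

/-- The action of `Γ` on `T`: `(g t)(θ_x) = t(g⁻¹(θ_x))`. -/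
def actTorus (g : Γ) (t : D.Torus) : D.Torus :=
  D.z g⁻¹ * t.comp (D.autHom (D.act g⁻¹)).toMonoidHom

/-- The subtorus `T^P = Hom(X / (X ∩ ℚP), ℂˣ)`. -/
def torusUpper (P : Set ι) : Set D.Torus :=
  {t | ∀ x : X, (∃ n : ℤ, n ≠ 0 ∧ n • x ∈ AddSubgroup.closure (D.R.root '' P)) → t (.ofAdd x) = 1}

/-- The subtorus `T_P = Hom(X / (P^∨)^⊥, ℂˣ)`. -/
def torusLower (P : Set ι) : Set D.Torus :=
  {t | ∀ x : X, (∀ i ∈ P, D.R.toLinearMap x (D.R.coroot i) = 0) → t (.ofAdd x) = 1}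

/-- The embedding of `Γ` in `Aut(R) × Γ`. The group `W ⋊ Γ` is identified with a subgroup of
`Aut(R) × Γ` by `u g ↦ (u g, g)`. -/
def emb : Γ →* D.R.Aut × Γ := D.act.prod (MonoidHom.id Γ)

/-- The conditions on the subgroups `Γ_P ⊆ Γ`, for `P ⊆ Δ`. -/
structure ParabolicCondition (G : Set ι → Subgroup Γ) : Prop where
  mono : ∀ P Q, P ⊆ Q → Q ⊆ D.simple → G P ≤ G Q
  stab : ∀ P ⊆ D.simple, ∀ g ∈ G P, ∀ i ∈ P, D.act g • i ∈ P
  stab_upper : ∀ P ⊆ D.simple, ∀ g ∈ G P, ∀ t ∈ D.torusUpper P, D.actTorus g t ∈ D.torusUpper P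
  stab_lower : ∀ P ⊆ D.simple, ∀ g ∈ G P, ∀ t ∈ D.torusLower P, D.actTorus g t ∈ D.torusLower P
  mul_upper : ∀ P ⊆ D.simple, ∀ g ∈ G P, ∃ k ∈ D.torusLower P ∩ D.torusUpper P,
    ∀ t ∈ D.torusUpper P, D.actTorus g t = k * t
  /-- if `γ = u g ∈ W ⋊ Γ` and `γ(P) = Q ⊆ Δ`, then `γ Γ_P γ⁻¹ = Γ_Q` -/
  conjugate : ∀ u ∈ D.weyl D.simple, ∀ (g : Γ), ∀ P ⊆ D.simple, ∀ Q ⊆ D.simple,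
    (fun i => (u * D.act g) • i) '' P = Q →
      ((G P).map D.emb).map (MulAut.conj (u * D.act g, g)).toMonoidHom = (G Q).map D.emb
  coc_empty : ∀ g ∈ G ∅, ∀ h ∈ G ∅, D.coc g h = 1

/-- The algebra `H ⋊ ℂ[Γ, ♮]`. -/
abbrev Full : Type _ := D.Alg D.simple ⊤

/-- The algebra `H^P ⋊ ℂ[Γ_P, ♮]`. -/
abbrev Par (G : Set ι → Subgroup Γ) (P : Set ι) : Type _ := D.Alg P (G P)

/-- The element `N_w` of `H ⋊ ℂ[Γ, ♮]`, for `w ∈ W ⋉ X`. -/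
abbrev NFull (w : D.Ext) : D.Full := D.N D.simple ⊤ w

/-- The element `N_g` of `H ⋊ ℂ[Γ, ♮]`, for `g ∈ Γ`. -/
abbrev NGFull (g : Γ) : D.Full := D.NG D.simple ⊤ g

/-- `τ` is the trace of `H ⋊ ℂ[Γ, ♮]`: `τ(N_w N_g) = 1` if `w = 1` and `g = 1`, and
`τ(N_w N_g) = 0` otherwise. -/
def IsTrace (τ : D.Full →ₗ[ℂ] ℂ) : Prop :=
  τ 1 = 1 ∧ ∀ w ∈ D.aff D.simple, ∀ g : Γ, (w ≠ 1 ∨ g ≠ 1) → τ (D.NFull w * D.NGFull g) = 0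

/-- `j` is the embedding of `H^P ⋊ ℂ[Γ_P, ♮]` as the parabolic subalgebra of `H ⋊ ℂ[Γ, ♮]`
generated by the `θ_x` with `x ∈ X`, the `N_w` with `w ∈ W_P` and the `N_g` with `g ∈ Γ_P`.
In both algebras `θ_x = N_{t_y} N_{t_z}⁻¹` whenever `x = y - z` with `y` and `z` dominant (with
respect to `Δ`, so also with respect to `P`), hence `j(θ_x) = θ_x` for all `x ∈ X` if and only if
`j(N_{t_y}) = N_{t_y}` for all dominant `y`. -/
structure IsParabolicEmbedding (G : Set ι → Subgroup Γ) (P : Set ι)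
    (j : D.Par G P →ₐ[ℂ] D.Full) : Prop where
  injective : Function.Injective j
  theta : ∀ y, D.Dominant y → j (D.N P (G P) (D.trans y)) = D.NFull (D.trans y)
  weyl : ∀ u ∈ D.weyl P, j (D.N P (G P) (D.lin u)) = D.NFull (D.lin u)
  group : ∀ g ∈ G P, j (D.NG P (G P) g) = D.NGFull g

/-- `ψ` is the isomorphism `ψ_{ΔP} : H^P ⋊ ℂ[Γ_P, ♮] → H^Q ⋊ ℂ[Γ_Q, ♮]`, where `Q = P^op`:
`N_w ↦ N_{w_Δ w_P w w_P w_Δ}` for `w ∈ W_P ⋉ X`, and `N_g ↦ N_g` for `g ∈ Γ_P` (such `g` commute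
with `w_Δ` and `w_P`). -/
def IsPsi (G : Set ι → Subgroup Γ) (P : Set ι)
    (ψ : D.Par G P ≃⋆ₐ[ℂ] D.Par G (D.op P)) : Prop :=
  (∀ w ∈ D.aff P, ψ (D.N P (G P) w) = D.N (D.op P) (G (D.op P))
    (D.lin (D.longest D.simple) * D.lin (D.longest P) * w *
      D.lin (D.longest P) * D.lin (D.longest D.simple))) ∧
  ∀ g ∈ G P, ψ (D.NG P (G P) g) = D.NG (D.op P) (G (D.op P)) g

/-- The subspace `H(Γ^P W^P)` of `H ⋊ ℂ[Γ, ♮]` spanned by the `N_g N_w` with `g ∈ Γ^P` and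
`w ∈ W^P`, for a set `Γ^P ⊆ Γ` (used for sets of representatives of `Γ / Γ_P`). -/
def repSpan (P : Set ι) (GP : Set Γ) : Submodule ℂ D.Full :=
  Submodule.span ℂ {h | ∃ g ∈ GP, ∃ w ∈ D.minReps P, h = D.NGFull g * D.NFull (D.lin w)}

end Parabolic

end TwistedDatum

end

/-!
# Hermitian duals and parabolic induction and restriction for twisted affine Hecke algebras

Write `B = H ⋊ ℂ[Γ, ♮]`, and `B_P = H^P ⋊ ℂ[Γ_P, ♮]` for the abstract algebra given by generators
and relations. Everything rests on two devices: signed hyperplane counts, and translations that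
lie far out in the cone orthogonal to `R_P`.

*Lengths.* For `w ∈ W ⋉ X` and a root `α` let `cr w α` be the signed number of hyperplanes `⟨·,
α^∨⟩ = k` between the fundamental alcove and its image under `w`. These counts form a cocycle
(`cr_mul`), their absolute values add up to twice the length (`two_mul_len_eq`), and lengths add
in a product if and only if the counts have compatible signs (`len_mul_iff`). This replaces the
Coxeter theory of the affine Weyl group, and it applies to all `W_P ⋉ X` at once.

*The Iwahori--Matsumoto basis and the trace.* `B_P` acts on functions on `(W_P ⋉ X) × Γ_P`, where
left multiplications are pinned down by commuting with right multiplications (`leftOps_ext`). A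
matrix coefficient of this regular representation is the trace `τ`. The elements `N_w N_g` form an
orthogonal basis for the pairing `τ(a^* b)`, which is therefore nondegenerate
(`Admissible.tau_star_mul`, `Admissible.eq_zero_of_tau`).

*The embedding.* Let `t` be the translation by a large multiple of the sum of the positive roots
outside `R_P`. It commutes with `W_P ⋉ X`, and the hyperplane counts of `y t` for the roots
outside `R_P` have the signs of these roots. Hence `N_{y t} N_t⁻¹` does not depend on `t`
(`stab`), and `N_y ↦ N_{y t} N_t⁻¹` respects products along which lengths add in `W_P ⋉ X`
(`stab_mul`). The quadratic relation of an affine reflection `r` of `W_P ⋉ X` holds because `ℓ(r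
t) = ℓ(t) + 1` (`len_aref_mul_tr`), and strong exchange then makes `N_{r t} N_t⁻¹` a conjugate of
the generator of a simple affine reflection of `W ⋉ X` (`exists_quadratic_factor`). This gives
`j_P : B_P → B` (`Admissible.embed`).

*Induction.* The algebra `B` is the sum of the cosets `N_g N_u j_P(B_P)` with `g ∈ Γ^P`, `u ∈
W^P`. After multiplication by a far away `N_t` on the right, `τ(a^* b)` makes these cosets
orthogonal and restricts to the pairing of `B_P` on each of them (`Admissible.tau_coset`). So
`j_P` has an adjoint `E : B → B_P`, with `E(b j_P(a)) = E(b) a` and `E(j_P(a^*)^* b) = a E(b)`,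
for which the `N_g N_u` are orthogonal (`Admissible.expect`, `Admissible.expect_coset`). The
pairing `⟨b' ⊗ λ, b ⊗ v⟩ = λ(E(b'^* b) v)` is then well defined, equivariant and perfect
(`exists_induced_dual_equiv`), and on the span of the `N_g N_u` it is `τ(b' b^*) λ(v)`
(`Admissible.expect_repSpan`).

*Restriction.* The involutions of `B` and `B_P` do not agree along `j_P`. But `w_Δ w_P` turns far
away translations for `P` into inverses of such translations for `P^op`, and comparing two
factorizations of `N_{t⁻¹ y w_P w_Δ}` gives `j_P(a^*)^* N_{w_P w_Δ} = N_{w_P w_Δ} j_{P^op}(ψ(a))`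
(`Admissible.star_embed_star_mul`). Since `N_{w_P w_Δ}` is invertible, precomposition with it, or
with its adjoint, is the required isomorphism (`exists_dual_restrict_equiv`,
`exists_restrict_dual_equiv`).
-/

noncomputable section

namespace HeckeDatum

variable {ι X Y : Type*} [Fintype ι] [AddCommGroup X] [AddCommGroup Y] (D : HeckeDatum ι X Y)

/-! ### Positive roots of parabolic subsystems -/

instance : D.R.IsReduced := D.reduced

/-- The pairing `⟨x, α^∨⟩` of `x` with the coroot of index `i`. -/
def pr (x : X) (i : ι) : ℤ := D.R.toLinearMap x (D.R.coroot i)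

/-- The index of the root `-α`. -/
def opp (i : ι) : ι := D.R.reflectionPerm i i

/-- The reflection `s_α` as an automorphism of the root datum. -/
abbrev refl (i : ι) : D.R.Aut := RootPairing.Equiv.reflection D.R i

theorem pr_add (x y : X) (i : ι) : D.pr (x + y) i = D.pr x i + D.pr y i := by simp [pr]

theorem pr_zero (i : ι) : D.pr 0 i = 0 := by simp [pr]

theorem pr_neg (x : X) (i : ι) : D.pr (-x) i = -D.pr x i := by simp [pr]

theorem pr_sub (x y : X) (i : ι) : D.pr (x - y) i = D.pr x i - D.pr y i := by simp [pr]

theorem pr_zsmul (n : ℤ) (x : X) (i : ι) : D.pr (n • x) i = n * D.pr x i := by simp [pr]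

theorem pr_nsmul (n : ℕ) (x : X) (i : ι) : D.pr (n • x) i = n * D.pr x i := by simp [pr]

theorem pr_sum {α : Type*} (s : Finset α) (f : α → X) (i : ι) :
    D.pr (∑ a ∈ s, f a) i = ∑ a ∈ s, D.pr (f a) i := by simp [pr]

theorem pr_self (i : ι) : D.pr (D.R.root i) i = 2 := by simp [pr]

theorem pr_smul (u : D.R.Aut) (x : X) (i : ι) : D.pr (u • x) (u • i) = D.pr x i :=
  D.pair_smul u x i

theorem pr_smul_left (u : D.R.Aut) (x : X) (i : ι) : D.pr (u • x) i = D.pr x (u⁻¹ • i) := by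
  rw [← D.pr_smul u x, smul_inv_smul]

theorem root_smul (u : D.R.Aut) (i : ι) : D.R.root (u • i) = u • D.R.root i :=
  RootPairing.Equiv.root_indexEquiv_eq_smul (P := D.R) i u

theorem root_opp (i : ι) : D.R.root (D.opp i) = -D.R.root i := by
  rw [opp, D.R.root_reflectionPerm, RootPairing.reflection_apply_self]

theorem coroot_opp (i : ι) : D.R.coroot (D.opp i) = -D.R.coroot i := by
  rw [opp, D.R.coroot_reflectionPerm, RootPairing.coreflection_apply_self]

theorem pr_opp (x : X) (i : ι) : D.pr x (D.opp i) = -D.pr x i := by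
  rw [pr, coroot_opp, map_neg]; rfl

theorem opp_opp (i : ι) : D.opp (D.opp i) = i := by
  apply D.R.root.injective; rw [root_opp, root_opp, neg_neg]

theorem smul_opp (u : D.R.Aut) (i : ι) : u • D.opp i = D.opp (u • i) := by
  apply D.R.root.injective; rw [root_smul, root_opp, root_opp, root_smul, smul_neg]

theorem isPos_opp (i : ι) : D.base.IsPos (D.opp i) ↔ ¬ D.base.IsPos i :=
  RootPairing.Base.IsPos.neg_iff_not D.base i

theorem opp_ne (i : ι) : D.opp i ≠ i := fun h => by
  have := D.isPos_opp i
  rw [h] at this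
  tauto

theorem refl_smul (j : ι) (x : X) : D.refl j • x = x - D.pr x j • D.R.root j := rfl

theorem refl_smul_self (j : ι) : D.refl j • j = D.opp j := rfl

theorem root_refl (j i : ι) :
    D.R.root (D.refl j • i) = D.R.root i - D.pr (D.R.root i) j • D.R.root j := by
  rw [root_smul, refl_smul]

theorem coroot_refl (j i : ι) :
    D.R.coroot (D.refl j • i) = D.R.coroot i - D.pr (D.R.root j) i • D.R.coroot j :=
  (D.R.reflectionPerm_coroot j i).symm

theorem refl_refl (j i : ι) : D.refl j • D.refl j • i = i := D.R.reflectionPerm_self j i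

theorem refl_mul_self (j : ι) : D.refl j * D.refl j = 1 := by
  have h := RootPairing.Equiv.reflection_inv D.R j
  nth_rewrite 2 [refl]
  rw [← h, mul_inv_cancel]

variable {D} in
theorem eq_opp_of_refl_smul {i j : ι} (h : D.refl j • i = j) : i = D.opp j := by
  have := congrArg (fun k => D.refl j • k) h
  simp only [refl_refl, refl_smul_self] at this
  exact this

theorem pr_refl (x : X) (j i : ι) :
    D.pr x (D.refl j • i) = D.pr x i - D.pr (D.R.root j) i * D.pr x j := by
  rw [pr, coroot_refl]; simp [pr]

theorem ext_aut {u v : D.R.Aut} (h : ∀ x : X, u • x = v • x) : u = v :=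
  RootPairing.Equiv.weightHom_injective D.R (LinearEquiv.ext h)

theorem conj_refl (u : D.R.Aut) (i : ι) : u * D.refl i * u⁻¹ = D.refl (u • i) := by
  apply D.ext_aut
  intro x
  rw [mul_smul, mul_smul, refl_smul, refl_smul, smul_sub, smul_inv_smul, smul_comm, ← root_smul,
    pr_smul_left, inv_inv]

theorem refl_opp (i : ι) : D.refl (D.opp i) = D.refl i := by
  apply D.ext_aut
  intro x
  rw [refl_smul, refl_smul, pr_opp, root_opp, smul_neg, neg_smul, neg_neg]

theorem mem_sub_of_mem {P : Set ι} {i : ι} (h : i ∈ P) : i ∈ D.sub P :=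
  AddSubgroup.subset_closure ⟨i, h, rfl⟩

theorem opp_mem_sub {P : Set ι} {i : ι} : D.opp i ∈ D.sub P ↔ i ∈ D.sub P := by
  simp only [sub, Set.mem_ofPred_eq, root_opp, neg_mem_iff]

theorem smul_mem_sub_iff {P : Set ι} {u : D.R.Aut} (hu : u ∈ D.weyl P) {i : ι} :
    u • i ∈ D.sub P ↔ i ∈ D.sub P :=
  ⟨fun h => by simpa using D.smul_mem_sub (inv_mem hu) h, D.smul_mem_sub hu⟩

theorem sub_simple : D.sub D.simple = Set.univ := by
  refine Set.eq_univ_of_forall fun i => ?_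
  have hle : AddSubmonoid.closure (D.R.root '' D.base.support) ≤
      (AddSubgroup.closure (D.R.root '' D.simple)).toAddSubmonoid :=
    (AddSubmonoid.closure_le).2 AddSubgroup.subset_closure
  rcases D.base.root_mem_or_neg_mem i with h | h
  · exact hle h
  · have := hle h
    exact (neg_mem_iff (H := AddSubgroup.closure (D.R.root '' D.simple))).1 this

theorem refl_mem_weyl {P : Set ι} {i : ι} (h : i ∈ D.sub P) : D.refl i ∈ D.weyl P :=
  Subgroup.subset_closure ⟨i, h, rfl⟩

theorem refl_mem_weyl_simple (i : ι) : D.refl i ∈ D.weyl D.simple :=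
  D.refl_mem_weyl (by rw [sub_simple]; trivial)

theorem sub_mono {P Q : Set ι} (h : P ⊆ Q) : D.sub P ⊆ D.sub Q := fun _ hi =>
  AddSubgroup.closure_mono (Set.image_mono h) hi

theorem weyl_mono {P Q : Set ι} (h : P ⊆ Q) : D.weyl P ≤ D.weyl Q :=
  Subgroup.closure_mono (Set.image_mono (D.sub_mono h))

variable {D}

theorem isPos_simple {i : ι} (h : i ∈ D.simple) : D.base.IsPos i :=
  RootPairing.Base.isPos_of_mem_support h

theorem isPos_refl {i j : ι} (hj : j ∈ D.simple) (hi : D.base.IsPos i) (hij : i ≠ j) :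
    D.base.IsPos (D.refl j • i) := hi.reflectionPerm hj hij

/-- A simple reflection changes only the sign of the simple root and its opposite. -/
theorem isPos_refl_iff {i j : ι} (hj : j ∈ D.simple) (h1 : i ≠ j) (h2 : i ≠ D.opp j) :
    D.base.IsPos (D.refl j • i) ↔ D.base.IsPos i := by
  refine ⟨fun h => ?_, fun h => isPos_refl hj h h1⟩
  have := isPos_refl hj h (fun h3 => h2 (eq_opp_of_refl_smul h3))
  rwa [refl_refl] at this

/-- A positive root of `R_P` that is not in `P` can be made lower by a reflection from `P`. -/
theorem exists_pos_pr {P : Set ι} (hP : P ⊆ D.simple) {i : ι} (hi : i ∈ D.sub P)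
    (hpos : D.base.IsPos i) : ∃ j ∈ P, 0 < D.pr (D.R.root j) i := by
  classical
  obtain ⟨f, hf, hf1, hf2⟩ := D.base.exists_root_eq_sum_int i
  have hf3 : 0 < f := by
    refine hf1.resolve_right fun h => ?_
    rw [RootPairing.Base.isPos_iff, RootPairing.Base.height_eq_sum hf2] at hpos
    exact absurd hpos (not_lt.2 (Finset.sum_nonpos fun j _ => h.le j))
  obtain ⟨g, hg, hg2⟩ : ∃ g : ι → ℤ, (∀ j, g j ≠ 0 → j ∈ P) ∧
      D.R.root i = ∑ j ∈ D.base.support, g j • D.R.root j := by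
    have : ∀ x ∈ AddSubgroup.closure (D.R.root '' P), ∃ g : ι → ℤ, (∀ j, g j ≠ 0 → j ∈ P) ∧
        x = ∑ j ∈ D.base.support, g j • D.R.root j := by
      intro x hx
      induction hx using AddSubgroup.closure_induction with
      | mem x hx =>
        obtain ⟨j, hj, rfl⟩ := hx
        refine ⟨Pi.single j 1, fun k hk => ?_, ?_⟩
        · by_contra h
          exact hk (Pi.single_eq_of_ne (fun h' : k = j => h (by rwa [h'])) _)
        · rw [Finset.sum_eq_single_of_mem j (hP hj)]
          · simp
          · intro b _ hb; simp [Pi.single_eq_of_ne hb]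
      | zero => exact ⟨0, by simp, by simp⟩
      | add x y _ _ hx hy =>
        obtain ⟨f, hf, rfl⟩ := hx
        obtain ⟨g, hg, rfl⟩ := hy
        refine ⟨f + g, fun j hj => ?_, by simp [add_smul, Finset.sum_add_distrib]⟩
        by_contra h
        exact hj (by simp [not_imp_comm.1 (hf j) h, not_imp_comm.1 (hg j) h])
      | neg x _ hx =>
        obtain ⟨f, hf, rfl⟩ := hx
        exact ⟨-f, fun j hj => hf j (by simpa using hj), by simp⟩
    exact this _ hi
  have hfg : ∀ j ∈ D.base.support, f j = g j := by
    have h := hf2.symm.trans hg2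
    rw [← sub_eq_zero, ← Finset.sum_sub_distrib] at h
    simp_rw [← sub_smul] at h
    have := linearIndepOn_finset_iff.1 D.base.linearIndepOn_root (fun j => f j - g j) h
    exact fun j hj => sub_eq_zero.1 (this j hj)
  by_contra! hcon
  have h2 : D.pr (D.R.root i) i = ∑ j ∈ D.base.support, f j * D.pr (D.R.root j) i := by
    conv_lhs => rw [hf2]
    rw [pr_sum]
    simp_rw [pr_zsmul]
  rw [pr_self] at h2
  have : ∑ j ∈ D.base.support, f j * D.pr (D.R.root j) i ≤ 0 := by
    refine Finset.sum_nonpos fun j hj => ?_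
    by_cases h : f j = 0
    · simp [h]
    · exact mul_nonpos_of_nonneg_of_nonpos (hf3.le j) (hcon j (hg j (hfg j hj ▸ h)))
  omega

theorem pairingIn_eq (i j : ι) : D.R.pairingIn ℤ i j = D.pr (D.R.root i) j :=
  D.R.algebraMap_pairingIn ℤ i j

theorem pr_root_pos_comm {i j : ι} : 0 < D.pr (D.R.root i) j ↔ 0 < D.pr (D.R.root j) i := by
  rw [← pairingIn_eq, ← pairingIn_eq]
  exact D.R.zero_lt_pairingIn_iff' ℤ

theorem refl_mem_sub {P : Set ι} {i j : ι} (hj : j ∈ P) (hi : i ∈ D.sub P) :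
    D.refl j • i ∈ D.sub P :=
  D.smul_mem_sub (D.refl_mem_weyl (D.mem_sub_of_mem hj)) hi

/-- Induction over the positive roots of `R_P`: every such root is obtained from a root in `P` by
simple reflections from `P` which increase the root. -/
theorem pos_sub_induction {P : Set ι} (hP : P ⊆ D.simple) {p : ι → Prop} (h1 : ∀ j ∈ P, p j)
    (h2 : ∀ i j, j ∈ P → i ∈ D.sub P → D.base.IsPos i → D.pr (D.R.root j) i < 0 → p i →
      p (D.refl j • i)) {i : ι} (hi : i ∈ D.sub P) (hpos : D.base.IsPos i) : p i := by
  generalize hN : (D.base.height i).natAbs = N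
  induction N using Nat.strongRecOn generalizing i with
  | ind n ih =>
    obtain ⟨j, hj, hj'⟩ := exists_pos_pr hP hi hpos
    rcases eq_or_ne i j with rfl | hij
    · exact h1 i hj
    have hk := isPos_refl (hP hj) hpos hij
    have hroot : D.R.root (D.refl j • i) =
        D.R.root i + (-D.pr (D.R.root i) j) • D.R.root j := by
      rw [root_refl, neg_smul, sub_eq_add_neg]
    have hht := D.base.height_add_zsmul hroot
    rw [RootPairing.Base.height_one_of_mem_support (hP hj)] at hht
    have hpr := pr_root_pos_comm.1 hj'
    rw [RootPairing.Base.isPos_iff] at hpos hk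
    have := h2 (D.refl j • i) j hj (refl_mem_sub hj hi) hk
      (by rw [pr_refl, pr_self]; linarith) (ih _ (by simp only [smul_eq_mul] at hht; omega)
        (refl_mem_sub hj hi) hk rfl)
    rwa [refl_refl] at this

theorem coroot_mem_cone {P : Set ι} (hP : P ⊆ D.simple) {i : ι} (hi : i ∈ D.sub P)
    (hpos : D.base.IsPos i) : D.R.coroot i ∈ AddSubmonoid.closure (D.R.coroot '' P) := by
  refine pos_sub_induction hP (p := fun i => D.R.coroot i ∈ AddSubmonoid.closure (D.R.coroot '' P))
    (fun j hj => AddSubmonoid.subset_closure ⟨j, hj, rfl⟩) (fun i j hj _ _ hneg h => ?_) hi hpos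
  rw [coroot_refl, sub_eq_add_neg, ← neg_smul]
  obtain ⟨n, hn⟩ := Int.eq_ofNat_of_zero_le (show 0 ≤ -D.pr (D.R.root j) i by omega)
  rw [hn, natCast_zsmul]
  exact add_mem h (nsmul_mem (AddSubmonoid.subset_closure (Set.mem_image_of_mem _ hj)) n)

theorem root_mem_cone {P : Set ι} (hP : P ⊆ D.simple) {i : ι} (hi : i ∈ D.sub P)
    (hpos : D.base.IsPos i) : D.R.root i ∈ AddSubmonoid.closure (D.R.root '' P) := by
  refine pos_sub_induction hP (p := fun i => D.R.root i ∈ AddSubmonoid.closure (D.R.root '' P))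
    (fun j hj => AddSubmonoid.subset_closure ⟨j, hj, rfl⟩) (fun i j hj _ _ hneg h => ?_) hi hpos
  have hneg' : D.pr (D.R.root i) j ≤ 0 := by
    by_contra h'
    have := pr_root_pos_comm.1 (not_le.1 h')
    omega
  rw [root_refl, sub_eq_add_neg, ← neg_smul]
  obtain ⟨n, hn⟩ := Int.eq_ofNat_of_zero_le (show 0 ≤ -D.pr (D.R.root i) j by omega)
  rw [hn, natCast_zsmul]
  exact add_mem h (nsmul_mem (AddSubmonoid.subset_closure (Set.mem_image_of_mem _ hj)) n)

/-- The group `W_P` is generated by the simple reflections from `P`. -/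
theorem weyl_eq_closure {P : Set ι} (hP : P ⊆ D.simple) :
    D.weyl P = Subgroup.closure (D.refl '' P) := by
  refine le_antisymm ((Subgroup.closure_le _).2 ?_)
    (Subgroup.closure_mono (Set.image_mono fun i hi => D.mem_sub_of_mem hi))
  have key : ∀ i ∈ D.sub P, D.base.IsPos i → D.refl i ∈ Subgroup.closure (D.refl '' P) := by
    intro i hi hpos
    refine pos_sub_induction hP (p := fun i => D.refl i ∈ Subgroup.closure (D.refl '' P))
      (fun j hj => Subgroup.subset_closure ⟨j, hj, rfl⟩) (fun i j hj _ _ _ h => ?_) hi hpos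
    have hj' : D.refl j ∈ Subgroup.closure (D.refl '' P) := Subgroup.subset_closure ⟨j, hj, rfl⟩
    rw [← conj_refl]
    exact mul_mem (mul_mem hj' h) (inv_mem hj')
  rintro _ ⟨i, hi, rfl⟩
  by_cases hpos : D.base.IsPos i
  · exact key i hi hpos
  · change D.refl i ∈ _
    rw [← refl_opp]
    exact key _ (D.opp_mem_sub.2 hi) ((D.isPos_opp i).2 hpos)

theorem smul_isPos_of_not_mem {P : Set ι} (hP : P ⊆ D.simple) {u : D.R.Aut} (hu : u ∈ D.weyl P)
    {i : ι} (hi : i ∉ D.sub P) : D.base.IsPos (u • i) ↔ D.base.IsPos i := by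
  have hu' := hu
  rw [weyl_eq_closure hP] at hu'
  clear hu
  induction hu' using Subgroup.closure_induction generalizing i with
  | mem v hv =>
    obtain ⟨j, hj, rfl⟩ := hv
    refine isPos_refl_iff (hP hj) ?_ ?_
    · rintro rfl; exact hi (D.mem_sub_of_mem hj)
    · rintro rfl; exact hi (D.opp_mem_sub.2 (D.mem_sub_of_mem hj))
  | one => rw [one_smul]
  | mul v w hv hw h1 h2 =>
    rw [← weyl_eq_closure hP] at hv hw
    rw [mul_smul]
    exact (h1 (i := w • i) (by rwa [D.smul_mem_sub_iff hw])).trans (h2 hi)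
  | inv v hv h1 =>
    rw [← weyl_eq_closure hP] at hv
    have := h1 (i := v⁻¹ • i) (by rwa [D.smul_mem_sub_iff (inv_mem hv)])
    rw [smul_inv_smul] at this
    exact this.symm

/-! ### The action of `W_P` on the positive systems of `R_P` is free -/

/-- The exchange condition in `W_P`. -/
theorem exchange {P : Set ι} (hP : P ⊆ D.simple) {j : ι} (hj : j ∈ P) (l : List ι)
    (hl : ∀ i ∈ l, i ∈ P) (hneg : ¬ D.base.IsPos ((l.map D.refl).prod • j)) :
    ∃ l' : List ι, (∀ i ∈ l', i ∈ P) ∧ l'.length + 1 = l.length ∧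
      (l.map D.refl).prod * D.refl j = (l'.map D.refl).prod := by
  induction l with
  | nil => exact absurd (isPos_simple (hP hj)) (by simpa using hneg)
  | cons a l ih =>
    have hl' : ∀ i ∈ l, i ∈ P := fun i hi => hl i (List.mem_cons_of_mem _ hi)
    have ha : a ∈ P := hl a List.mem_cons_self
    simp only [List.map_cons, List.prod_cons] at hneg ⊢
    by_cases h : D.base.IsPos ((l.map D.refl).prod • j)
    · have e : (l.map D.refl).prod • j = a := by
        by_contra hne
        rw [mul_smul] at hneg
        exact hneg (isPos_refl (hP ha) h hne)
      refine ⟨l, hl', rfl, ?_⟩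
      have h1 : (l.map D.refl).prod * D.refl j = D.refl a * (l.map D.refl).prod := by
        have := D.conj_refl (l.map D.refl).prod j
        rw [e] at this
        rw [← this, inv_mul_cancel_right]
      rw [mul_assoc, h1, ← mul_assoc, refl_mul_self, one_mul]
    · obtain ⟨l', h1, h2, h3⟩ := ih hl' h
      refine ⟨a :: l', ?_, by simp [h2], ?_⟩
      · intro i hi
        rcases List.mem_cons.1 hi with rfl | hi
        · exact ha
        · exact h1 i hi
      · rw [mul_assoc, h3]; simp

theorem exists_word {P : Set ι} (hP : P ⊆ D.simple) {u : D.R.Aut} (hu : u ∈ D.weyl P) :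
    ∃ l : List ι, (∀ i ∈ l, i ∈ P) ∧ u = (l.map D.refl).prod := by
  rw [weyl_eq_closure hP] at hu
  induction hu using Subgroup.closure_induction with
  | mem v hv =>
    obtain ⟨j, hj, rfl⟩ := hv
    exact ⟨[j], by simpa using hj, by simp⟩
  | one => exact ⟨[], by simp, rfl⟩
  | mul v w _ _ hv hw =>
    obtain ⟨l, h1, rfl⟩ := hv
    obtain ⟨m, h2, rfl⟩ := hw
    refine ⟨l ++ m, fun i hi => ?_, by simp⟩
    rcases List.mem_append.1 hi with h | h
    · exact h1 i h
    · exact h2 i h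
  | inv v _ hv =>
    obtain ⟨l, h1, rfl⟩ := hv
    refine ⟨l.reverse, fun i hi => h1 i (List.mem_reverse.1 hi), ?_⟩
    rw [List.prod_inv_reverse, List.map_map, List.map_reverse]
    congr 3
    funext i
    exact RootPairing.Equiv.reflection_inv D.R i

/-- An element of `W_P` that maps `P` to positive roots is trivial. -/
theorem eq_one_of_isPos {P : Set ι} (hP : P ⊆ D.simple) {u : D.R.Aut} (hu : u ∈ D.weyl P)
    (h : ∀ j ∈ P, D.base.IsPos (u • j)) : u = 1 := by
  obtain ⟨l, hl, rfl⟩ := exists_word hP hu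
  generalize hn : l.length = n
  induction n using Nat.strongRecOn generalizing l with
  | ind n ih =>
    rcases List.eq_nil_or_concat l with rfl | ⟨m, j, rfl⟩
    · rfl
    rw [List.concat_eq_append] at *
    have hm : ∀ i ∈ m, i ∈ P := fun i hi => hl i (List.mem_append_left _ hi)
    have hj : j ∈ P := hl j (List.mem_append_right _ (List.mem_singleton_self j))
    have e : ((m ++ [j]).map D.refl).prod = (m.map D.refl).prod * D.refl j := by simp
    have hneg : ¬ D.base.IsPos ((m.map D.refl).prod • j) := by
      have := h j hj
      rwa [e, mul_smul, refl_smul_self, smul_opp, isPos_opp] at this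
    obtain ⟨l', h1, h2, h3⟩ := exchange hP hj m hm hneg
    rw [e, h3] at h hu ⊢
    exact ih _ (by rw [← hn]; simp; omega) l' h1 hu h rfl

/-! ### A weight that is positive outside `R_P` -/

variable (D) in
open Classical in
/-- The sum of the positive roots outside `R_P`. It is orthogonal to `P^∨`, and its pairing with
the positive coroots outside `R_P^∨` is positive. -/
def mu (P : Set ι) : X := ∑ i with D.base.IsPos i ∧ i ∉ D.sub P, D.R.root i

theorem smul_mu {P : Set ι} {u : D.R.Aut}
    (hu : ∀ i, (D.base.IsPos (u • i) ∧ u • i ∉ D.sub P) ↔ (D.base.IsPos i ∧ i ∉ D.sub P)) :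
    u • D.mu P = D.mu P := by
  classical
  have h : u • D.mu P = ∑ i with D.base.IsPos i ∧ i ∉ D.sub P, D.R.root (u • i) := by
    rw [mu, Finset.smul_sum]
    exact Finset.sum_congr rfl fun i _ => (D.root_smul u i).symm
  rw [h]
  refine Finset.sum_nbij' (fun i => u • i) (fun i => u⁻¹ • i) ?_ ?_ ?_ ?_ ?_
  · intro i hi
    simpa [hu] using hi
  · intro i hi
    have := hu (u⁻¹ • i)
    rw [smul_inv_smul] at this
    simpa [← this] using hi
  · intro i _; exact inv_smul_smul _ i
  · intro i _; exact smul_inv_smul _ i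
  · intro i _; rfl

theorem weyl_smul_mu {P : Set ι} (hP : P ⊆ D.simple) {u : D.R.Aut} (hu : u ∈ D.weyl P) :
    u • D.mu P = D.mu P := by
  refine smul_mu fun i => ?_
  rw [D.smul_mem_sub_iff hu]
  by_cases h : i ∈ D.sub P
  · simp [h]
  · simp [h, smul_isPos_of_not_mem hP hu h]

theorem root_ne_zero (i : ι) : D.R.root i ≠ 0 := fun h => by
  have := D.pr_self i
  rw [h, pr_zero] at this
  omega

theorem zsmul_root_injective (i : ι) {m n : ℤ} (h : m • D.R.root i = n • D.R.root i) : m = n := by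
  have := congrArg (fun x => D.pr x i) h
  simp only [pr_zsmul, pr_self] at this
  omega

theorem pr_mu_of_mem {P : Set ι} (hP : P ⊆ D.simple) {i : ι} (hi : i ∈ D.sub P) :
    D.pr (D.mu P) i = 0 := by
  have h := weyl_smul_mu hP (D.refl_mem_weyl hi)
  have h2 := D.pr_smul (D.refl i) (D.mu P) i
  rw [h, refl_smul_self, pr_opp] at h2
  omega

/-- Distinct simple roots form obtuse angles. -/
theorem pr_simple_nonpos {i j : ι} (hi : i ∈ D.simple) (hj : j ∈ D.simple) (h : i ≠ j) :
    D.pr (D.R.root i) j ≤ 0 := by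
  rw [← pairingIn_eq]
  exact D.base.pairingIn_le_zero_of_ne h hi hj

open Classical in
theorem mu_empty_eq (P : Set ι) : D.mu ∅ = D.mu P +
    ∑ i with D.base.IsPos i ∧ i ∈ D.sub P, D.R.root i := by
  have h0 : ∀ i, i ∉ D.sub ∅ := fun i hi => by
    simp only [sub, Set.image_empty, AddSubgroup.closure_empty] at hi
    exact root_ne_zero i hi
  rw [mu, mu, add_comm, ← Finset.sum_filter_add_sum_filter_not
    (Finset.univ.filter fun i => D.base.IsPos i ∧ i ∉ D.sub ∅) (fun i => i ∈ D.sub P),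
    Finset.filter_filter, Finset.filter_filter]
  simp only [h0, not_false_eq_true, and_true]

/-- The weight `mu ∅` is the sum `2ρ` of all positive roots. -/
theorem pr_mu_empty {j : ι} (hj : j ∈ D.simple) : D.pr (D.mu ∅) j = 2 := by
  classical
  have h0 : ∀ i, i ∉ D.sub ∅ := fun i hi => by
    simp only [sub, Set.image_empty, AddSubgroup.closure_empty] at hi
    exact root_ne_zero i hi
  have h1 : D.mu ∅ = D.R.root j + ∑ i with D.base.IsPos i ∧ i ≠ j, D.R.root i := by
    have : (Finset.univ.filter fun i => D.base.IsPos i ∧ i ∉ D.sub ∅) =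
        insert j (Finset.univ.filter fun i => D.base.IsPos i ∧ i ≠ j) := by
      ext i
      have := isPos_simple hj
      by_cases h : i = j
      · subst h; simp [h0, this]
      · simp [h0, h]
    rw [mu, this, Finset.sum_insert (by simp)]
  have h2 : D.refl j • (∑ i with D.base.IsPos i ∧ i ≠ j, D.R.root i) =
      ∑ i with D.base.IsPos i ∧ i ≠ j, D.R.root i := by
    rw [Finset.smul_sum]
    simp_rw [← root_smul]
    have key : ∀ i, D.base.IsPos i → i ≠ j → D.base.IsPos (D.refl j • i) ∧ D.refl j • i ≠ j := by
      intro i hi hij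
      refine ⟨isPos_refl hj hi hij, fun h => ?_⟩
      rw [eq_opp_of_refl_smul h, isPos_opp] at hi
      exact hi (isPos_simple hj)
    refine Finset.sum_nbij' (fun i => D.refl j • i) (fun i => D.refl j • i) ?_ ?_ ?_ ?_ ?_
    · intro i hi
      simp only [Finset.mem_filter, Finset.mem_univ, true_and] at hi ⊢
      exact key i hi.1 hi.2
    · intro i hi
      simp only [Finset.mem_filter, Finset.mem_univ, true_and] at hi ⊢
      exact key i hi.1 hi.2
    · intro i _; exact refl_refl D j i
    · intro i _; exact refl_refl D j i
    · intro i _; rfl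
  have h3 := D.pr_smul (D.refl j) (∑ i with D.base.IsPos i ∧ i ≠ j, D.R.root i) j
  rw [h2, refl_smul_self, pr_opp] at h3
  rw [h1, pr_add, pr_self]
  omega

/-- The pairing of `2ρ` with `α^∨` is `2`, and the positive roots of `R_P`, which make up the rest
of `2ρ`, pair non-positively with the coroots of the other simple roots. -/
theorem pr_mu_pos_simple {P : Set ι} (hP : P ⊆ D.simple) {j : ι} (hj : j ∈ D.simple)
    (hjP : j ∉ P) : 0 < D.pr (D.mu P) j := by
  classical
  have h := pr_mu_empty hj
  rw [mu_empty_eq P, pr_add, pr_sum] at h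
  have h2 : ∑ i with D.base.IsPos i ∧ i ∈ D.sub P, D.pr (D.R.root i) j ≤ 0 := by
    refine Finset.sum_nonpos fun i hi => ?_
    simp only [Finset.mem_filter, Finset.mem_univ, true_and] at hi
    have : ∀ x ∈ AddSubmonoid.closure (D.R.root '' P), D.pr x j ≤ 0 := by
      intro x hx
      induction hx using AddSubmonoid.closure_induction with
      | mem x hx =>
        obtain ⟨k, hk, rfl⟩ := hx
        exact pr_simple_nonpos (hP hk) hj (fun h => hjP (h ▸ hk))
      | zero => rw [pr_zero]
      | add x y _ _ h1 h2 => rw [pr_add]; omega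
    exact this _ (root_mem_cone hP hi.2 hi.1)
  omega

theorem pr_mu_nonneg_simple {P : Set ι} (hP : P ⊆ D.simple) {j : ι} (hj : j ∈ D.simple) :
    0 ≤ D.pr (D.mu P) j := by
  by_cases h : j ∈ P
  · rw [pr_mu_of_mem hP (D.mem_sub_of_mem h)]
  · exact (pr_mu_pos_simple hP hj h).le

theorem pr_mu_nonneg {P : Set ι} (hP : P ⊆ D.simple) {i : ι} (hi : D.base.IsPos i) :
    0 ≤ D.pr (D.mu P) i := by
  have : ∀ y ∈ AddSubmonoid.closure (D.R.coroot '' D.simple),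
      0 ≤ D.R.toLinearMap (D.mu P) y := by
    intro y hy
    induction hy using AddSubmonoid.closure_induction with
    | mem y hy => obtain ⟨k, hk, rfl⟩ := hy; exact pr_mu_nonneg_simple hP hk
    | zero => simp
    | add x y _ _ h1 h2 => rw [map_add]; omega
  exact this _ (coroot_mem_cone subset_rfl (by rw [sub_simple]; trivial) hi)

theorem pr_mu_pos {P : Set ι} (hP : P ⊆ D.simple) {i : ι} (hi : D.base.IsPos i)
    (hiP : i ∉ D.sub P) : 0 < D.pr (D.mu P) i := by
  have key : i ∉ D.sub P → 0 < D.pr (D.mu P) i := by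
    refine pos_sub_induction (P := D.simple) subset_rfl
      (p := fun i => i ∉ D.sub P → 0 < D.pr (D.mu P) i) ?_ ?_
      (by rw [sub_simple]; trivial) hi
    · intro j hj h
      exact pr_mu_pos_simple hP hj (fun h' => h (D.mem_sub_of_mem h'))
    · intro i j hj _ hpos hneg ih h
      rw [pr_refl]
      have h1 := pr_mu_nonneg_simple hP hj
      by_cases hjP : j ∈ P
      · have h2 : i ∉ D.sub P := fun h' => h (refl_mem_sub hjP h')
        nlinarith [ih h2]
      · have h2 := pr_mu_pos_simple hP hj hjP
        nlinarith [pr_mu_nonneg hP hpos]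
  exact key hiP

/-- Pairing with `2ρ` detects the sign of a root. -/
theorem isPos_iff_pr (i : ι) : D.base.IsPos i ↔ 0 < D.pr (D.mu ∅) i := by
  have h0 : ∀ i, i ∉ D.sub ∅ := fun i hi => by
    simp only [sub, Set.image_empty, AddSubgroup.closure_empty] at hi
    exact root_ne_zero i hi
  refine ⟨fun h => pr_mu_pos (Set.empty_subset _) h (h0 i), fun h => ?_⟩
  by_contra h'
  have := pr_mu_pos (Set.empty_subset _) ((D.isPos_opp i).2 h') (h0 _)
  rw [pr_opp] at this
  omega

theorem pr_mu_neg {P : Set ι} (hP : P ⊆ D.simple) {i : ι} (hi : ¬ D.base.IsPos i)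
    (hiP : i ∉ D.sub P) : D.pr (D.mu P) i < 0 := by
  have := pr_mu_pos hP ((D.isPos_opp i).2 hi) (by rwa [opp_mem_sub])
  rw [pr_opp] at this
  omega

end HeckeDatum

namespace HeckeDatum

variable {ι X Y : Type*} [Fintype ι] [AddCommGroup X] [AddCommGroup Y] {D : HeckeDatum ι X Y}

/-! ### Signed hyperplane counts and the length function -/

variable (D) in
open Classical in
/-- The indicator of the negative roots. -/
def eps (i : ι) : ℤ := if D.base.IsPos i then 0 else 1

theorem eps_pos {i : ι} (h : D.base.IsPos i) : D.eps i = 0 := if_pos h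

theorem eps_neg {i : ι} (h : ¬ D.base.IsPos i) : D.eps i = 1 := if_neg h

theorem eps_opp (i : ι) : D.eps (D.opp i) = 1 - D.eps i := by
  by_cases h : D.base.IsPos i
  · rw [eps_pos h, eps_neg (fun h' => (D.isPos_opp i).1 h' h)]; rfl
  · rw [eps_neg h, eps_pos ((D.isPos_opp i).2 h)]; rfl

theorem eps_mem (i : ι) : D.eps i = 0 ∨ D.eps i = 1 := by
  by_cases h : D.base.IsPos i
  · exact .inl (eps_pos h)
  · exact .inr (eps_neg h)

/-- The signed number of hyperplanes `⟨·, α^∨⟩ = k`, with `k ∈ ℤ`, that separate the fundamental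
alcove from its image under `w`. -/
def cr (w : D.Ext) (i : ι) : ℤ := D.pr w.left.toAdd i + D.eps i - D.eps (w.right⁻¹ • i)

/-- The signed hyperplane counts form a cocycle on `W ⋉ X`. -/
theorem cr_mul (v w : D.Ext) (i : ι) : cr (v * w) i = cr v i + cr w (v.right⁻¹ • i) := by
  have h1 : (v * w).left.toAdd = v.left.toAdd + v.right • w.left.toAdd := rfl
  have h2 : (v * w).right⁻¹ • i = w.right⁻¹ • v.right⁻¹ • i := by
    rw [SemidirectProduct.mul_right, mul_inv_rev, mul_smul]
  rw [cr, cr, cr, h1, h2, pr_add, pr_smul_left]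
  ring

theorem cr_one (i : ι) : cr (1 : D.Ext) i = 0 := by
  have h : (1 : D.Ext).left.toAdd = 0 := rfl
  rw [cr, h, pr_zero, SemidirectProduct.one_right, inv_one, one_smul]
  ring

theorem cr_opp (w : D.Ext) (i : ι) : cr w (D.opp i) = -cr w i := by
  rw [cr, cr, pr_opp, eps_opp, smul_opp, eps_opp]
  ring

theorem cr_trans (x : X) (i : ι) : cr (D.trans x) i = D.pr x i := by
  have h : (D.trans x).right⁻¹ • i = i := by
    rw [trans, SemidirectProduct.right_inl, inv_one, one_smul]
  have h' : (D.trans x).left.toAdd = x := rfl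
  rw [cr, h, h']
  ring

theorem cr_lin (u : D.R.Aut) (i : ι) : cr (D.lin u) i = D.eps i - D.eps (u⁻¹ • i) := by
  have h' : (D.lin u).left.toAdd = 0 := rfl
  have h2 : (D.lin u).right = u := rfl
  rw [cr, h', h2, pr_zero]
  ring

open Classical in
/-- Each pair of opposite roots contributes twice to the sum of the absolute counts. -/
theorem two_mul_len_eq (P : Set ι) (w : D.Ext) :
    2 * D.len P w = ∑ i with i ∈ D.sub P, (cr w i).natAbs := D.two_mul_len P w

open Classical in
theorem len_eq (P : Set ι) (w : D.Ext) :
    D.len P w = ∑ i with i ∈ D.sub P ∧ D.base.IsPos i, (cr w i).natAbs := by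
  refine Finset.sum_congr rfl fun i hi => ?_
  simp only [Finset.mem_filter, Finset.mem_univ, true_and] at hi
  rw [cr, eps_pos hi.2, add_zero]
  rfl

theorem len_eq_zero_iff {P : Set ι} {w : D.Ext} :
    D.len P w = 0 ↔ ∀ i ∈ D.sub P, cr w i = 0 := by
  classical
  have h := two_mul_len_eq P w
  constructor
  · intro h0 i hi
    rw [h0, mul_zero, eq_comm, Finset.sum_eq_zero_iff] at h
    simpa using h i (by simpa using hi)
  · intro h0
    rw [Finset.sum_eq_zero fun i hi => by rw [h0 i (by simpa using hi)]; rfl] at h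
    omega

theorem natAbs_cr_le {P : Set ι} (w : D.Ext) {i : ι} (hi : i ∈ D.sub P) :
    (cr w i).natAbs ≤ 2 * D.len P w := by
  classical
  rw [two_mul_len_eq]
  exact Finset.single_le_sum (f := fun i => (cr w i).natAbs) (fun _ _ => Nat.zero_le _)
    (by simpa using hi)

open Classical in
theorem sum_smul_sub {P : Set ι} {u : D.R.Aut} (hu : u ∈ D.weyl P) (f : ι → ℕ) :
    ∑ i with i ∈ D.sub P, f (u⁻¹ • i) = ∑ i with i ∈ D.sub P, f i := by
  refine Finset.sum_nbij' (fun i => u⁻¹ • i) (fun i => u • i) ?_ ?_ ?_ ?_ ?_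
  · intro i hi
    simpa [D.smul_mem_sub_iff (inv_mem hu)] using hi
  · intro i hi
    simpa [D.smul_mem_sub_iff hu] using hi
  · intro i _; exact smul_inv_smul _ i
  · intro i _; exact inv_smul_smul _ i
  · intro i _; rfl

/-- Lengths add if and only if no hyperplane is crossed twice. -/
theorem len_mul_iff {P : Set ι} {v : D.Ext} (hv : v ∈ D.aff P) (w : D.Ext) :
    D.len P (v * w) = D.len P v + D.len P w ↔
      ∀ i ∈ D.sub P, 0 ≤ cr v i * cr w (v.right⁻¹ • i) := by
  classical
  have h1 := two_mul_len_eq P (v * w)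
  have h2 := two_mul_len_eq P v
  have h3 := two_mul_len_eq P w
  rw [← sum_smul_sub (P := P) (u := v.right) hv] at h3
  have h4 : D.len P (v * w) = D.len P v + D.len P w ↔ ∑ i with i ∈ D.sub P, (cr (v * w) i).natAbs
      = ∑ i with i ∈ D.sub P, ((cr v i).natAbs + (cr w (v.right⁻¹ • i)).natAbs) := by
    rw [Finset.sum_add_distrib]; omega
  rw [h4, Finset.sum_eq_sum_iff_of_le
    (fun i _ => by rw [cr_mul]; exact Int.natAbs_add_le _ _)]
  simp only [Finset.mem_filter, Finset.mem_univ, true_and]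
  refine forall₂_congr fun i _ => ?_
  rw [cr_mul]
  have key : ∀ a b : ℤ, (a + b).natAbs = a.natAbs + b.natAbs ↔ 0 ≤ a * b := by
    intro a b
    rw [mul_nonneg_iff]
    omega
  exact key _ _

theorem lin_mem_aff {P : Set ι} {u : D.R.Aut} (hu : u ∈ D.weyl P) : D.lin u ∈ D.aff P := hu

theorem trans_mem_aff {P : Set ι} (x : X) : D.trans x ∈ D.aff P :=
  Subgroup.mem_comap.2 (by rw [trans, SemidirectProduct.rightHom_inl]; exact one_mem _)

theorem aff_mono {P Q : Set ι} (h : P ⊆ Q) : D.aff P ≤ D.aff Q := fun _ hw => D.weyl_mono h hw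

theorem mem_aff {P : Set ι} {w : D.Ext} : w ∈ D.aff P ↔ w.right ∈ D.weyl P := Iff.rfl

theorem len_one (P : Set ι) : D.len P (1 : D.Ext) = 0 := len_eq_zero_iff.2 fun i _ => cr_one i

/-! ### Affine reflections -/

variable (D) in
/-- The reflection `t_{kα} s_α` in the hyperplane `⟨·, α^∨⟩ = k`. -/
def aref (i : ι) (k : ℤ) : D.Ext := D.trans (k • D.R.root i) * D.lin (D.refl i)

theorem aref_left (i : ι) (k : ℤ) : (D.aref i k).left.toAdd = k • D.R.root i := by
  change k • D.R.root i + (1 : D.R.Aut) • (0 : X) = _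
  rw [smul_zero, add_zero]

theorem aref_right (i : ι) (k : ℤ) : (D.aref i k).right = D.refl i := by
  change 1 * D.refl i = _
  rw [one_mul]

theorem ext_of_toAdd {v w : D.Ext} (h : v.left.toAdd = w.left.toAdd) (h' : v.right = w.right) :
    v = w := SemidirectProduct.ext (Multiplicative.toAdd.injective h) h'

theorem aref_zero (i : ι) : D.aref i 0 = D.lin (D.refl i) := by
  refine ext_of_toAdd ?_ ?_
  · rw [aref_left, zero_smul]; rfl
  · rw [aref_right]; rfl

theorem aref_one (i : ι) : D.aref i 1 = D.affRefl i := by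
  rw [aref, one_smul]; rfl

theorem refl_inv (i : ι) : (D.refl i)⁻¹ = D.refl i := RootPairing.Equiv.reflection_inv D.R i

theorem aref_mul_self (i : ι) (k : ℤ) : D.aref i k * D.aref i k = 1 := by
  refine ext_of_toAdd ?_ ?_
  · change (D.aref i k).left.toAdd + (D.aref i k).right • (D.aref i k).left.toAdd = 0
    rw [aref_left, aref_right, refl_smul, pr_zsmul, pr_self]
    module
  · rw [SemidirectProduct.mul_right, aref_right, refl_mul_self]; rfl

theorem aref_mul_aref_mul (i : ι) (k : ℤ) (w : D.Ext) : D.aref i k * (D.aref i k * w) = w := by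
  rw [← mul_assoc, aref_mul_self, one_mul]

theorem aref_opp (i : ι) (k : ℤ) : D.aref (D.opp i) (-k) = D.aref i k := by
  refine ext_of_toAdd ?_ ?_
  · rw [aref_left, aref_left, root_opp, smul_neg, neg_smul, neg_neg]
  · rw [aref_right, aref_right, refl_opp]

theorem mul_aref (w : D.Ext) (i : ι) (k : ℤ) :
    w * D.aref i k = D.aref (w.right • i) (k + D.pr w.left.toAdd (w.right • i)) * w := by
  refine ext_of_toAdd ?_ ?_
  · change w.left.toAdd + w.right • (D.aref i k).left.toAdd =
      (D.aref (w.right • i) (k + D.pr w.left.toAdd (w.right • i))).left.toAdd +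
        (D.aref (w.right • i) (k + D.pr w.left.toAdd (w.right • i))).right • w.left.toAdd
    rw [aref_left, aref_left, aref_right, refl_smul, root_smul, smul_comm w.right]
    generalize w.right • D.R.root i = r
    module
  · rw [SemidirectProduct.mul_right, SemidirectProduct.mul_right, aref_right, aref_right,
      ← conj_refl, inv_mul_cancel_right]

theorem refl_eq_refl {i j : ι} (h : D.refl i = D.refl j) : j = i ∨ j = D.opp i := by
  have h1 := congrArg (fun u => u • D.R.root i) h
  simp only [refl_smul, pr_self] at h1
  have h2 : ¬ LinearIndependent ℤ ![D.R.root j, D.R.root i] := by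
    rw [LinearIndependent.pair_iff]
    intro h3
    have := (h3 (-D.pr (D.R.root i) j) 2 (by
      rw [sub_right_injective h1, neg_smul, neg_add_cancel])).2
    omega
  rcases RootPairing.IsReduced.eq_or_eq_neg (P := D.R) j i h2 with h3 | h3
  · exact .inl (D.R.root.injective h3)
  · rw [← root_opp] at h3
    exact .inr (D.R.root.injective h3)

theorem aref_eq_aref {i j : ι} {k l : ℤ} (h : D.aref i k = D.aref j l) :
    (j = i ∧ l = k) ∨ (j = D.opp i ∧ l = -k) := by
  have h1 := congrArg SemidirectProduct.right h
  rw [aref_right, aref_right] at h1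
  have h2 := congrArg (fun w => w.left.toAdd) h
  simp only [aref_left] at h2
  rcases refl_eq_refl h1 with rfl | rfl
  · exact .inl ⟨rfl, (zsmul_root_injective _ h2).symm⟩
  · rw [root_opp, smul_neg, ← neg_smul] at h2
    exact .inr ⟨rfl, by rw [zsmul_root_injective _ h2, neg_neg]⟩

theorem aref_mem_aff {P : Set ι} {i : ι} (hi : i ∈ D.sub P) (k : ℤ) : D.aref i k ∈ D.aff P := by
  rw [mem_aff, aref_right]; exact D.refl_mem_weyl hi

theorem cr_aref (j : ι) (k : ℤ) (i : ι) :
    cr (D.aref j k) i = k * D.pr (D.R.root j) i + D.eps i - D.eps (D.refl j • i) := by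
  rw [cr, aref_left, aref_right, pr_zsmul, refl_inv]

variable (D) in
/-- The parameter of the reflection in the hyperplane `⟨·, α^∨⟩ = k`: it is `λ(α)` if `k` is even
and `λ*(α)` if `k` is odd. -/
def par (i : ι) (k : ℤ) : ℝ := if Even k then D.lam i else D.lamStar i

theorem lam_weyl {u : D.R.Aut} (hu : u ∈ D.weyl D.simple) (i : ι) :
    D.lam (u • i) = D.lam i ∧ D.lamStar (u • i) = D.lamStar i := by
  induction hu using Subgroup.closure_induction generalizing i with
  | mem v hv =>
    obtain ⟨j, _, rfl⟩ := hv
    exact ⟨D.lam_reflection j i, D.lamStar_reflection j i⟩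
  | one => simp
  | mul v w _ _ hv hw => rw [mul_smul, (hv _).1, (hv _).2]; exact hw i
  | inv v _ hv => rw [← (hv (v⁻¹ • i)).1, ← (hv (v⁻¹ • i)).2, smul_inv_smul]; exact ⟨rfl, rfl⟩

/-- The parameters are invariant under conjugation by `W ⋉ X`. -/
theorem par_conj {w : D.Ext} (hw : w ∈ D.aff D.simple) (i : ι) (k : ℤ) :
    D.par (w.right • i) (k + D.pr w.left.toAdd (w.right • i)) = D.par i k := by
  have hl : D.lam (w.right • i) = D.lam i ∧ D.lamStar (w.right • i) = D.lamStar i :=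
    lam_weyl (D := D) hw i
  by_cases h : D.lamStar i = D.lam i
  · simp only [par, hl.1, hl.2, h, ite_self]
  · have h2 : ∃ y : Y, D.R.coroot (w.right • i) = (2 : ℤ) • y := by
      by_contra hcon
      exact h (by rw [← hl.1, ← hl.2, D.lamStar_eq _ hcon])
    obtain ⟨y, hy⟩ := h2
    have h3 : Even (D.pr w.left.toAdd (w.right • i)) := by
      rw [pr, hy, map_zsmul]; exact ⟨D.R.toLinearMap w.left.toAdd y, by simp [two_mul]⟩
    have h4 : Even (k + D.pr w.left.toAdd (w.right • i)) ↔ Even k := by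
      rw [Int.even_add]; tauto
    simp only [par, hl.1, hl.2, h4]

theorem par_opp (i : ι) (k : ℤ) : D.par (D.opp i) (-k) = D.par i k := by
  have := lam_weyl (D.refl_mem_weyl_simple i) i
  rw [refl_smul_self] at this
  simp only [par, this.1, this.2, even_neg]

theorem par_eq_of_aref_eq {i j : ι} {k l : ℤ} (h : D.aref i k = D.aref j l) :
    D.par i k = D.par j l := by
  rcases aref_eq_aref h with ⟨rfl, rfl⟩ | ⟨rfl, rfl⟩
  · rfl
  · rw [par_opp]

theorem par_eq_of_conj {w : D.Ext} (hw : w ∈ D.aff D.simple) {i j : ι} {k l : ℤ}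
    (h : D.aref i k * w = w * D.aref j l) : D.par i k = D.par j l := by
  rw [mul_aref] at h
  rw [par_eq_of_aref_eq (mul_right_cancel h), par_conj hw]

/-! ### Simple affine reflections -/

theorem cone_pointed {P : Set ι} (hP : P ⊆ D.simple) {y : Y}
    (hy : y ∈ AddSubmonoid.closure (D.R.coroot '' P)) :
    0 < D.R.toLinearMap (D.mu ∅) y ∨ y = 0 := by
  induction hy using AddSubmonoid.closure_induction with
  | mem y hy =>
    obtain ⟨j, hj, rfl⟩ := hy
    exact .inl ((isPos_iff_pr j).1 (isPos_simple (hP hj)))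
  | zero => exact .inr rfl
  | add x y _ _ h1 h2 =>
    rcases h1 with h1 | rfl
    · rcases h2 with h2 | rfl
      · left; rw [map_add]; omega
      · left; rwa [add_zero]
    · rwa [zero_add]

theorem isPos_of_mem_cone {P : Set ι} (hP : P ⊆ D.simple) {i : ι}
    (h : D.R.coroot i ∈ AddSubmonoid.closure (D.R.coroot '' P)) : D.base.IsPos i := by
  rw [isPos_iff_pr]
  exact (cone_pointed hP h).resolve_right fun h0 => by
    have := D.pr_self i
    rw [pr, h0, map_zero] at this
    omega

theorem IsMaxCoroot.isPos {P : Set ι} (hP : P ⊆ D.simple) {i : ι} (h : D.IsMaxCoroot P i) :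
    D.base.IsPos i := by
  by_contra hneg
  have h1 := coroot_mem_cone hP (D.opp_mem_sub.2 h.1) ((D.isPos_opp i).2 hneg)
  refine D.opp_ne i (h.2 _ (D.opp_mem_sub.2 h.1) ?_)
  have : D.R.coroot (D.opp i) - D.R.coroot i = D.R.coroot (D.opp i) + D.R.coroot (D.opp i) := by
    rw [coroot_opp]; abel
  rw [this]
  exact add_mem h1 h1

theorem exists_isMaxCoroot {P : Set ι} (hP : P ⊆ D.simple) {i : ι} (hi : i ∈ D.sub P) :
    ∃ j, D.IsMaxCoroot P j ∧
      D.R.coroot j - D.R.coroot i ∈ AddSubmonoid.closure (D.R.coroot '' P) := by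
  classical
  let s : Finset ι := Finset.univ.filter fun j => j ∈ D.sub P ∧
    D.R.coroot j - D.R.coroot i ∈ AddSubmonoid.closure (D.R.coroot '' P)
  obtain ⟨j, hj, hmax⟩ := s.exists_max_image (fun j => D.pr (D.mu ∅) j)
    ⟨i, by simp [s, hi]⟩
  simp only [s, Finset.mem_filter, Finset.mem_univ, true_and] at hj hmax
  refine ⟨j, ⟨hj.1, fun k hk hkj => ?_⟩, hj.2⟩
  have h1 := hmax k ⟨hk, by simpa using add_mem hkj hj.2⟩
  rcases cone_pointed hP hkj with h2 | h2
  · rw [map_sub] at h2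
    simp only [pr] at h1
    omega
  · exact D.R.coroot.injective (sub_eq_zero.1 h2)

variable (D) in
/-- The reflection in `⟨·, α^∨⟩ = k` is one of the simple affine reflections of `W_P ⋉ X`. -/
def IsSimpleAff (P : Set ι) (j : ι) (k : ℤ) : Prop := (k = 0 ∧ j ∈ P) ∨ (k = 1 ∧ D.IsMaxCoroot P j)

theorem IsSimpleAff.mem_sub {P : Set ι} {j : ι} {k : ℤ} (h : D.IsSimpleAff P j k) :
    j ∈ D.sub P := by
  rcases h with ⟨_, h⟩ | ⟨_, h⟩
  · exact D.mem_sub_of_mem h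
  · exact h.1

theorem IsSimpleAff.isPos {P : Set ι} (hP : P ⊆ D.simple) {j : ι} {k : ℤ}
    (h : D.IsSimpleAff P j k) : D.base.IsPos j := by
  rcases h with ⟨_, h⟩ | ⟨_, h⟩
  · exact isPos_simple (hP h)
  · exact h.isPos hP

theorem IsSimpleAff.eq {P : Set ι} {j : ι} {k : ℤ} (h : D.IsSimpleAff P j k) : k = 0 ∨ k = 1 := by
  rcases h with ⟨h, _⟩ | ⟨h, _⟩
  · exact .inl h
  · exact .inr h

theorem IsSimpleAff.mem_aff {P : Set ι} {j : ι} {k : ℤ} (h : D.IsSimpleAff P j k) :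
    D.aref j k ∈ D.aff P := aref_mem_aff h.mem_sub k

theorem IsSimpleAff.cr_self {P : Set ι} (hP : P ⊆ D.simple) {j : ι} {k : ℤ}
    (h : D.IsSimpleAff P j k) : cr (D.aref j k) j = 2 * k - 1 := by
  rw [cr_aref, pr_self, refl_smul_self, eps_opp, eps_pos (h.isPos hP)]
  ring

/-- If `β^∨` is a maximal coroot, then `⟨β, α^∨⟩ ∈ {0, 1}` for the other positive roots `α`, and the
value is `1` exactly if `s_β` makes `α` negative. Hence `t_β s_β` crosses only one hyperplane. -/
theorem IsMaxCoroot.eps_refl {P : Set ι} (hP : P ⊆ D.simple) {j i : ι} (h : D.IsMaxCoroot P j)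
    (hi : i ∈ D.sub P) (hpos : D.base.IsPos i) (hij : i ≠ j) :
    D.pr (D.R.root j) i = D.eps (D.refl j • i) := by
  have hjc := coroot_mem_cone hP h.1 (h.isPos hP)
  have hic := coroot_mem_cone hP hi hpos
  have hb : D.refl j • i ∈ D.sub P := D.smul_mem_sub (D.refl_mem_weyl h.1) hi
  have hne : i ≠ D.opp j := fun e => by
    rw [e, isPos_opp] at hpos; exact hpos (h.isPos hP)
  have hco := D.coroot_refl j i
  rcases lt_trichotomy (D.pr (D.R.root j) i) 0 with hm | hm | hm
  · exfalso
    obtain ⟨n, hn⟩ := Int.eq_ofNat_of_zero_le (show 0 ≤ -D.pr (D.R.root j) i - 1 by omega)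
    have : D.refl j • i = j := by
      refine h.2 _ hb ?_
      have e : D.R.coroot (D.refl j • i) - D.R.coroot j = D.R.coroot i + n • D.R.coroot j := by
        rw [hco, ← natCast_zsmul, ← hn]; module
      rw [e]
      exact add_mem hic (nsmul_mem hjc n)
    exact hne (eq_opp_of_refl_smul this)
  · have : D.refl j • i = i := by
      apply D.R.coroot.injective
      rw [hco, hm, zero_smul, sub_zero]
    rw [this, hm, eps_pos hpos]
  · obtain ⟨c, hc, hcc⟩ : ∃ c ∈ D.sub P, D.R.coroot c = D.R.coroot j - D.R.coroot i := by
      have h1 : D.R.root j ≠ D.R.root i := fun e => hij (D.R.root.injective e).symm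
      have h2 : D.R.root j ≠ -D.R.root i := fun e => by
        rw [← root_opp] at e
        exact hne (by rw [D.R.root.injective e, opp_opp])
      have h3 := D.R.pairingIn_pairingIn_mem_set_of_isCrystal_of_isRed' j i h1 h2
      rw [pairingIn_eq, pairingIn_eq] at h3
      have h4 : D.pr (D.R.root j) i = 1 ∨ D.pr (D.R.root i) j = 1 := by
        simp only [Set.mem_insert_iff, Set.mem_singleton_iff, Prod.mk.injEq] at h3
        omega
      rcases h4 with h4 | h4
      · refine ⟨D.opp (D.refl j • i), D.opp_mem_sub.2 hb, ?_⟩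
        rw [coroot_opp, hco, h4]; module
      · refine ⟨D.refl i • j, D.smul_mem_sub (D.refl_mem_weyl hi) h.1, ?_⟩
        rw [coroot_refl, h4]; module
    have hcpos : D.base.IsPos c := by
      by_contra hneg
      have h1 := coroot_mem_cone hP (D.opp_mem_sub.2 hc) ((D.isPos_opp c).2 hneg)
      rw [coroot_opp, hcc, neg_sub] at h1
      exact hij (h.2 i hi h1)
    have hccone := coroot_mem_cone hP hc hcpos
    have hle : D.pr (D.R.root j) i ≤ 1 := by
      by_contra hgt
      obtain ⟨n, hn⟩ := Int.eq_ofNat_of_zero_le (show 0 ≤ D.pr (D.R.root j) i - 2 by omega)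
      have : D.opp (D.refl j • i) = j := by
        refine h.2 _ (D.opp_mem_sub.2 hb) ?_
        have e : D.R.coroot (D.opp (D.refl j • i)) - D.R.coroot j
            = n • D.R.coroot j + D.R.coroot c := by
          rw [coroot_opp, hco, hcc, ← natCast_zsmul, ← hn]; module
        rw [e]
        exact add_mem (nsmul_mem hjc n) hccone
      have e2 : D.refl j • i = D.refl j • j := by rw [refl_smul_self, ← this, opp_opp, this]
      exact hij (MulAction.injective _ e2)
    have h1 : D.pr (D.R.root j) i = 1 := by omega
    have h2 : D.base.IsPos (D.opp (D.refl j • i)) := by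
      apply isPos_of_mem_cone hP
      have e : D.R.coroot (D.opp (D.refl j • i)) = D.R.coroot c := by
        rw [coroot_opp, hco, hcc, h1]; module
      rwa [e]
    rw [h1, eps_neg ((D.isPos_opp _).1 h2)]

theorem IsSimpleAff.cr_of_ne {P : Set ι} (hP : P ⊆ D.simple) {j : ι} {k : ℤ}
    (h : D.IsSimpleAff P j k) {i : ι} (hi : i ∈ D.sub P) (h1 : i ≠ j) (h2 : i ≠ D.opp j) :
    cr (D.aref j k) i = 0 := by
  rw [cr_aref]
  rcases h with ⟨rfl, h⟩ | ⟨rfl, h⟩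
  · have h3 := isPos_refl_iff (hP h) h1 h2
    by_cases hpos : D.base.IsPos i
    · rw [eps_pos hpos, eps_pos (h3.2 hpos)]; ring
    · rw [eps_neg hpos, eps_neg (fun h' => hpos (h3.1 h'))]; ring
  · by_cases hpos : D.base.IsPos i
    · rw [h.eps_refl hP hi hpos h1, eps_pos hpos]; ring
    · have h3 := h.eps_refl hP (D.opp_mem_sub.2 hi) ((D.isPos_opp i).2 hpos)
        (fun e => h2 (by rw [← e, opp_opp]))
      rw [pr_opp, smul_opp, eps_opp] at h3
      rw [eps_neg hpos]
      linarith

theorem IsSimpleAff.len {P : Set ι} (hP : P ⊆ D.simple) {j : ι} {k : ℤ}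
    (h : D.IsSimpleAff P j k) : D.len P (D.aref j k) = 1 := by
  classical
  have hj : j ∈ Finset.univ.filter fun i => i ∈ D.sub P ∧ D.base.IsPos i := by
    simp [h.mem_sub, h.isPos hP]
  rw [len_eq, Finset.sum_eq_single_of_mem j hj, h.cr_self hP]
  · rcases h.eq with rfl | rfl <;> rfl
  · intro i hi hij
    simp only [Finset.mem_filter, Finset.mem_univ, true_and] at hi
    rw [h.cr_of_ne hP hi.1 hij, Int.natAbs_zero]
    rintro rfl
    exact (D.isPos_opp j).1 hi.2 (h.isPos hP)

theorem IsSimpleAff.cr_mul_self {P : Set ι} (hP : P ⊆ D.simple) {j : ι} {k : ℤ}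
    (h : D.IsSimpleAff P j k) (w : D.Ext) : cr (D.aref j k * w) j = 2 * k - 1 - cr w j := by
  rw [cr_mul, h.cr_self hP, aref_right, refl_inv, refl_smul_self, cr_opp]; ring

theorem IsSimpleAff.len_mul_of_nonpos {P : Set ι} (hP : P ⊆ D.simple) {j : ι} {k : ℤ}
    (h : D.IsSimpleAff P j k) {w : D.Ext} (hw : (2 * k - 1) * cr w j ≤ 0) :
    D.len P (D.aref j k * w) = D.len P (D.aref j k) + D.len P w := by
  rw [len_mul_iff h.mem_aff]
  intro i hi
  rw [aref_right, refl_inv]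
  by_cases h1 : i = j
  · subst h1
    rw [h.cr_self hP, refl_smul_self, cr_opp]; linarith
  by_cases h2 : i = D.opp j
  · subst h2
    rw [cr_opp, h.cr_self hP, smul_opp, refl_smul_self, opp_opp]; linarith
  rw [h.cr_of_ne hP hi h1 h2, zero_mul]

theorem IsSimpleAff.len_mul_of_pos {P : Set ι} (hP : P ⊆ D.simple) {j : ι} {k : ℤ}
    (h : D.IsSimpleAff P j k) {w : D.Ext} (hw : 0 < (2 * k - 1) * cr w j) :
    D.len P w = D.len P (D.aref j k) + D.len P (D.aref j k * w) := by
  have := h.len_mul_of_nonpos hP (w := D.aref j k * w) (by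
    rw [h.cr_mul_self hP]
    rcases h.eq with rfl | rfl <;> linarith)
  rwa [aref_mul_aref_mul] at this

theorem IsSimpleAff.len_lt_iff {P : Set ι} (hP : P ⊆ D.simple) {j : ι} {k : ℤ}
    (h : D.IsSimpleAff P j k) {w : D.Ext} :
    D.len P (D.aref j k * w) < D.len P w ↔ 0 < (2 * k - 1) * cr w j := by
  have h1 := h.len hP
  by_cases hw : 0 < (2 * k - 1) * cr w j
  · have := h.len_mul_of_pos hP hw
    simp only [hw, iff_true]; omega
  · have := h.len_mul_of_nonpos hP (not_lt.1 hw)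
    simp only [hw, iff_false]; omega

/-- An element of positive length can be shortened by a simple affine reflection. -/
theorem exists_descent {P : Set ι} (hP : P ⊆ D.simple) {w : D.Ext} (hw : D.len P w ≠ 0) :
    ∃ j k, D.IsSimpleAff P j k ∧ 0 < (2 * k - 1) * cr w j := by
  by_contra! hcon
  apply hw
  have hs : ∀ j ∈ P, 0 ≤ cr w j := fun j hj => by
    have := hcon j 0 (.inl ⟨rfl, hj⟩)
    linarith
  have hm : ∀ j, D.IsMaxCoroot P j → cr w j ≤ 0 := fun j hj => by
    have := hcon j 1 (.inr ⟨rfl, hj⟩)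
    linarith
  -- the sign of `u⁻¹ α` is the sign of the pairing of `α^∨` with `u (2ρ)`
  have hsign : ∀ i, D.base.IsPos (w.right⁻¹ • i) ↔ 0 < D.pr (w.right • D.mu ∅) i := fun i => by
    rw [isPos_iff_pr, pr_smul_left]
  set x := w.left.toAdd
  set ν := w.right • D.mu ∅
  have hcone : ∀ y ∈ AddSubmonoid.closure (D.R.coroot '' P), 0 ≤ D.R.toLinearMap x y ∧
      (D.R.toLinearMap x y = 0 → 0 ≤ D.R.toLinearMap ν y) := by
    intro y hy
    induction hy using AddSubmonoid.closure_induction with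
    | mem y hy =>
      obtain ⟨j, hj, rfl⟩ := hy
      have h1 := hs j hj
      rw [cr, eps_pos (isPos_simple (hP hj))] at h1
      change 0 ≤ D.pr x j ∧ (D.pr x j = 0 → 0 ≤ D.pr ν j)
      change 0 ≤ D.pr x j + 0 - _ at h1
      by_cases h2 : D.base.IsPos (w.right⁻¹ • j)
      · rw [eps_pos h2] at h1
        exact ⟨by omega, fun _ => ((hsign j).1 h2).le⟩
      · rw [eps_neg h2] at h1
        exact ⟨by omega, fun _ => by omega⟩
    | zero => simp
    | add y z _ _ h1 h2 =>
      rw [map_add, map_add]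
      refine ⟨by omega, fun h => ?_⟩
      have := h1.2 (by omega)
      have := h2.2 (by omega)
      omega
  rw [len_eq_zero_iff]
  have key : ∀ i ∈ D.sub P, D.base.IsPos i → cr w i = 0 := by
    intro i hi hpos
    obtain ⟨h1, h2⟩ := hcone _ (coroot_mem_cone hP hi hpos)
    change 0 ≤ D.pr x i at h1
    change D.pr x i = 0 → 0 ≤ D.pr ν i at h2
    obtain ⟨j, hj, hji⟩ := exists_isMaxCoroot hP hi
    obtain ⟨h3, h4⟩ := hcone _ hji
    rw [map_sub] at h3 h4
    rw [map_sub] at h4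
    change 0 ≤ D.pr x j - D.pr x i at h3
    change D.pr x j - D.pr x i = 0 → 0 ≤ D.pr ν j - D.pr ν i at h4
    have h5 := hm j hj
    rw [cr, eps_pos (hj.isPos hP)] at h5
    change D.pr x j + 0 - _ ≤ 0 at h5
    rw [cr, eps_pos hpos]
    change D.pr x i + 0 - _ = 0
    by_cases hi' : D.base.IsPos (w.right⁻¹ • i) <;> by_cases hj' : D.base.IsPos (w.right⁻¹ • j)
    · rw [eps_pos hj'] at h5; rw [eps_pos hi']; omega
    · rw [eps_neg hj'] at h5; rw [eps_pos hi']; rw [hsign] at hi' hj'; omega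
    · rw [eps_pos hj'] at h5; rw [eps_neg hi']; rw [hsign, pr] at hi'
      have : D.pr ν i ≠ 0 := by
        intro h0
        have h6 := isPos_iff_pr (D := D) (w.right⁻¹ • D.opp i)
        have h7 := isPos_iff_pr (D := D) (w.right⁻¹ • i)
        rw [smul_opp, isPos_opp, pr_opp, h7, ← pr_smul_left] at h6
        change ¬ 0 < D.pr ν i ↔ 0 < -D.pr ν i at h6
        omega
      change ¬ 0 < D.pr ν i at hi'
      omega
    · rw [eps_neg hj'] at h5; rw [eps_neg hi']
      have : D.pr ν i ≠ 0 := by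
        intro h0
        have h6 := isPos_iff_pr (D := D) (w.right⁻¹ • D.opp i)
        have h7 := isPos_iff_pr (D := D) (w.right⁻¹ • i)
        rw [smul_opp, isPos_opp, pr_opp, h7, ← pr_smul_left] at h6
        change ¬ 0 < D.pr ν i ↔ 0 < -D.pr ν i at h6
        omega
      rw [hsign] at hi'
      omega
  intro i hi
  by_cases hpos : D.base.IsPos i
  · exact key i hi hpos
  · have := key _ (D.opp_mem_sub.2 hi) ((D.isPos_opp i).2 hpos)
    rw [cr_opp] at this
    omega

/-- If right multiplication by a simple affine reflection changes whether the hyperplane of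
another simple affine reflection is crossed, then these two reflections are conjugate by `w`. -/
theorem IsSimpleAff.fold {P : Set ι} (hP : P ⊆ D.simple) {i j : ι} {k l : ℤ}
    (hj : D.IsSimpleAff P j k) (hi : D.IsSimpleAff P i l) {w : D.Ext} (hw : w ∈ D.aff P)
    (h : ¬ (0 < (2 * k - 1) * cr w j ↔ 0 < (2 * k - 1) * cr (w * D.aref i l) j)) :
    D.aref j k * w = w * D.aref i l := by
  rw [mul_aref]
  congr 1
  rw [cr_mul] at h
  have hmem : w.right⁻¹ • j ∈ D.sub P := (D.smul_mem_sub_iff (inv_mem hw)).2 hj.mem_sub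
  by_cases h1 : w.right⁻¹ • j = i
  · have h2 : w.right • i = j := by rw [← h1, smul_inv_smul]
    have h3 : cr w j = D.pr w.left.toAdd j := by
      rw [cr, h1, eps_pos (hj.isPos hP), eps_pos (hi.isPos hP)]; ring
    rw [h1, hi.cr_self hP, h3] at h
    rw [h2]
    congr 1
    rcases hj.eq with rfl | rfl <;> rcases hi.eq with rfl | rfl <;> omega
  by_cases h2 : w.right⁻¹ • j = D.opp i
  · have h4 : w.right • i = D.opp j := by
      rw [← opp_opp D i, smul_opp, ← h2, smul_inv_smul]
    have h3 : cr w j = D.pr w.left.toAdd j - 1 := by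
      rw [cr, h2, eps_pos (hj.isPos hP), eps_opp, eps_pos (hi.isPos hP)]; ring
    rw [h2, cr_opp, hi.cr_self hP, h3] at h
    rw [h4, pr_opp, ← aref_opp (D.opp j), opp_opp]
    congr 1
    rcases hj.eq with rfl | rfl <;> rcases hi.eq with rfl | rfl <;> omega
  · rw [hi.cr_of_ne hP hmem h1 h2, add_zero] at h
    exact absurd Iff.rfl h

/-! ### Hyperplanes that separate the fundamental alcove from another alcove -/

/-- The hyperplane `⟨·, α^∨⟩ = k` separates the fundamental alcove from its image under `w`. -/
def Sep (i : ι) (k : ℤ) (w : D.Ext) : Prop := ¬ (k + D.eps i ≤ 0 ↔ k + D.eps i ≤ cr w i)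

/-- A simple affine reflection crosses only its own hyperplane, so it moves the other hyperplanes
that separate `w` from the fundamental alcove to hyperplanes that separate its product with `w`. -/
theorem sep_simple_mul {P : Set ι} (hP : P ⊆ D.simple) {j : ι} {l : ℤ}
    (hj : D.IsSimpleAff P j l) {i : ι} (hi : i ∈ D.sub P) {k : ℤ} (hne : D.aref i k ≠ D.aref j l)
    (w : D.Ext) : Sep ((D.aref j l).right • i)
      (k + D.pr (D.aref j l).left.toAdd ((D.aref j l).right • i)) (D.aref j l * w) ↔
      Sep i k w := by
  have e1 : k + D.pr (D.aref j l).left.toAdd ((D.aref j l).right • i) +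
      D.eps ((D.aref j l).right • i) = k + D.eps i + cr (D.aref j l) ((D.aref j l).right • i) := by
    rw [cr, inv_smul_smul]; ring
  have e2 : cr (D.aref j l * w) ((D.aref j l).right • i) =
      cr (D.aref j l) ((D.aref j l).right • i) + cr w i := by rw [cr_mul, inv_smul_smul]
  unfold Sep
  rw [e1, e2, aref_right]
  by_cases h1 : i = j
  · subst h1
    have hkl : k ≠ l := fun h => hne (by rw [h])
    rw [refl_smul_self, cr_opp, hj.cr_self hP, eps_pos (hj.isPos hP)]
    rcases hj.eq with rfl | rfl <;> omega
  by_cases h2 : i = D.opp j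
  · subst h2
    have hkl : k ≠ -l := fun h => hne (by rw [h, aref_opp])
    rw [smul_opp, refl_smul_self, opp_opp, hj.cr_self hP, eps_opp, eps_pos (hj.isPos hP)]
    rcases hj.eq with rfl | rfl <;> omega
  · rw [hj.cr_of_ne hP (D.smul_mem_sub (D.refl_mem_weyl hj.mem_sub) hi)]
    · simp
    · exact fun h => h2 (eq_opp_of_refl_smul h)
    · intro h
      rw [← refl_smul_self] at h
      exact h1 (MulAction.injective _ h)

theorem len_simple_mul_le {P : Set ι} (hP : P ⊆ D.simple) {j : ι} {l : ℤ}
    (hj : D.IsSimpleAff P j l) (w : D.Ext) : D.len P (D.aref j l * w) ≤ D.len P w + 1 := by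
  have h1 := hj.len hP
  by_cases hw : 0 < (2 * l - 1) * cr w j
  · have := hj.len_mul_of_pos hP hw
    omega
  · have := hj.len_mul_of_nonpos hP (not_lt.1 hw)
    omega

theorem simple_conj_aref (i j : ι) (k l : ℤ) (w : D.Ext) :
    D.aref ((D.aref j l).right • i) (k + D.pr (D.aref j l).left.toAdd ((D.aref j l).right • i)) *
      (D.aref j l * w) = D.aref j l * (D.aref i k * w) := by
  rw [← mul_assoc, ← mul_aref, mul_assoc]

/-- Reflection in a separating hyperplane shortens `w`, by induction on the length of `w`. -/
theorem len_lt_of_sep {P : Set ι} (hP : P ⊆ D.simple) {i : ι} (hi : i ∈ D.sub P) {k : ℤ}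
    {w : D.Ext} (h : Sep i k w) : D.len P (D.aref i k * w) < D.len P w := by
  generalize hn : D.len P w = n
  induction n using Nat.strongRecOn generalizing i k w with
  | ind n ih =>
    have hw : D.len P w ≠ 0 := fun h0 => by
      have := len_eq_zero_iff.1 h0 i hi
      rw [Sep, this] at h
      exact h Iff.rfl
    obtain ⟨j, l, hj, hd⟩ := exists_descent hP hw
    have h1 := hj.len_mul_of_pos hP hd
    have h2 := hj.len hP
    by_cases hne : D.aref i k = D.aref j l
    · rw [hne]; omega
    · have h3 := (sep_simple_mul hP hj hi hne w).2 h
      have h4 := ih _ (by omega) (by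
        rw [aref_right]; exact D.smul_mem_sub (D.refl_mem_weyl hj.mem_sub) hi) h3 rfl
      rw [simple_conj_aref] at h4
      have h5 := len_simple_mul_le hP hj (D.aref j l * (D.aref i k * w))
      rw [aref_mul_aref_mul] at h5
      omega

theorem sep_aref_mul (i : ι) (k : ℤ) (w : D.Ext) :
    Sep i k (D.aref i k * w) ↔ ¬ Sep i k w := by
  have : cr (D.aref i k * w) i = 2 * (k + D.eps i) - 1 - cr w i := by
    rw [cr_mul, cr_aref, pr_self, aref_right, refl_inv, refl_smul_self, cr_opp, eps_opp]; ring
  unfold Sep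
  rw [this]
  omega

/-- A form of strong exchange: if the reflection `r` raises the length of `w` by one, then some
simple affine reflection that shortens `r w` is equal to `r` or shortens `w` as well. -/
theorem exists_simple_of_cover {P : Set ι} (hP : P ⊆ D.simple) {i : ι} (hi : i ∈ D.sub P) {k : ℤ}
    {w : D.Ext} (h : D.len P (D.aref i k * w) = D.len P w + 1) :
    ∃ j l, D.IsSimpleAff P j l ∧ 0 < (2 * l - 1) * cr (D.aref i k * w) j ∧
      (D.aref i k = D.aref j l ∨ 0 < (2 * l - 1) * cr w j) := by
  obtain ⟨j, l, hj, hd⟩ := exists_descent hP (w := D.aref i k * w) (by omega)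
  refine ⟨j, l, hj, hd, ?_⟩
  by_contra! hcon
  have h1 := hj.len_mul_of_pos hP hd
  have h2 := hj.len hP
  have h3 := hj.len_mul_of_nonpos hP hcon.2
  have hsep : Sep i k (D.aref i k * w) := by
    by_contra hns
    rw [sep_aref_mul, not_not] at hns
    have := len_lt_of_sep hP hi hns
    omega
  have h4 := len_lt_of_sep hP (by
    rw [aref_right]; exact D.smul_mem_sub (D.refl_mem_weyl hj.mem_sub) hi)
    ((sep_simple_mul hP hj hi hcon.1 _).2 hsep)
  rw [simple_conj_aref, aref_mul_aref_mul] at h4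
  omega

end HeckeDatum

namespace HeckeDatum

variable {ι X Y : Type*} [Fintype ι] [AddCommGroup X] [AddCommGroup Y] {D : HeckeDatum ι X Y}

/-! ### The regular representation of an affine Hecke algebra -/

variable (D) in
/-- The simple affine reflections of `W_P ⋉ X`, as pairs `(α, k)` with fixed hyperplane
`⟨·, α^∨⟩ = k`. -/
abbrev SimpleAff (P : Set ι) : Type _ := {p : ι × ℤ // D.IsSimpleAff P p.1 p.2}

namespace SimpleAff

variable {P : Set ι}

/-- The reflection as element of `W_P ⋉ X`. -/
def elt (σ : D.SimpleAff P) : D.aff P := ⟨D.aref σ.1.1 σ.1.2, σ.2.mem_aff⟩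

/-- Left multiplication by the reflection shortens `w`. -/
def Desc (σ : D.SimpleAff P) (w : D.Ext) : Prop := 0 < (2 * σ.1.2 - 1) * cr w σ.1.1

/-- The number `q_s^{1/2} - q_s^{-1/2}`. -/
def q (σ : D.SimpleAff P) : ℂ := D.quad (D.par σ.1.1 σ.1.2)

theorem elt_mul_elt (σ : D.SimpleAff P) : σ.elt * σ.elt = 1 := Subtype.ext (aref_mul_self _ _)

theorem elt_inv (σ : D.SimpleAff P) : σ.elt⁻¹ = σ.elt := inv_eq_of_mul_eq_one_left σ.elt_mul_elt

theorem elt_mul_elt_mul (σ : D.SimpleAff P) (w : D.aff P) : σ.elt * (σ.elt * w) = w := by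
  rw [← mul_assoc, elt_mul_elt, one_mul]

theorem desc_elt_mul (σ : D.SimpleAff P) (hP : P ⊆ D.simple) (w : D.Ext) :
    σ.Desc (σ.elt * w) ↔ ¬ σ.Desc w := by
  have h := σ.2.cr_mul_self hP w
  unfold Desc
  change 0 < _ * cr (D.aref _ _ * w) _ ↔ _
  rw [h]
  rcases σ.2.eq with h | h <;> rw [h] <;> omega

theorem len_elt (σ : D.SimpleAff P) (hP : P ⊆ D.simple) : D.len P σ.elt = 1 := σ.2.len hP

theorem len_elt_mul (σ : D.SimpleAff P) (hP : P ⊆ D.simple) {w : D.Ext} (h : ¬ σ.Desc w) :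
    D.len P (σ.elt * w) = D.len P σ.elt + D.len P w := σ.2.len_mul_of_nonpos hP (not_lt.1 h)

theorem len_of_desc (σ : D.SimpleAff P) (hP : P ⊆ D.simple) {w : D.Ext} (h : σ.Desc w) :
    D.len P w = D.len P σ.elt + D.len P (σ.elt * w) := σ.2.len_mul_of_pos hP h

theorem len_lt_iff (σ : D.SimpleAff P) (hP : P ⊆ D.simple) {w : D.Ext} :
    D.len P (σ.elt * w) < D.len P w ↔ σ.Desc w := σ.2.len_lt_iff hP

theorem not_desc_one (σ : D.SimpleAff P) : ¬ σ.Desc (1 : D.Ext) := by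
  rw [Desc, cr_one, mul_zero]; exact lt_irrefl 0

theorem fold (σ τ : D.SimpleAff P) (hP : P ⊆ D.simple) (w : D.aff P)
    (h : ¬ (σ.Desc (w : D.Ext) ↔ σ.Desc (w * τ.elt : D.Ext))) : σ.elt * w = w * τ.elt :=
  Subtype.ext (σ.2.fold hP τ.2 w.2 h)

theorem q_eq (σ τ : D.SimpleAff P) (hP : P ⊆ D.simple) {w : D.aff P}
    (h : σ.elt * w = w * τ.elt) : σ.q = τ.q := by
  rw [q, q, par_eq_of_conj (aff_mono hP w.2) (congrArg Subtype.val h)]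

theorem desc_mul_len_zero (σ : D.SimpleAff P) (w ω : D.aff P) (h : D.len P (ω : D.Ext) = 0) :
    σ.Desc (w * ω : D.Ext) ↔ σ.Desc (w : D.Ext) := by
  unfold Desc
  rw [cr_mul, len_eq_zero_iff.1 h, add_zero]
  exact (D.smul_mem_sub_iff (inv_mem w.2)).2 σ.2.mem_sub

end SimpleAff

theorem len_mul_le {P : Set ι} {v : D.Ext} (hv : v ∈ D.aff P) (w : D.Ext) :
    D.len P (v * w) ≤ D.len P v + D.len P w := by
  classical
  have h1 := two_mul_len_eq P (v * w)
  have h2 := two_mul_len_eq P v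
  have h3 := two_mul_len_eq P w
  rw [← sum_smul_sub (P := P) (u := v.right) hv] at h3
  have h4 : ∑ i with i ∈ D.sub P, (cr (v * w) i).natAbs ≤
      ∑ i with i ∈ D.sub P, ((cr v i).natAbs + (cr w (v.right⁻¹ • i)).natAbs) :=
    Finset.sum_le_sum fun i _ => by rw [cr_mul]; exact Int.natAbs_add_le _ _
  rw [Finset.sum_add_distrib] at h4
  omega

theorem exists_desc {P : Set ι} (hP : P ⊆ D.simple) {w : D.Ext} (hw : D.len P w ≠ 0) :
    ∃ σ : D.SimpleAff P, σ.Desc w := by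
  obtain ⟨j, k, h, h'⟩ := exists_descent hP hw
  exact ⟨⟨(j, k), h⟩, h'⟩

/-- Induction over `W_P ⋉ X` along reduced expressions. -/
theorem aff_induction {P : Set ι} (hP : P ⊆ D.simple) {p : D.aff P → Prop}
    (h0 : ∀ ω : D.aff P, D.len P (ω : D.Ext) = 0 → p ω)
    (h1 : ∀ (σ : D.SimpleAff P) (w : D.aff P), ¬ σ.Desc (w : D.Ext) → p w → p (σ.elt * w))
    (w : D.aff P) : p w := by
  generalize hn : D.len P (w : D.Ext) = n
  induction n generalizing w with
  | zero => exact h0 w hn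
  | succ n ih =>
    obtain ⟨σ, hσ⟩ := exists_desc hP (w := (w : D.Ext)) (by omega)
    have h2 := σ.len_of_desc hP hσ
    rw [σ.len_elt hP] at h2
    have h3 := h1 σ (σ.elt * w) (by
      rw [Subgroup.coe_mul, σ.desc_elt_mul hP, not_not]; exact hσ)
      (ih _ (by rw [Subgroup.coe_mul]; omega))
    rwa [σ.elt_mul_elt_mul] at h3

section Operators

variable {P : Set ι}

variable (D) in
/-- The space on which the regular representation of `H^P` is realized, with the basis
`W_P ⋉ X`. -/
abbrev RegSpace (P : Set ι) : Type _ := D.aff P →₀ ℂ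

/-- The basis vector of `w`. -/
abbrev bas (w : D.aff P) : D.RegSpace P := Finsupp.single w 1

open Classical in
/-- Left multiplication by `N_s`: `N_s N_w` is `N_{sw}`, plus a multiple of `N_w` if `s` shortens
`w`. -/
def opL (σ : D.SimpleAff P) : Module.End ℂ (D.RegSpace P) :=
  Finsupp.linearCombination ℂ fun w =>
    bas (σ.elt * w) + (if σ.Desc (w : D.Ext) then σ.q else 0) • bas w

open Classical in
/-- Right multiplication by `N_s`. -/
def opR (σ : D.SimpleAff P) : Module.End ℂ (D.RegSpace P) :=
  Finsupp.linearCombination ℂ fun w =>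
    bas (w * σ.elt) + (if σ.Desc (w⁻¹ : D.Ext) then σ.q else 0) • bas w

/-- Left translation. -/
def shiftL (v : D.aff P) : Module.End ℂ (D.RegSpace P) :=
  Finsupp.linearCombination ℂ fun w => bas (v * w)

/-- Right translation. -/
def shiftR (v : D.aff P) : Module.End ℂ (D.RegSpace P) :=
  Finsupp.linearCombination ℂ fun w => bas (w * v)

open Classical in
theorem opL_bas (σ : D.SimpleAff P) (w : D.aff P) : opL σ (bas w) =
    bas (σ.elt * w) + (if σ.Desc (w : D.Ext) then σ.q else 0) • bas w := by
  rw [opL, bas, Finsupp.linearCombination_single, one_smul]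

open Classical in
theorem opR_bas (σ : D.SimpleAff P) (w : D.aff P) : opR σ (bas w) =
    bas (w * σ.elt) + (if σ.Desc (w⁻¹ : D.Ext) then σ.q else 0) • bas w := by
  rw [opR, bas, Finsupp.linearCombination_single, one_smul]

theorem shiftL_bas (v w : D.aff P) : shiftL v (bas w) = bas (v * w) := by
  rw [shiftL, bas, Finsupp.linearCombination_single, one_smul]

theorem shiftR_bas (v w : D.aff P) : shiftR v (bas w) = bas (w * v) := by
  rw [shiftR, bas, Finsupp.linearCombination_single, one_smul]

theorem end_ext {S T : Module.End ℂ (D.RegSpace P)} (h : ∀ w, S (bas w) = T (bas w)) : S = T :=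
  Finsupp.lhom_ext' fun w => LinearMap.ext_ring (h w)

/-- Left and right multiplications commute. -/
theorem opL_opR (hP : P ⊆ D.simple) (σ τ : D.SimpleAff P) :
    opL σ * opR τ = opR τ * opL σ := by
  classical
  refine end_ext fun w => ?_
  simp only [Module.End.mul_apply, opL_bas, opR_bas, map_add, map_smul]
  have e1 : ((w * τ.elt : D.aff P) : D.Ext) = w * τ.elt := rfl
  have e2 : ((σ.elt * w : D.aff P) : D.Ext)⁻¹ = (w : D.Ext)⁻¹ * σ.elt := by
    rw [Subgroup.coe_mul, mul_inv_rev, ← InvMemClass.coe_inv σ.elt, σ.elt_inv]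
  rw [e1, e2, ← mul_assoc]
  by_cases hf : σ.elt * w = w * τ.elt
  · have hq := σ.q_eq τ hP hf
    have e3 : (w : D.Ext) * τ.elt = σ.elt * w := (congrArg Subtype.val hf).symm
    have e4 : (w : D.Ext)⁻¹ * σ.elt = τ.elt * (w : D.Ext)⁻¹ := by
      rw [inv_mul_eq_iff_eq_mul, ← mul_assoc, e3, mul_assoc, mul_inv_cancel, mul_one]
    have e5 : τ.Desc (w⁻¹ : D.Ext) ↔ σ.Desc (w : D.Ext) := by
      rw [← τ.len_lt_iff hP, ← σ.len_lt_iff hP, ← e4, D.len_inv P w.2]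
      have := D.len_inv P (σ.elt * w : D.aff P).2
      rw [e2] at this
      rw [this]; rfl
    rw [e3, e4, σ.desc_elt_mul hP, τ.desc_elt_mul hP, e5, hf, hq]
  · have h1 : σ.Desc (w : D.Ext) ↔ σ.Desc (w * τ.elt : D.Ext) :=
      not_not.1 fun h => hf (σ.fold τ hP w h)
    have h2 : τ.Desc (w⁻¹ : D.Ext) ↔ τ.Desc ((w : D.Ext)⁻¹ * σ.elt) :=
      not_not.1 fun h => hf (by
        have := τ.fold σ hP w⁻¹ h
        rw [eq_comm, inv_mul_eq_iff_eq_mul] at this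
        rw [this]; group)
    rw [← h1, ← h2]
    module

theorem opL_shiftR (σ : D.SimpleAff P) {ω : D.aff P} (hω : D.len P (ω : D.Ext) = 0) :
    opL σ * shiftR ω = shiftR ω * opL σ := by
  classical
  refine end_ext fun w => ?_
  simp only [Module.End.mul_apply, opL_bas, shiftR_bas, map_add, map_smul, Subgroup.coe_mul,
    σ.desc_mul_len_zero w ω hω, mul_assoc]

theorem shiftL_opR (σ : D.SimpleAff P) {ω : D.aff P} (hω : D.len P (ω : D.Ext) = 0) :
    shiftL ω * opR σ = opR σ * shiftL ω := by
  classical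
  refine end_ext fun w => ?_
  have h := σ.desc_mul_len_zero w⁻¹ ω⁻¹ (by
    rw [InvMemClass.coe_inv, D.len_inv P ω.2, hω])
  rw [InvMemClass.coe_inv, InvMemClass.coe_inv] at h
  have e2 : ((ω * w : D.aff P) : D.Ext)⁻¹ = (w : D.Ext)⁻¹ * (ω : D.Ext)⁻¹ := by
    rw [Subgroup.coe_mul, mul_inv_rev]
  simp only [Module.End.mul_apply, opR_bas, shiftL_bas, map_add, map_smul, e2, h, mul_assoc]

theorem shiftL_shiftR (v ω : D.aff P) : shiftL v * shiftR ω = shiftR ω * shiftL v :=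
  end_ext fun w => by simp only [Module.End.mul_apply, shiftL_bas, shiftR_bas, mul_assoc]

variable (D P) in
/-- The operators that commute with all right multiplications. -/
def leftOps : Subalgebra ℂ (Module.End ℂ (D.RegSpace P)) :=
  Subalgebra.centralizer ℂ (Set.range opR ∪ shiftR '' {ω | D.len P (ω : D.Ext) = 0})

theorem opL_mem (hP : P ⊆ D.simple) (σ : D.SimpleAff P) : opL σ ∈ D.leftOps P := by
  refine Subalgebra.mem_centralizer_iff ℂ |>.2 ?_
  rintro _ (⟨τ, rfl⟩ | ⟨ω, hω, rfl⟩)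
  · exact (opL_opR hP σ τ).symm
  · exact (opL_shiftR σ hω).symm

theorem shiftL_mem {ω : D.aff P} (hω : D.len P (ω : D.Ext) = 0) : shiftL ω ∈ D.leftOps P := by
  refine Subalgebra.mem_centralizer_iff ℂ |>.2 ?_
  rintro _ (⟨τ, rfl⟩ | ⟨ω', _, rfl⟩)
  · exact (shiftL_opR τ hω).symm
  · exact (shiftL_shiftR ω ω').symm

/-- An operator that commutes with the right multiplications is determined by its value at the
basis vector of the unit element. -/
theorem leftOps_ext (hP : P ⊆ D.simple) {S T : Module.End ℂ (D.RegSpace P)}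
    (hS : S ∈ D.leftOps P) (hT : T ∈ D.leftOps P) (h : S (bas 1) = T (bas 1)) : S = T := by
  classical
  have hS' := Subalgebra.mem_centralizer_iff ℂ |>.1 hS
  have hT' := Subalgebra.mem_centralizer_iff ℂ |>.1 hT
  refine end_ext fun w => ?_
  rw [← inv_inv w]
  refine aff_induction hP (p := fun w => S (bas w⁻¹) = T (bas w⁻¹)) (fun ω hω => ?_)
    (fun σ w hd ih => ?_) w⁻¹
  · have hm : shiftR (D := D) ω⁻¹ ∈ Set.range opR ∪ shiftR '' {ω | D.len P (ω : D.Ext) = 0} :=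
      .inr ⟨ω⁻¹, by
        rw [Set.mem_ofPred_eq, InvMemClass.coe_inv, D.len_inv P ω.2, hω], rfl⟩
    have e : bas (D := D) ω⁻¹ = shiftR ω⁻¹ (bas 1) := by rw [shiftR_bas, one_mul]
    rw [e, ← Module.End.mul_apply, ← Module.End.mul_apply, ← hS' _ hm, ← hT' _ hm,
      Module.End.mul_apply, Module.End.mul_apply, h]
  · have hm : opR σ ∈ Set.range opR ∪ shiftR '' {ω | D.len P (ω : D.Ext) = 0} := .inl ⟨σ, rfl⟩
    have e : bas (σ.elt * w)⁻¹ = opR σ (bas w⁻¹) := by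
      rw [opR_bas, mul_inv_rev, σ.elt_inv, ← InvMemClass.coe_inv, inv_inv, if_neg hd, zero_smul,
        add_zero]
    rw [e, ← Module.End.mul_apply, ← Module.End.mul_apply, ← hS' _ hm, ← hT' _ hm,
      Module.End.mul_apply, Module.End.mul_apply, ih]

/-- Left multiplication by `N_w` is a product of operators for a reduced expression of `w`. By
`leftOps_ext` it does not depend on the expression. -/
theorem exists_leftOp (hP : P ⊆ D.simple) (w : D.aff P) : ∃ T ∈ D.leftOps P, ∀ x : D.aff P,
    D.len P (w * x : D.Ext) = D.len P (w : D.Ext) + D.len P (x : D.Ext) →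
      T (bas x) = bas (w * x) := by
  classical
  refine aff_induction hP (p := fun w => ∃ T ∈ D.leftOps P, ∀ x : D.aff P,
    D.len P (w * x : D.Ext) = D.len P (w : D.Ext) + D.len P (x : D.Ext) →
      T (bas x) = bas (w * x)) (fun ω hω => ⟨shiftL ω, shiftL_mem hω, fun x _ => shiftL_bas ω x⟩)
    (fun σ w hd => ?_) w
  rintro ⟨T, hT, h⟩
  refine ⟨opL σ * T, mul_mem (opL_mem hP σ) hT, fun x hx => ?_⟩
  have h1 := σ.len_elt_mul hP hd
  have h2 := len_mul_le (D := D) w.2 (x : D.Ext)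
  have h3 := len_mul_le (D := D) σ.elt.2 (w * x : D.Ext)
  rw [Subgroup.coe_mul, mul_assoc, h1] at hx
  have h4 : ¬ σ.Desc (w * x : D.Ext) := fun h' => by
    have := σ.len_of_desc hP h'
    have := σ.len_elt hP
    omega
  rw [Module.End.mul_apply, h x (by omega), opL_bas, Subgroup.coe_mul, if_neg h4, zero_smul,
    add_zero, mul_assoc]

/-- Left multiplication by `N_w` in the regular representation. -/
def leftOp (hP : P ⊆ D.simple) (w : D.aff P) : Module.End ℂ (D.RegSpace P) :=
  (exists_leftOp hP w).choose

theorem leftOp_mem (hP : P ⊆ D.simple) (w : D.aff P) : leftOp hP w ∈ D.leftOps P :=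
  (exists_leftOp hP w).choose_spec.1

theorem leftOp_bas (hP : P ⊆ D.simple) (w x : D.aff P)
    (h : D.len P (w * x : D.Ext) = D.len P (w : D.Ext) + D.len P (x : D.Ext)) :
    leftOp hP w (bas x) = bas (w * x) :=
  (exists_leftOp hP w).choose_spec.2 x h

theorem leftOp_bas_one (hP : P ⊆ D.simple) (w : D.aff P) : leftOp hP w (bas 1) = bas w := by
  rw [leftOp_bas, mul_one]
  rw [Subgroup.coe_one, mul_one, len_one, add_zero]

theorem leftOp_unique (hP : P ⊆ D.simple) {w : D.aff P} {T : Module.End ℂ (D.RegSpace P)}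
    (hT : T ∈ D.leftOps P) (h : T (bas 1) = bas w) : leftOp hP w = T :=
  leftOps_ext hP (leftOp_mem hP w) hT (by rw [leftOp_bas_one, h])

theorem leftOp_mul (hP : P ⊆ D.simple) {v w : D.aff P}
    (h : D.len P (v * w : D.Ext) = D.len P (v : D.Ext) + D.len P (w : D.Ext)) :
    leftOp hP v * leftOp hP w = leftOp hP (v * w) :=
  (leftOp_unique hP (mul_mem (leftOp_mem hP v) (leftOp_mem hP w)) (by
    rw [Module.End.mul_apply, leftOp_bas_one, leftOp_bas hP v w h])).symm

theorem leftOp_len_zero (hP : P ⊆ D.simple) {ω : D.aff P} (hω : D.len P (ω : D.Ext) = 0) :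
    leftOp hP ω = shiftL ω :=
  leftOp_unique hP (shiftL_mem hω) (by rw [shiftL_bas, mul_one])

theorem leftOp_one (hP : P ⊆ D.simple) : leftOp hP (1 : D.aff P) = 1 :=
  leftOp_unique hP (one_mem _) rfl

theorem leftOp_elt (hP : P ⊆ D.simple) (σ : D.SimpleAff P) : leftOp hP σ.elt = opL σ := by
  classical
  refine leftOp_unique hP (opL_mem hP σ) ?_
  rw [opL_bas, mul_one, Subgroup.coe_one, if_neg σ.not_desc_one, zero_smul, add_zero]

theorem leftOp_elt_mul (hP : P ⊆ D.simple) (σ : D.SimpleAff P) {w : D.aff P}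
    (h : ¬ σ.Desc (w : D.Ext)) : leftOp hP (σ.elt * w) = opL σ * leftOp hP w := by
  rw [← leftOp_mul hP (σ.len_elt_mul hP h), leftOp_elt]

theorem opL_sq (hP : P ⊆ D.simple) (σ : D.SimpleAff P) : opL σ * opL σ = 1 + σ.q • opL σ := by
  classical
  refine end_ext fun w => ?_
  simp only [Module.End.mul_apply, opL_bas, map_add, map_smul, Subgroup.coe_mul,
    σ.desc_elt_mul hP, σ.elt_mul_elt_mul, LinearMap.add_apply, LinearMap.smul_apply,
    Module.End.one_apply]
  by_cases h : σ.Desc (w : D.Ext)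
  · simp only [h, not_true, if_false, if_true]; module
  · simp only [h, not_false_eq_true, if_false, if_true]; module

theorem _root_.HeckeDatum.SimpleAff.elt_mul_ne (hP : P ⊆ D.simple) (σ : D.SimpleAff P)
    (y : D.aff P) : σ.elt * y ≠ y := fun h => by
  have h1 := σ.desc_elt_mul hP (y : D.Ext)
  have h2 : (σ.elt * y : D.Ext) = y := congrArg Subtype.val h
  rw [h2] at h1
  tauto

open Classical in
theorem opL_bas_self (hP : P ⊆ D.simple) (σ : D.SimpleAff P) (y : D.aff P) :
    opL σ (bas y) y = if σ.Desc (y : D.Ext) then σ.q else 0 := by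
  rw [opL_bas, Finsupp.add_apply, Finsupp.smul_apply, bas, bas, Finsupp.single_eq_same,
    Finsupp.single_eq_of_ne' (SimpleAff.elt_mul_ne hP σ y), zero_add, smul_eq_mul, mul_one]

theorem opL_apply (hP : P ⊆ D.simple) (σ : D.SimpleAff P) (f : D.RegSpace P) (y : D.aff P) :
    opL σ f y = f (σ.elt * y) + opL σ (bas y) y * f y := by
  classical
  induction f using Finsupp.induction_linear with
  | zero => simp
  | add f g hf hg => rw [map_add, Finsupp.add_apply, hf, hg, Finsupp.add_apply,
      Finsupp.add_apply]; ring
  | single w c =>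
    have e : (Finsupp.single w c : D.RegSpace P) = c • bas w := by simp [bas]
    have e2 : σ.elt * w = y ↔ w = σ.elt * y :=
      ⟨fun h => by rw [← h, σ.elt_mul_elt_mul], fun h => by rw [h, σ.elt_mul_elt_mul]⟩
    rw [e, map_smul, opL_bas_self hP, opL_bas]
    simp only [Finsupp.smul_apply, Finsupp.add_apply, bas, Finsupp.single_apply, smul_eq_mul, e2]
    by_cases h : w = y
    · rw [h, if_pos rfl]; ring
    · rw [if_neg h]; ring

/-- The operators `N_w` and `N_{w⁻¹}` are adjoint. -/
theorem leftOp_adjoint (hP : P ⊆ D.simple) (w x y : D.aff P) :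
    leftOp hP w (bas x) y = leftOp hP w⁻¹ (bas y) x := by
  classical
  refine aff_induction hP (p := fun w => ∀ x y, leftOp hP w (bas x) y = leftOp hP w⁻¹ (bas y) x)
    (fun ω hω x y => ?_) (fun σ w hd ih x y => ?_) w x y
  · rw [leftOp_len_zero hP hω, leftOp_len_zero hP (by
      rw [InvMemClass.coe_inv, D.len_inv P ω.2, hω]), shiftL_bas, shiftL_bas, bas, bas,
      Finsupp.single_apply, Finsupp.single_apply]
    have : ω * x = y ↔ ω⁻¹ * y = x := by rw [inv_mul_eq_iff_eq_mul, eq_comm]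
    simp only [this]
  · have e : leftOp hP (σ.elt * w)⁻¹ = leftOp hP w⁻¹ * opL σ := by
      rw [← leftOp_elt hP, leftOp_mul, mul_inv_rev, σ.elt_inv]
      have h1 := D.len_inv P (σ.elt * w : D.aff P).2
      have h2 : ((σ.elt * w : D.aff P) : D.Ext)⁻¹ = (w⁻¹ : D.aff P) * σ.elt := by
        rw [Subgroup.coe_mul, mul_inv_rev, ← InvMemClass.coe_inv σ.elt, σ.elt_inv,
          InvMemClass.coe_inv]
      rw [h2, Subgroup.coe_mul, σ.len_elt_mul hP hd] at h1
      rw [h1, InvMemClass.coe_inv, D.len_inv P w.2, add_comm]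
    rw [leftOp_elt_mul hP σ hd, Module.End.mul_apply, opL_apply hP, ih, ih, e, Module.End.mul_apply,
      opL_bas_self hP, opL_bas, map_add, map_smul, Finsupp.add_apply, Finsupp.smul_apply,
      smul_eq_mul]

end Operators

end HeckeDatum

namespace HeckeDatum

variable {ι X Y : Type*} [Fintype ι] [AddCommGroup X] [AddCommGroup Y] {D : HeckeDatum ι X Y}

/-! ### Automorphisms of the root datum that map one parabolic subsystem to another -/

theorem smul_mem_sub_of {P Q : Set ι} {u : D.R.Aut} (hu : ∀ i ∈ P, u • i ∈ Q) {i : ι}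
    (hi : i ∈ D.sub P) : u • i ∈ D.sub Q := by
  change D.R.root (u • i) ∈ AddSubgroup.closure (D.R.root '' Q)
  rw [root_smul]
  have key : ∀ x ∈ AddSubgroup.closure (D.R.root '' P),
      u • x ∈ AddSubgroup.closure (D.R.root '' Q) := by
    intro x hx
    induction hx using AddSubgroup.closure_induction with
    | mem x hx =>
      obtain ⟨j, hj, rfl⟩ := hx
      rw [← root_smul]
      exact AddSubgroup.subset_closure ⟨_, hu j hj, rfl⟩
    | zero => rw [smul_zero]; exact zero_mem _
    | add x y _ _ hx hy => rw [smul_add]; exact add_mem hx hy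
    | neg x _ hx => rw [smul_neg]; exact neg_mem hx
  exact key _ hi

theorem smul_mem_sub_iff_of {P Q : Set ι} {u : D.R.Aut} (hu : ∀ i, u • i ∈ Q ↔ i ∈ P) {i : ι} :
    u • i ∈ D.sub Q ↔ i ∈ D.sub P := by
  refine ⟨fun h => ?_, smul_mem_sub_of fun i hi => (hu i).2 hi⟩
  rw [← inv_smul_smul u i]
  exact smul_mem_sub_of (fun i hi => (hu _).1 (by rwa [smul_inv_smul])) h

theorem IsMaxCoroot.smul {P Q : Set ι} {u : D.R.Aut} (hu : ∀ i, u • i ∈ Q ↔ i ∈ P) {i : ι}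
    (h : D.IsMaxCoroot P i) : D.IsMaxCoroot Q (u • i) := by
  refine ⟨(smul_mem_sub_iff_of hu).2 h.1, fun j hj hji => ?_⟩
  have hco : ∀ k, u.toHom.coweightMap (D.R.coroot (u • k)) = D.R.coroot k := fun k => by
    rw [RootPairing.Hom.coroot_coweightMap_apply]
    exact congrArg _ (Equiv.symm_apply_apply _ k)
  have key : ∀ y ∈ AddSubmonoid.closure (D.R.coroot '' Q),
      u.toHom.coweightMap y ∈ AddSubmonoid.closure (D.R.coroot '' P) := by
    intro y hy
    induction hy using AddSubmonoid.closure_induction with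
    | mem y hy =>
      obtain ⟨k, hk, rfl⟩ := hy
      rw [← smul_inv_smul u k, hco]
      exact AddSubmonoid.subset_closure ⟨_, (hu _).1 (by rwa [smul_inv_smul]), rfl⟩
    | zero => rw [map_zero]; exact zero_mem _
    | add x y _ _ hx hy => rw [map_add]; exact add_mem hx hy
  have h1 := key _ hji
  rw [map_sub, hco, ← smul_inv_smul u j, hco] at h1
  rw [← h.2 _ ((smul_mem_sub_iff_of hu).1 (by rwa [smul_inv_smul])) h1, smul_inv_smul]

theorem isPos_smul_of_simple {u : D.R.Aut} (hu : ∀ i ∈ D.simple, u • i ∈ D.simple) (i : ι) :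
    D.base.IsPos (u • i) ↔ D.base.IsPos i := by
  have key : ∀ i, D.base.IsPos i → D.base.IsPos (u • i) := by
    intro i hi
    refine pos_sub_induction (P := D.simple) subset_rfl (p := fun i => D.base.IsPos (u • i))
      (fun j hj => isPos_simple (hu j hj)) (fun i j hj _ _ hneg h => ?_)
      (by rw [sub_simple]; trivial) hi
    rw [← mul_smul, show u * D.refl j = D.refl (u • j) * u by
      rw [← conj_refl, inv_mul_cancel_right], mul_smul]
    refine isPos_refl (hu j hj) h fun e => ?_
    rw [MulAction.injective u e, pr_self] at hneg
    omega
  refine ⟨fun h => ?_, key i⟩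
  by_contra hneg
  have := key _ ((D.isPos_opp i).2 hneg)
  rw [smul_opp, isPos_opp] at this
  exact this h

theorem lin_right (u : D.R.Aut) : (D.lin u).right = u := rfl

theorem lin_inv (u : D.R.Aut) : (D.lin u)⁻¹ = D.lin u⁻¹ := (map_inv SemidirectProduct.inr u).symm

theorem lin_mul (u v : D.R.Aut) : D.lin (u * v) = D.lin u * D.lin v :=
  map_mul SemidirectProduct.inr u v

theorem lin_one : D.lin 1 = 1 := map_one SemidirectProduct.inr

theorem conj_left (u : D.R.Aut) (w : D.Ext) :
    (D.lin u * w * (D.lin u)⁻¹).left.toAdd = u • w.left.toAdd := by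
  rw [lin_inv]
  change ((0 : X) + u • w.left.toAdd) + (D.lin u * w).right • (0 : X) = _
  rw [smul_zero, add_zero, zero_add]

theorem conj_right (u : D.R.Aut) (w : D.Ext) :
    (D.lin u * w * (D.lin u)⁻¹).right = u * w.right * u⁻¹ := rfl

theorem weyl_conj {P Q : Set ι} {u : D.R.Aut} (hu : ∀ i, u • i ∈ Q ↔ i ∈ P) {v : D.R.Aut}
    (hv : v ∈ D.weyl P) : u * v * u⁻¹ ∈ D.weyl Q := by
  induction hv using Subgroup.closure_induction with
  | mem v hv =>
    obtain ⟨j, hj, rfl⟩ := hv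
    rw [conj_refl]
    exact D.refl_mem_weyl ((smul_mem_sub_iff_of hu).2 hj)
  | one => rw [mul_one, mul_inv_cancel]; exact one_mem _
  | mul v w _ _ h1 h2 =>
    have : u * (v * w) * u⁻¹ = u * v * u⁻¹ * (u * w * u⁻¹) := by group
    rw [this]; exact mul_mem h1 h2
  | inv v _ h =>
    have : u * v⁻¹ * u⁻¹ = (u * v * u⁻¹)⁻¹ := by group
    rw [this]; exact inv_mem h

theorem aff_conj {P Q : Set ι} {u : D.R.Aut} (hu : ∀ i, u • i ∈ Q ↔ i ∈ P) {w : D.Ext}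
    (hw : w ∈ D.aff P) : D.lin u * w * (D.lin u)⁻¹ ∈ D.aff Q := weyl_conj hu hw

/-- Conjugation by an automorphism that preserves the relevant positive roots preserves the
signed hyperplane counts. -/
theorem cr_conj {P : Set ι} {u : D.R.Aut}
    (hpos : ∀ i ∈ D.sub P, D.base.IsPos (u • i) ↔ D.base.IsPos i) {w : D.Ext} (hw : w ∈ D.aff P)
    {i : ι} (hi : i ∈ D.sub P) : cr (D.lin u * w * (D.lin u)⁻¹) (u • i) = cr w i := by
  have heps : ∀ i ∈ D.sub P, D.eps (u • i) = D.eps i := fun i hi => by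
    by_cases h : D.base.IsPos i
    · rw [eps_pos h, eps_pos ((hpos i hi).2 h)]
    · rw [eps_neg h, eps_neg fun h' => h ((hpos i hi).1 h')]
  have e : (u * w.right * u⁻¹)⁻¹ • u • i = u • w.right⁻¹ • i := by
    simp only [← mul_smul]; congr 1; group
  have hw' : w.right ∈ D.weyl P := hw
  rw [cr, cr, conj_left, conj_right, e, pr_smul, heps i hi,
    heps _ ((D.smul_mem_sub_iff (inv_mem hw')).2 hi)]

theorem len_conj {P Q : Set ι} {u : D.R.Aut} (hu : ∀ i, u • i ∈ Q ↔ i ∈ P)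
    (hpos : ∀ i ∈ D.sub P, D.base.IsPos (u • i) ↔ D.base.IsPos i) {w : D.Ext} (hw : w ∈ D.aff P) :
    D.len Q (D.lin u * w * (D.lin u)⁻¹) = D.len P w := by
  classical
  suffices h : 2 * D.len Q (D.lin u * w * (D.lin u)⁻¹) = 2 * D.len P w by omega
  rw [two_mul_len_eq, two_mul_len_eq]
  refine Finset.sum_nbij' (fun i => u⁻¹ • i) (fun i => u • i) ?_ ?_ ?_ ?_ ?_
  · intro i hi
    simp only [Finset.mem_filter, Finset.mem_univ, true_and] at hi ⊢
    rw [← smul_mem_sub_iff_of hu, smul_inv_smul]; exact hi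
  · intro i hi
    simp only [Finset.mem_filter, Finset.mem_univ, true_and] at hi ⊢
    exact (smul_mem_sub_iff_of hu).2 hi
  · intro i _; exact smul_inv_smul _ i
  · intro i _; exact inv_smul_smul _ i
  · intro i hi
    simp only [Finset.mem_filter, Finset.mem_univ, true_and] at hi
    rw [← cr_conj hpos hw (i := u⁻¹ • i), smul_inv_smul]
    rw [← smul_mem_sub_iff_of hu, smul_inv_smul]; exact hi

theorem conj_aref (u : D.R.Aut) (i : ι) (k : ℤ) :
    D.lin u * D.aref i k * (D.lin u)⁻¹ = D.aref (u • i) k := by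
  rw [mul_aref, mul_inv_cancel_right]
  change D.aref (u • i) (k + D.pr 0 _) = _
  rw [pr_zero, add_zero]

theorem quad_zero : D.quad 0 = 0 := by simp [quad]

end HeckeDatum

namespace TwistedDatum

open HeckeDatum

variable {ι X Y Γ : Type*} [Fintype ι] [AddCommGroup X] [AddCommGroup Y] [Group Γ] [Fintype Γ]
  {D : TwistedDatum ι X Y Γ}

/-! ### The regular representation of a twisted affine Hecke algebra -/

variable (D) in
/-- The subgroup `K ⊆ Γ` stabilizes the set `P` of simple roots. -/
structure Admissible (P : Set ι) (K : Subgroup Γ) : Prop where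
  subset : P ⊆ D.simple
  stab : ∀ g ∈ K, ∀ i ∈ P, D.act g • i ∈ P

variable {P : Set ι} {K : Subgroup Γ}

theorem Admissible.smul_mem_iff (h : D.Admissible P K) {g : Γ} (hg : g ∈ K) (i : ι) :
    D.act g • i ∈ P ↔ i ∈ P := by
  refine ⟨fun hi => ?_, h.stab g hg i⟩
  have := h.stab g⁻¹ (inv_mem hg) _ hi
  rwa [map_inv, inv_smul_smul] at this

theorem isPos_act (g : Γ) (i : ι) : D.base.IsPos (D.act g • i) ↔ D.base.IsPos i :=
  isPos_smul_of_simple (fun i hi => D.act_simple g i hi) i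

/-- The action of `K` on `W_P ⋉ X` by conjugation. -/
def Admissible.cj (h : D.Admissible P K) (g : K) : D.aff P →* D.aff P :=
  ((MulAut.conj (D.lin (D.act g))).toMonoidHom.comp (D.aff P).subtype).codRestrict (D.aff P)
    fun w => aff_conj (h.smul_mem_iff g.2) w.2

theorem Admissible.coe_cj (h : D.Admissible P K) (g : K) (w : D.aff P) :
    (h.cj g w : D.Ext) = D.lin (D.act g) * w * (D.lin (D.act g))⁻¹ := rfl

theorem Admissible.cj_cj (h : D.Admissible P K) (g g' : K) (w : D.aff P) :
    h.cj g (h.cj g' w) = h.cj (g * g') w := by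
  apply Subtype.ext
  rw [coe_cj, coe_cj, coe_cj, Subgroup.coe_mul, map_mul, lin_mul]
  group

theorem Admissible.cj_one (h : D.Admissible P K) (w : D.aff P) : h.cj 1 w = w := by
  apply Subtype.ext
  rw [coe_cj, Subgroup.coe_one, map_one, lin_one]
  group

theorem Admissible.cj_injective (h : D.Admissible P K) (g : K) : Function.Injective (h.cj g) := by
  intro v w e
  have := congrArg (h.cj g⁻¹) e
  rwa [h.cj_cj, h.cj_cj, inv_mul_cancel, h.cj_one, h.cj_one] at this

theorem Admissible.len_cj (h : D.Admissible P K) (g : K) (w : D.aff P) :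
    D.len P (h.cj g w : D.Ext) = D.len P (w : D.Ext) :=
  len_conj (h.smul_mem_iff g.2) (fun i _ => isPos_act (g : Γ) i) w.2

/-- The action of `K` on the simple affine reflections. -/
def Admissible.cjSimple (h : D.Admissible P K) (g : K) (σ : D.SimpleAff P) : D.SimpleAff P :=
  ⟨(D.act g • σ.1.1, σ.1.2), by
    rcases σ.2 with ⟨hk, hj⟩ | ⟨hk, hj⟩
    · exact .inl ⟨hk, h.stab g g.2 _ hj⟩
    · exact .inr ⟨hk, hj.smul (h.smul_mem_iff g.2)⟩⟩

theorem Admissible.cj_elt (h : D.Admissible P K) (g : K) (σ : D.SimpleAff P) :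
    h.cj g σ.elt = (h.cjSimple g σ).elt := Subtype.ext (conj_aref _ _ _)

theorem Admissible.desc_cj (h : D.Admissible P K) (g : K) (σ : D.SimpleAff P) (w : D.aff P) :
    (h.cjSimple g σ).Desc (h.cj g w : D.Ext) ↔ σ.Desc (w : D.Ext) := by
  have := cr_conj (P := P) (fun i _ => isPos_act (g : Γ) i) w.2 σ.2.mem_sub
  unfold SimpleAff.Desc
  rw [← this]; rfl

theorem Admissible.q_cj (h : D.Admissible P K) (g : K) (σ : D.SimpleAff P) :
    (h.cjSimple g σ).q = σ.q := by
  change D.quad (D.par (D.act g • σ.1.1) σ.1.2) = D.quad (D.par σ.1.1 σ.1.2)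
  rw [par, par, D.lam_act, D.lamStar_act]

theorem z_mul_left (g : Γ) (v : D.aff P) (w : D.Ext) :
    (D.z g (v * w : D.Ext).left : ℂ) = D.z g (v : D.Ext).left * D.z g w.left := by
  have hv : (v : D.Ext).right ∈ D.weyl P := v.2
  have : (v * w : D.Ext).left =
      (v : D.Ext).left * Multiplicative.ofAdd ((v : D.Ext).right • w.left.toAdd) := rfl
  rw [this, map_mul, Units.val_mul, D.z_weyl g hv]
  rfl

theorem z_one_left (g : Γ) : (D.z g (1 : D.Ext).left : ℂ) = 1 := by
  rw [SemidirectProduct.one_left, map_one, Units.val_one]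

theorem z_lin_left (g : Γ) (u : D.R.Aut) : (D.z g (D.lin u).left : ℂ) = 1 := by
  rw [HeckeDatum.lin, SemidirectProduct.left_inr, map_one, Units.val_one]

/-- The character `z_g` is trivial on the simple affine reflections with a nontrivial parameter. -/
theorem z_mul_q (g : Γ) (σ : D.SimpleAff P) :
    (D.z g (σ.elt : D.Ext).left : ℂ) * σ.q = σ.q := by
  have h1 : (σ.elt : D.Ext).left = Multiplicative.ofAdd (σ.1.2 • D.R.root σ.1.1 : X) :=
    Multiplicative.toAdd.injective (aref_left _ _)
  rw [h1]
  rcases σ.2.eq with hk | hk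
  · rw [hk, zero_smul, ofAdd_zero, map_one, Units.val_one, one_mul]
  · by_cases h : D.lamStar σ.1.1 = 0
    · have : σ.q = 0 := by
        rw [SimpleAff.q, par, hk, if_neg (by decide), h, quad_zero]
      rw [this, mul_zero]
    · rw [hk, one_smul, D.z_root g _ h, Units.val_one, one_mul]

/-- The action of `g ∈ K` on the regular representation of `H^P`. -/
def Admissible.actOp (h : D.Admissible P K) (g : K) : Module.End ℂ (D.RegSpace P) :=
  Finsupp.linearCombination ℂ fun w => (D.z g (w : D.Ext).left : ℂ) • bas (h.cj g w)

theorem Admissible.actOp_bas (h : D.Admissible P K) (g : K) (w : D.aff P) :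
    h.actOp g (bas w) = (D.z g (w : D.Ext).left : ℂ) • bas (h.cj g w) := by
  rw [actOp, bas, Finsupp.linearCombination_single, one_smul]

theorem Admissible.actOp_mul (h : D.Admissible P K) (g g' : K) :
    h.actOp g * h.actOp g' = h.actOp (g * g') := by
  refine end_ext fun w => ?_
  have h0 : (h.cj g' w : D.Ext).left =
      Multiplicative.ofAdd (D.act g' • (w : D.Ext).left.toAdd : X) :=
    Multiplicative.toAdd.injective (conj_left _ _)
  have h1 := D.z_mul g g' (w : D.Ext).left.toAdd
  rw [ofAdd_toAdd] at h1
  rw [Module.End.mul_apply, actOp_bas, map_smul, actOp_bas, actOp_bas, h.cj_cj, smul_smul, h0,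
    Subgroup.coe_mul, h1, Units.val_mul, mul_comm]

theorem Admissible.actOp_one (h : D.Admissible P K) : h.actOp 1 = 1 := by
  refine end_ext fun w => ?_
  have h4 : ∀ x, D.z 1 (.ofAdd x) = 1 := fun x => by
    have := D.z_mul 1 1 x
    rw [one_mul, map_one, one_smul] at this
    exact mul_eq_left.1 this.symm
  rw [actOp_bas, h.cj_one, Subgroup.coe_one, ← ofAdd_toAdd (w : D.Ext).left, h4, Units.val_one,
    one_smul, Module.End.one_apply]

theorem Admissible.actOp_opL (h : D.Admissible P K) (g : K) (σ : D.SimpleAff P) :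
    h.actOp g * opL σ =
      (D.z g (σ.elt : D.Ext).left : ℂ) • (opL (h.cjSimple g σ) * h.actOp g) := by
  classical
  refine end_ext fun w => ?_
  have hz := z_mul_q (g : Γ) σ
  have hz2 := z_mul_left (g : Γ) σ.elt (w : D.Ext)
  simp only [Module.End.mul_apply, LinearMap.smul_apply, opL_bas, map_add, map_smul, actOp_bas,
    h.desc_cj, h.q_cj, ← h.cj_elt, ← map_mul, Subgroup.coe_mul, hz2]
  by_cases hd : σ.Desc (w : D.Ext)
  · simp only [hd, if_true]
    linear_combination (norm := module) -(D.z g (w : D.Ext).left : ℂ) •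
      congrArg (fun c => c • bas (h.cj g w)) hz
  · simp only [hd, if_false]
    module

theorem Admissible.actOp_shiftL (h : D.Admissible P K) (g : K) (ω : D.aff P) :
    h.actOp g * shiftL ω =
      (D.z g (ω : D.Ext).left : ℂ) • (shiftL (h.cj g ω) * h.actOp g) := by
  refine end_ext fun w => ?_
  simp only [Module.End.mul_apply, LinearMap.smul_apply, shiftL_bas, map_smul, actOp_bas,
    ← map_mul, Subgroup.coe_mul, z_mul_left (g : Γ) ω (w : D.Ext), mul_smul]

theorem Admissible.actOp_leftOp (h : D.Admissible P K) (g : K) (w : D.aff P) :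
    h.actOp g * leftOp h.subset w =
      (D.z g (w : D.Ext).left : ℂ) • (leftOp h.subset (h.cj g w) * h.actOp g) := by
  refine aff_induction h.subset (p := fun w => h.actOp g * leftOp h.subset w =
      (D.z g (w : D.Ext).left : ℂ) • (leftOp h.subset (h.cj g w) * h.actOp g))
    (fun ω hω => ?_) (fun σ w hd ih => ?_) w
  · rw [leftOp_len_zero _ hω, leftOp_len_zero _ (by rw [h.len_cj, hω]), h.actOp_shiftL]
  · rw [leftOp_elt_mul _ σ hd, map_mul, h.cj_elt, leftOp_elt_mul _ _ (by rwa [h.desc_cj]),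
      ← mul_assoc, h.actOp_opL, smul_mul_assoc, mul_assoc, ih, Subgroup.coe_mul, z_mul_left,
      mul_smul_comm, smul_smul, mul_assoc]

theorem coc_one_right (g : Γ) : D.coc g 1 = 1 := by
  have h := D.coc_assoc g 1 1
  rw [one_mul, mul_one, D.coc_one, mul_one] at h
  exact mul_eq_left.1 h

theorem coc_inv_comm (g : Γ) : D.coc g⁻¹ g = D.coc g g⁻¹ := by
  have h := D.coc_assoc g g⁻¹ g
  rw [mul_inv_cancel, inv_mul_cancel, D.coc_one_left, coc_one_right, mul_one, one_mul] at h
  exact h.symm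

/-- The space on which the regular representation of `H^P ⋊ ℂ[K, ♮]` is realized. -/
abbrev RegSpaceK (D : TwistedDatum ι X Y Γ) (P : Set ι) (K : Subgroup Γ) : Type _ :=
  K → D.RegSpace P

/-- The operator of `N_w` in the regular representation. -/
def Admissible.repW (h : D.Admissible P K) (w : D.aff P) : Module.End ℂ (D.RegSpaceK P K) :=
  (leftOp h.subset w).compLeft K

/-- The operator of `N_g` in the regular representation. -/
def Admissible.repK (h : D.Admissible P K) (g : K) : Module.End ℂ (D.RegSpaceK P K) :=
  LinearMap.pi fun k => (D.coc g (g⁻¹ * k : K) : ℂ) • (h.actOp g ∘ₗ LinearMap.proj (g⁻¹ * k))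

theorem Admissible.repW_apply (h : D.Admissible P K) (w : D.aff P) (f : D.RegSpaceK P K) (k : K) :
    h.repW w f k = leftOp h.subset w (f k) := rfl

theorem Admissible.repK_apply (h : D.Admissible P K) (g : K) (f : D.RegSpaceK P K) (k : K) :
    h.repK g f k = (D.coc g (g⁻¹ * k : K) : ℂ) • h.actOp g (f (g⁻¹ * k)) := rfl

/-- The images of the generators in the regular representation. -/
def Admissible.repGen (h : D.Admissible P K) : D.Gen P K → Module.End ℂ (D.RegSpaceK P K)
  | .inl w => h.repW w
  | .inr g => h.repK g

theorem Admissible.repGen_rel (h : D.Admissible P K) {a b : FreeAlgebra ℂ (D.Gen P K)}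
    (hab : D.Rel P K a b) :
    FreeAlgebra.lift ℂ h.repGen a = FreeAlgebra.lift ℂ h.repGen b := by
  refine LinearMap.ext fun f => funext fun k => ?_
  induction hab with
  | one =>
    simp only [genW, FreeAlgebra.lift_ι_apply, map_one, repGen, repW_apply, leftOp_one,
      Module.End.one_apply]
  | mul v w hvw =>
    simp only [genW, FreeAlgebra.lift_ι_apply, map_mul, repGen, Module.End.mul_apply, repW_apply]
    rw [← leftOp_mul _ hvw, Module.End.mul_apply]
  | simple i hi s hs =>
    let σ : D.SimpleAff P := ⟨(i, 0), .inl ⟨rfl, hi⟩⟩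
    have e : s = σ.elt := Subtype.ext (hs.trans (aref_zero i).symm)
    have hq : σ.q = D.quad (D.lam i) := by
      change D.quad (D.par i 0) = _
      rw [par, if_pos (by decide)]
    simp only [genW, FreeAlgebra.lift_ι_apply, map_mul, map_add, map_smul, map_one, repGen,
      Module.End.mul_apply, LinearMap.add_apply, LinearMap.smul_apply, Module.End.one_apply,
      Pi.add_apply, Pi.smul_apply, repW_apply]
    rw [e, leftOp_elt, ← Module.End.mul_apply, opL_sq h.subset, hq]
    rfl
  | affine i hi s hs =>
    let σ : D.SimpleAff P := ⟨(i, 1), .inr ⟨rfl, hi⟩⟩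
    have e : s = σ.elt := Subtype.ext (hs.trans (aref_one i).symm)
    have hq : σ.q = D.quad (D.lamStar i) := by
      change D.quad (D.par i 1) = _
      rw [par, if_neg (by decide)]
    simp only [genW, FreeAlgebra.lift_ι_apply, map_mul, map_add, map_smul, map_one, repGen,
      Module.End.mul_apply, LinearMap.add_apply, LinearMap.smul_apply, Module.End.one_apply,
      Pi.add_apply, Pi.smul_apply, repW_apply]
    rw [e, leftOp_elt, ← Module.End.mul_apply, opL_sq h.subset, hq]
    rfl
  | group_one =>
    simp only [genK, FreeAlgebra.lift_ι_apply, map_one, repGen, repK_apply, Module.End.one_apply,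
      actOp_one, Subgroup.coe_one, D.coc_one_left, Units.val_one, one_smul, inv_one, one_mul]
  | group_mul g g' =>
    simp only [genK, FreeAlgebra.lift_ι_apply, map_mul, map_smul, repGen, Module.End.mul_apply,
      LinearMap.smul_apply, Pi.smul_apply, repK_apply]
    have h1 := D.coc_assoc g g' ((g * g')⁻¹ * k : K)
    have e1 : (g' : Γ) * ((g * g')⁻¹ * k : K) = (g⁻¹ * k : K) := by
      rw [← Subgroup.coe_mul]; congr 1; group
    have e2 : g'⁻¹ * (g⁻¹ * k) = (g * g')⁻¹ * k := by group
    rw [e1] at h1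
    rw [← h.actOp_mul, Module.End.mul_apply, e2, smul_smul, smul_smul, ← Units.val_mul,
      ← Units.val_mul, Subgroup.coe_mul K g g', h1]
  | cross g w w' hw =>
    have e : w' = h.cj g w := Subtype.ext hw
    simp only [genK, genW, FreeAlgebra.lift_ι_apply, map_mul, map_smul, repGen,
      Module.End.mul_apply, LinearMap.smul_apply, Pi.smul_apply, repK_apply, repW_apply]
    rw [← Module.End.mul_apply, h.actOp_leftOp, e, LinearMap.smul_apply, Module.End.mul_apply,
      smul_comm]

/-- The regular representation of `H^P ⋊ ℂ[K, ♮]`. -/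
def Admissible.rep (h : D.Admissible P K) : D.Alg P K →ₐ[ℂ] Module.End ℂ (D.RegSpaceK P K) :=
  RingQuot.liftAlgHom ℂ ⟨FreeAlgebra.lift ℂ h.repGen, fun _ _ hab => h.repGen_rel hab⟩

theorem Admissible.rep_toAlg (h : D.Admissible P K) (a : FreeAlgebra ℂ (D.Gen P K)) :
    h.rep (D.toAlg P K a) = FreeAlgebra.lift ℂ h.repGen a :=
  RingQuot.liftAlgHom_mkAlgHom_apply ..

theorem Admissible.rep_nW (h : D.Admissible P K) (w : D.aff P) :
    h.rep (D.nW P K w) = h.repW w := by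
  rw [nW, rep_toAlg, genW, FreeAlgebra.lift_ι_apply]; rfl

theorem Admissible.rep_nK (h : D.Admissible P K) (g : K) :
    h.rep (D.nK P K g) = h.repK g := by
  rw [nK, rep_toAlg, genK, FreeAlgebra.lift_ι_apply]; rfl

open Classical in
/-- The trace `τ` of `H^P ⋊ ℂ[K, ♮]`: a matrix coefficient of the regular representation. -/
def Admissible.tau (h : D.Admissible P K) : D.Alg P K →ₗ[ℂ] ℂ where
  toFun a := h.rep a (Pi.single 1 (bas 1)) 1 1
  map_add' a b := by simp
  map_smul' c a := by simp

open Classical in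
theorem Admissible.tau_apply (h : D.Admissible P K) (a : D.Alg P K) :
    h.tau a = h.rep a (Pi.single 1 (bas 1)) 1 1 := rfl

open Classical in
theorem Admissible.repK_single (h : D.Admissible P K) (g : K) :
    h.repK g (Pi.single 1 (bas 1)) = Pi.single g (bas 1) := by
  funext k
  rw [repK_apply]
  by_cases hk : k = g
  · subst hk
    rw [inv_mul_cancel, Pi.single_eq_same, Pi.single_eq_same, Subgroup.coe_one, coc_one_right,
      Units.val_one, one_smul, actOp_bas, map_one, Subgroup.coe_one, z_one_left, one_smul]
  · have : g⁻¹ * k ≠ 1 := fun h' => hk (inv_mul_eq_one.1 h').symm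
    rw [Pi.single_eq_of_ne this, Pi.single_eq_of_ne hk, map_zero, smul_zero]

open Classical in
/-- The trace is the coefficient of the unit element in the Iwahori--Matsumoto basis. -/
theorem Admissible.tau_nW_mul_nK (h : D.Admissible P K) (w : D.aff P) (g : K) :
    h.tau (D.nW P K w * D.nK P K g) = if w = 1 ∧ g = 1 then 1 else 0 := by
  rw [tau_apply, map_mul, rep_nW, rep_nK, Module.End.mul_apply, repK_single, repW_apply]
  by_cases hg : g = 1
  · subst hg
    rw [Pi.single_eq_same, leftOp_bas_one, bas, Finsupp.single_apply]
    simp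
  · rw [Pi.single_eq_of_ne' hg, map_zero, if_neg (fun h' => hg h'.2), Finsupp.zero_apply]

open Classical in
theorem Admissible.tau_nW_mul_nW (h : D.Admissible P K) (v w : D.aff P) :
    h.tau (D.nW P K v * D.nW P K w) = if v⁻¹ = w then 1 else 0 := by
  rw [tau_apply, map_mul, rep_nW, rep_nW, Module.End.mul_apply, repW_apply, repW_apply,
    Pi.single_eq_same, leftOp_bas_one, leftOp_adjoint, leftOp_bas_one, bas, Finsupp.single_apply]

/-! ### The Iwahori--Matsumoto basis -/

theorem nW_elt_sq (σ : D.SimpleAff P) :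
    D.nW P K σ.elt * D.nW P K σ.elt = 1 + σ.q • D.nW P K σ.elt := by
  rw [nW, ← map_mul]
  obtain ⟨⟨i, k⟩, hσ⟩ := σ
  rcases hσ with ⟨hk, hi⟩ | ⟨hk, hi⟩
  · obtain rfl : k = 0 := hk
    rw [D.toAlg_rel (.simple i hi _ (aref_zero i)), map_add, map_smul, map_one]
    change _ = 1 + D.quad (D.par i 0) • _
    rw [par, if_pos (by decide)]
  · obtain rfl : k = 1 := hk
    rw [D.toAlg_rel (.affine i hi _ (aref_one i)), map_add, map_smul, map_one]
    change _ = 1 + D.quad (D.par i 1) • _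
    rw [par, if_neg (by decide)]

theorem nW_elt_mul (hP : P ⊆ D.simple) (σ : D.SimpleAff P) {w : D.aff P}
    (h : ¬ σ.Desc (w : D.Ext)) :
    D.nW P K σ.elt * D.nW P K w = D.nW P K (σ.elt * w) := D.nW_mul (σ.len_elt_mul hP h)

theorem nW_elt_mul_of_desc (hP : P ⊆ D.simple) (σ : D.SimpleAff P) {w : D.aff P}
    (h : σ.Desc (w : D.Ext)) :
    D.nW P K σ.elt * D.nW P K w = D.nW P K (σ.elt * w) + σ.q • D.nW P K w := by
  have h1 : ¬ σ.Desc ((σ.elt * w : D.aff P) : D.Ext) := by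
    rw [Subgroup.coe_mul, σ.desc_elt_mul hP, not_not]; exact h
  have h2 := nW_elt_mul (K := K) hP σ h1
  rw [σ.elt_mul_elt_mul] at h2
  rw [← h2, ← mul_assoc, nW_elt_sq, add_mul, one_mul, smul_mul_assoc]

theorem nW_len_zero_mul {ω : D.aff P} (hω : D.len P (ω : D.Ext) = 0) (w : D.aff P) :
    D.nW P K ω * D.nW P K w = D.nW P K (ω * w) := by
  refine D.nW_mul ?_
  rw [(len_mul_iff ω.2 _).2 fun i hi => by rw [len_eq_zero_iff.1 hω i hi, zero_mul]]

theorem isUnit_nW (hP : P ⊆ D.simple) (w : D.aff P) : IsUnit (D.nW P K w) := by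
  refine aff_induction hP (p := fun w => IsUnit (D.nW P K w)) (fun ω hω => ?_)
    (fun σ w hd ih => ?_) w
  · have h1 := nW_len_zero_mul (K := K) hω ω⁻¹
    have h2 := nW_len_zero_mul (K := K) (ω := ω⁻¹) (by
      rw [InvMemClass.coe_inv, D.len_inv P ω.2, hω]) ω
    rw [mul_inv_cancel, nW_one] at h1
    rw [inv_mul_cancel, nW_one] at h2
    exact ⟨⟨_, _, h1, h2⟩, rfl⟩
  · rw [← nW_elt_mul hP σ hd]
    refine IsUnit.mul ⟨⟨D.nW P K σ.elt, D.nW P K σ.elt - σ.q • 1, ?_, ?_⟩, rfl⟩ ih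
    · rw [mul_sub, nW_elt_sq, mul_smul_comm, mul_one, add_sub_cancel_right]
    · rw [sub_mul, nW_elt_sq, smul_mul_assoc, one_mul, add_sub_cancel_right]

/-- An induction principle for `H^P ⋊ ℂ[K, ♮]` that uses only that this algebra is generated by the
`N_w` and the `N_g`. -/
theorem alg_induction {p : D.Alg P K → Prop} (hW : ∀ w, p (D.nW P K w)) (hK : ∀ g, p (D.nK P K g))
    (hadd : ∀ a b, p a → p b → p (a + b)) (hmul : ∀ a b, p a → p b → p (a * b))
    (hc : ∀ c : ℂ, p (algebraMap ℂ _ c)) (a : D.Alg P K) : p a := by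
  obtain ⟨a, rfl⟩ : ∃ b, D.toAlg P K b = a := RingQuot.mkAlgHom_surjective ℂ (D.Rel P K) a
  induction a using FreeAlgebra.induction with
  | grade0 c => rw [AlgHom.commutes]; exact hc c
  | grade1 x =>
    cases x with
    | inl w => exact hW w
    | inr g => exact hK g
  | mul a b ha hb => rw [map_mul]; exact hmul _ _ ha hb
  | add a b ha hb => rw [map_add]; exact hadd _ _ ha hb

theorem mul_mem_of_gen {S : Submodule ℂ (D.Alg P K)} (hW : ∀ w, ∀ s ∈ S, D.nW P K w * s ∈ S)
    (hK : ∀ g, ∀ s ∈ S, D.nK P K g * s ∈ S) (a : D.Alg P K) : ∀ s ∈ S, a * s ∈ S := by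
  refine alg_induction (p := fun a => ∀ s ∈ S, a * s ∈ S) hW hK ?_ ?_ ?_ a
  · intro a b ha hb s hs
    rw [add_mul]; exact add_mem (ha s hs) (hb s hs)
  · intro a b ha hb s hs
    rw [mul_assoc]; exact ha _ (hb s hs)
  · intro c s hs
    rw [← Algebra.smul_def]; exact S.smul_mem c hs

/-- The `N_w` span a subalgebra, the image of `H^P`. -/
theorem mul_mem_span_nW (hP : P ⊆ D.simple) (v w : D.aff P) :
    D.nW P K v * D.nW P K w ∈ Submodule.span ℂ (Set.range (D.nW P K)) := by
  have hmem : ∀ w, D.nW P K w ∈ Submodule.span ℂ (Set.range (D.nW P K)) := fun w =>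
    Submodule.subset_span ⟨w, rfl⟩
  have hσ : ∀ (σ : D.SimpleAff P), ∀ x ∈ Submodule.span ℂ (Set.range (D.nW P K)),
      D.nW P K σ.elt * x ∈ Submodule.span ℂ (Set.range (D.nW P K)) := by
    intro σ x hx
    induction hx using Submodule.span_induction with
    | mem x hx =>
      obtain ⟨w, rfl⟩ := hx
      by_cases h : σ.Desc (w : D.Ext)
      · rw [nW_elt_mul_of_desc hP σ h]
        exact add_mem (hmem _) (Submodule.smul_mem _ _ (hmem _))
      · rw [nW_elt_mul hP σ h]; exact hmem _
    | zero => rw [mul_zero]; exact zero_mem _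
    | add x y _ _ hx hy => rw [mul_add]; exact add_mem hx hy
    | smul c x _ hx => rw [mul_smul_comm]; exact Submodule.smul_mem _ _ hx
  refine aff_induction hP (p := fun v => D.nW P K v * D.nW P K w ∈ _) (fun ω hω => ?_)
    (fun σ v hd ih => ?_) v
  · rw [nW_len_zero_mul hω]; exact hmem _
  · rw [← nW_elt_mul hP σ hd, mul_assoc]
    exact hσ σ _ ih

theorem Admissible.nK_mul_nW (h : D.Admissible P K) (g : K) (w : D.aff P) :
    D.nK P K g * D.nW P K w =
      (D.z g (w : D.Ext).left : ℂ) • (D.nW P K (h.cj g w) * D.nK P K g) :=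
  D.nK_mul_nW g w _ rfl

/-- The elements `N_w N_g` span `H^P ⋊ ℂ[K, ♮]`, because their span is a left ideal. -/
theorem Admissible.span_eq_top (h : D.Admissible P K) :
    Submodule.span ℂ (Set.range fun p : D.aff P × K => D.nW P K p.1 * D.nK P K p.2) = ⊤ := by
  rw [Submodule.eq_top_iff']
  intro a
  have hmem : ∀ w g, D.nW P K w * D.nK P K g ∈
      Submodule.span ℂ (Set.range fun p : D.aff P × K => D.nW P K p.1 * D.nK P K p.2) :=
    fun w g => Submodule.subset_span ⟨(w, g), rfl⟩
  rw [← mul_one a]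
  refine mul_mem_of_gen ?_ ?_ a 1 (by
    have := hmem 1 1
    rwa [D.nW_one, D.nK_one, one_mul] at this)
  · intro v s hs
    induction hs using Submodule.span_induction with
    | mem x hx =>
      obtain ⟨⟨w, g⟩, rfl⟩ := hx
      simp only
      rw [← mul_assoc]
      have h1 := mul_mem_span_nW (K := K) h.subset v w
      generalize D.nW P K v * D.nW P K w = y at h1 ⊢
      induction h1 using Submodule.span_induction with
      | mem x hx => obtain ⟨u, rfl⟩ := hx; exact hmem _ _
      | zero => rw [zero_mul]; exact zero_mem _
      | add x y _ _ hx hy => rw [add_mul]; exact add_mem hx hy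
      | smul c x _ hx => rw [smul_mul_assoc]; exact Submodule.smul_mem _ _ hx
    | zero => rw [mul_zero]; exact zero_mem _
    | add x y _ _ hx hy => rw [mul_add]; exact add_mem hx hy
    | smul c x _ hx => rw [mul_smul_comm]; exact Submodule.smul_mem _ _ hx
  · intro k s hs
    induction hs using Submodule.span_induction with
    | mem x hx =>
      obtain ⟨⟨w, g⟩, rfl⟩ := hx
      simp only
      rw [← mul_assoc, h.nK_mul_nW, smul_mul_assoc, mul_assoc, D.nK_mul, mul_smul_comm]
      exact Submodule.smul_mem _ _ (Submodule.smul_mem _ _ (hmem _ _))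
    | zero => rw [mul_zero]; exact zero_mem _
    | add x y _ _ hx hy => rw [mul_add]; exact add_mem hx hy
    | smul c x _ hx => rw [mul_smul_comm]; exact Submodule.smul_mem _ _ hx

theorem Admissible.tau_nW (h : D.Admissible P K) (w : D.aff P) :
    h.tau (D.nW P K w) = h.tau (D.nW P K w * D.nK P K 1) := by rw [nK_one, mul_one]

open Classical in
theorem Admissible.tau_conj (h : D.Admissible P K) (g k : K) {b : D.Alg P K}
    (hb : b ∈ Submodule.span ℂ (Set.range (D.nW P K))) :
    h.tau (D.nK P K g⁻¹ * b * D.nK P K k) =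
      if g = k then (D.coc g (g : Γ)⁻¹ : ℂ) * h.tau b else 0 := by
  induction hb using Submodule.span_induction with
  | mem x hx =>
    obtain ⟨u, rfl⟩ := hx
    rw [h.nK_mul_nW, smul_mul_assoc, mul_assoc, D.nK_mul, mul_smul_comm, map_smul, map_smul,
      h.tau_nW, h.tau_nW_mul_nK, h.tau_nW_mul_nK, InvMemClass.coe_inv]
    by_cases hgk : g = k
    · subst hgk
      have : h.cj g⁻¹ u = 1 ↔ u = 1 :=
        ⟨fun e => h.cj_injective g⁻¹ (e.trans (map_one _).symm), fun e => by rw [e, map_one]⟩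
      simp only [this, coc_inv_comm]
      by_cases hu : u = 1
      · subst hu
        rw [Subgroup.coe_one, z_one_left]; simp
      · simp [hu]
    · have : g⁻¹ * k ≠ 1 := fun h' => hgk (inv_mul_eq_one.1 h')
      simp [hgk, this]
  | zero => simp
  | add x y _ _ hx hy => rw [mul_add, add_mul, map_add, hx, hy, map_add]; split_ifs <;> ring
  | smul c x _ hx =>
    rw [mul_smul_comm, smul_mul_assoc, map_smul, hx, map_smul]
    split_ifs
    · simp only [smul_eq_mul]; ring
    · simp

open Classical in
/-- The Iwahori--Matsumoto basis is orthogonal for the pairing `τ(a^* b)`. -/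
theorem Admissible.tau_star_mul (h : D.Admissible P K) (x y : D.aff P) (g k : K) :
    h.tau (star (D.nW P K x * D.nK P K g) * (D.nW P K y * D.nK P K k)) =
      if x = y ∧ g = k then (D.absNorm g : ℂ) ^ 2 else 0 := by
  have e : star (D.nW P K x * D.nK P K g) * (D.nW P K y * D.nK P K k) =
      D.starCoeff g • (D.nK P K g⁻¹ * (D.nW P K x⁻¹ * D.nW P K y) * D.nK P K k) := by
    rw [star_mul, star_nW, star_nK]
    simp only [smul_mul_assoc, mul_assoc]
  rw [e, map_smul, h.tau_conj g k (mul_mem_span_nW h.subset _ _), h.tau_nW_mul_nW, inv_inv]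
  by_cases hg : g = k
  · by_cases hx : x = y
    · simp only [hg, hx, and_self, if_true, smul_eq_mul, mul_one, starCoeff]
      rw [mul_assoc, inv_mul_cancel₀ (Units.ne_zero _), mul_one]
    · simp [hx]
  · simp [hg]

/-- The pairing `τ(a^* b)` is nondegenerate. -/
theorem Admissible.eq_zero_of_tau (h : D.Admissible P K) {b : D.Alg P K}
    (hb : ∀ x g, h.tau (star (D.nW P K x * D.nK P K g) * b) = 0) : b = 0 := by
  classical
  have hmem : b ∈ Submodule.span ℂ
      (Set.range fun p : D.aff P × K => D.nW P K p.1 * D.nK P K p.2) := by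
    rw [h.span_eq_top]; trivial
  obtain ⟨c, rfl⟩ := (Finsupp.mem_span_range_iff_exists_finsupp).1 hmem
  have hc : c = 0 := by
    ext ⟨x, g⟩
    have := hb x g
    rw [Finsupp.sum, Finset.mul_sum, map_sum] at this
    simp_rw [mul_smul_comm, map_smul, h.tau_star_mul] at this
    rw [Finset.sum_eq_single (x, g)] at this
    · have hn : (D.absNorm g : ℂ) ≠ 0 := by exact_mod_cast (D.absNorm_pos g).ne'
      simpa [hn] using this
    · intro p _ hp
      rw [if_neg, smul_zero]
      rintro ⟨rfl, rfl⟩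
      exact hp rfl
    · intro hp
      rw [Finsupp.notMem_support_iff.1 hp, zero_smul]
  rw [hc, Finsupp.sum_zero_index]

end TwistedDatum

namespace HeckeDatum

variable {ι X Y : Type*} [Fintype ι] [AddCommGroup X] [AddCommGroup Y] {D : HeckeDatum ι X Y}

/-! ### Translations far into the cone that is orthogonal to a parabolic subsystem -/

variable (D) in
/-- The translation by `n` times the sum of the positive roots outside `R_P`. -/
def tr (P : Set ι) (n : ℕ) : D.Ext := D.trans (n • D.mu P)

variable {P : Set ι}

theorem trans_mul_trans (x y : X) : D.trans x * D.trans y = D.trans (x + y) :=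
  (map_mul SemidirectProduct.inl _ _).symm

theorem tr_mul_tr (m n : ℕ) : D.tr P m * D.tr P n = D.tr P (m + n) := by
  rw [tr, tr, tr, trans_mul_trans, add_smul]

theorem tr_mem_aff (Q : Set ι) (n : ℕ) : D.tr P n ∈ D.aff Q := trans_mem_aff _

theorem mul_trans (w : D.Ext) (x : X) : w * D.trans x = D.trans (w.right • x) * w := by
  refine ext_of_toAdd ?_ (show w.right * 1 = 1 * w.right by rw [mul_one, one_mul])
  change w.left.toAdd + w.right • x = w.right • x + (1 : D.R.Aut) • w.left.toAdd
  rw [one_smul, add_comm]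

theorem smul_nsmul_aut (u : D.R.Aut) (n : ℕ) (x : X) : u • (n • x) = n • (u • x) :=
  (DistribSMul.toAddMonoidHom X u).map_nsmul n x

theorem mul_tr_comm (hP : P ⊆ D.simple) {w : D.Ext} (hw : w ∈ D.aff P) (n : ℕ) :
    w * D.tr P n = D.tr P n * w := by
  have hw' : w.right ∈ D.weyl P := hw
  rw [tr, mul_trans, smul_nsmul_aut, weyl_smul_mu hP hw']

theorem cr_tr (n : ℕ) (i : ι) : cr (D.tr P n) i = n * D.pr (D.mu P) i := by
  rw [tr, cr_trans, pr_nsmul]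

theorem cr_mul_tr (w : D.Ext) (n : ℕ) (i : ι) :
    cr (w * D.tr P n) i = cr w i + n * D.pr (D.mu P) (w.right⁻¹ • i) := by
  rw [cr_mul, cr_tr]

theorem abs_cr_le (w : D.Ext) (i : ι) {n : ℕ} (hn : 2 * D.len D.simple w ≤ n) :
    -(n : ℤ) ≤ cr w i ∧ cr w i ≤ n := by
  have := natAbs_cr_le (P := D.simple) w (i := i) (by rw [sub_simple]; trivial)
  omega

theorem pr_mu_cases (hP : P ⊆ D.simple) (i : ι) :
    (i ∈ D.sub P ∧ D.pr (D.mu P) i = 0) ∨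
      (i ∉ D.sub P ∧ D.base.IsPos i ∧ 1 ≤ D.pr (D.mu P) i) ∨
      (i ∉ D.sub P ∧ ¬ D.base.IsPos i ∧ D.pr (D.mu P) i ≤ -1) := by
  by_cases h : i ∈ D.sub P
  · exact .inl ⟨h, pr_mu_of_mem hP h⟩
  · by_cases hi : D.base.IsPos i
    · exact .inr (.inl ⟨h, hi, pr_mu_pos hP hi h⟩)
    · exact .inr (.inr ⟨h, hi, by have := pr_mu_neg hP hi h; omega⟩)

theorem pr_mu_smul (hP : P ⊆ D.simple) {u : D.R.Aut} (hu : u ∈ D.weyl P) (i : ι) :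
    D.pr (D.mu P) (u • i) = D.pr (D.mu P) i := by
  conv_lhs => rw [← weyl_smul_mu hP hu]
  exact D.pr_smul _ _ _

/-- Far away translations dominate the hyperplane counts of a given element. -/
theorem cr_mul_tr_nonneg (w : D.Ext) {i : ι} {n : ℕ} (hn : 2 * D.len D.simple w ≤ n)
    (h : 1 ≤ D.pr (D.mu P) (w.right⁻¹ • i)) : 0 ≤ cr (w * D.tr P n) i := by
  rw [cr_mul_tr]
  have := (abs_cr_le w i hn).1
  nlinarith

theorem cr_mul_tr_nonpos (w : D.Ext) {i : ι} {n : ℕ} (hn : 2 * D.len D.simple w ≤ n)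
    (h : D.pr (D.mu P) (w.right⁻¹ • i) ≤ -1) : cr (w * D.tr P n) i ≤ 0 := by
  rw [cr_mul_tr]
  have := (abs_cr_le w i hn).2
  nlinarith

theorem len_mul_tr_tr (hP : P ⊆ D.simple) {w : D.Ext} (hw : w ∈ D.aff D.simple) {n : ℕ}
    (hn : 2 * D.len D.simple w ≤ n) (m : ℕ) :
    D.len D.simple (w * D.tr P n * D.tr P m) =
      D.len D.simple (w * D.tr P n) + D.len D.simple (D.tr P m) := by
  refine (len_mul_iff (mul_mem hw (tr_mem_aff _ _)) _).2 fun i _ => ?_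
  have e : (w * D.tr P n).right = w.right := mul_one w.right
  rw [e, cr_tr]
  rcases pr_mu_cases hP (w.right⁻¹ • i) with ⟨_, h⟩ | ⟨_, _, h⟩ | ⟨_, _, h⟩
  · rw [h, mul_zero, mul_zero]
  · exact mul_nonneg (cr_mul_tr_nonneg w hn h) (by positivity)
  · exact mul_nonneg_of_nonpos_of_nonpos (cr_mul_tr_nonpos w hn h)
      (mul_nonpos_of_nonneg_of_nonpos (by positivity) (by omega))

theorem cr_mul_tr_of_mem (hP : P ⊆ D.simple) {w : D.Ext} (hw : w ∈ D.aff P) {i : ι}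
    (hi : i ∈ D.sub P) (n : ℕ) : cr (w * D.tr P n) i = cr w i := by
  have hw' : w.right ∈ D.weyl P := hw
  rw [cr_mul_tr, pr_mu_smul hP (inv_mem hw'), pr_mu_of_mem hP hi, mul_zero, add_zero]

theorem cr_mul_tr_of_pos (hP : P ⊆ D.simple) {w : D.Ext} (hw : w ∈ D.aff P) {i : ι}
    (hi : i ∉ D.sub P) (hpos : D.base.IsPos i) {n : ℕ} (hn : 2 * D.len D.simple w ≤ n) :
    0 ≤ cr (w * D.tr P n) i := by
  have hw' : w.right ∈ D.weyl P := hw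
  refine cr_mul_tr_nonneg w hn ?_
  rw [pr_mu_smul hP (inv_mem hw')]
  exact pr_mu_pos hP hpos hi

theorem cr_mul_tr_of_neg (hP : P ⊆ D.simple) {w : D.Ext} (hw : w ∈ D.aff P) {i : ι}
    (hi : i ∉ D.sub P) (hpos : ¬ D.base.IsPos i) {n : ℕ} (hn : 2 * D.len D.simple w ≤ n) :
    cr (w * D.tr P n) i ≤ 0 := by
  have hw' : w.right ∈ D.weyl P := hw
  refine cr_mul_tr_nonpos w hn ?_
  rw [pr_mu_smul hP (inv_mem hw')]
  have := pr_mu_neg hP hpos hi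
  omega

/-- For elements of `W_P ⋉ X` that are translated far away, additivity of the lengths in `W ⋉ X`
follows from additivity of the lengths in `W_P ⋉ X`. -/
theorem len_mul_tr_mul_tr (hP : P ⊆ D.simple) {v w : D.Ext} (hv : v ∈ D.aff P)
    (hw : w ∈ D.aff P) (h : D.len P (v * w) = D.len P v + D.len P w) {m n : ℕ}
    (hm : 2 * D.len D.simple v ≤ m) (hn : 2 * D.len D.simple w ≤ n) :
    D.len D.simple (v * D.tr P m * (w * D.tr P n)) =
      D.len D.simple (v * D.tr P m) + D.len D.simple (w * D.tr P n) := by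
  have hv' : v.right⁻¹ ∈ D.weyl P := inv_mem hv
  refine (len_mul_iff (mul_mem (aff_mono hP hv) (tr_mem_aff _ _)) _).2 fun i _ => ?_
  have e : (v * D.tr P m).right = v.right := mul_one v.right
  rw [e]
  by_cases hi : i ∈ D.sub P
  · rw [cr_mul_tr_of_mem hP hv hi, cr_mul_tr_of_mem hP hw ((D.smul_mem_sub_iff hv').2 hi)]
    exact (len_mul_iff hv w).1 h i hi
  · have hi' : v.right⁻¹ • i ∉ D.sub P := fun h' => hi ((D.smul_mem_sub_iff hv').1 h')
    by_cases hpos : D.base.IsPos i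
    · exact mul_nonneg (cr_mul_tr_of_pos hP hv hi hpos hm)
        (cr_mul_tr_of_pos hP hw hi' ((smul_isPos_of_not_mem hP hv' hi).2 hpos) hn)
    · exact mul_nonneg_of_nonpos_of_nonpos (cr_mul_tr_of_neg hP hv hi hpos hm)
        (cr_mul_tr_of_neg hP hw hi' (fun h' => hpos ((smul_isPos_of_not_mem hP hv' hi).1 h')) hn)

theorem isPos_smul_of_minReps (hP : P ⊆ D.simple) {u : D.R.Aut} (hu : ∀ i ∈ P, D.base.IsPos (u • i))
    {i : ι} (hi : i ∈ D.sub P) : D.base.IsPos (u • i) ↔ D.base.IsPos i := by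
  have key : ∀ i ∈ D.sub P, D.base.IsPos i → D.base.IsPos (u • i) := by
    intro i hi hpos
    have h1 : ∀ y ∈ AddSubmonoid.closure (D.R.coroot '' P),
        0 ≤ D.R.toLinearMap (u⁻¹ • D.mu ∅) y := by
      intro y hy
      induction hy using AddSubmonoid.closure_induction with
      | mem y hy =>
        obtain ⟨j, hj, rfl⟩ := hy
        change 0 ≤ D.pr (u⁻¹ • D.mu ∅) j
        rw [pr_smul_left, inv_inv]
        exact ((isPos_iff_pr _).1 (hu j hj)).le
      | zero => rw [map_zero]
      | add x y _ _ hx hy => rw [map_add]; exact add_nonneg hx hy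
    have h2 : 0 ≤ D.pr (D.mu ∅) (u • i) := by
      have := h1 _ (coroot_mem_cone hP hi hpos)
      change 0 ≤ D.pr (u⁻¹ • D.mu ∅) i at this
      rwa [pr_smul_left, inv_inv] at this
    by_contra hneg
    have h3 := (isPos_iff_pr _).1 ((D.isPos_opp _).2 hneg)
    rw [pr_opp] at h3
    omega
  refine ⟨fun h => ?_, key i hi⟩
  by_contra hneg
  have := key _ (D.opp_mem_sub.2 hi) ((D.isPos_opp i).2 hneg)
  rw [smul_opp, isPos_opp] at this
  exact this h

theorem eps_smul_of_minReps (hP : P ⊆ D.simple) {u : D.R.Aut}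
    (hu : ∀ i ∈ P, D.base.IsPos (u • i)) {i : ι} (hi : i ∈ D.sub P) :
    D.eps (u • i) = D.eps i := by
  by_cases h : D.base.IsPos i
  · rw [eps_pos h, eps_pos ((isPos_smul_of_minReps hP hu hi).2 h)]
  · rw [eps_neg h, eps_neg fun h' => h ((isPos_smul_of_minReps hP hu hi).1 h')]

theorem eps_smul_of_not_mem (hP : P ⊆ D.simple) {u : D.R.Aut} (hu : u ∈ D.weyl P) {i : ι}
    (hi : i ∉ D.sub P) : D.eps (u • i) = D.eps i := by
  by_cases h : D.base.IsPos i
  · rw [eps_pos h, eps_pos ((smul_isPos_of_not_mem hP hu hi).2 h)]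
  · rw [eps_neg h, eps_neg fun h' => h ((smul_isPos_of_not_mem hP hu hi).1 h')]

/-- Lengths add for a minimal coset representative and an element of `W_P ⋉ X` that is translated
far away. -/
theorem len_minReps_mul (hP : P ⊆ D.simple) {u : D.R.Aut} (hu : u ∈ D.minReps P) {w : D.Ext}
    (hw : w ∈ D.aff P) {n : ℕ} (hn : 2 * D.len D.simple w ≤ n) :
    D.len D.simple (D.lin u * (w * D.tr P n)) =
      D.len D.simple (D.lin u) + D.len D.simple (w * D.tr P n) := by
  refine (len_mul_iff (lin_mem_aff hu.1) _).2 fun i _ => ?_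
  rw [lin_right, cr_lin]
  obtain ⟨j, rfl⟩ : ∃ j, i = u • j := ⟨u⁻¹ • i, (smul_inv_smul _ _).symm⟩
  rw [inv_smul_smul]
  by_cases hj : j ∈ D.sub P
  · rw [eps_smul_of_minReps hP hu.2 hj, sub_self, zero_mul]
  · by_cases hpos : D.base.IsPos j
    · rw [eps_pos hpos]
      refine mul_nonneg ?_ (cr_mul_tr_of_pos hP hw hj hpos hn)
      rcases D.eps_mem (u • j) with h | h <;> omega
    · rw [eps_neg hpos]
      refine mul_nonneg_of_nonpos_of_nonpos ?_ (cr_mul_tr_of_neg hP hw hj hpos hn)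
      rcases D.eps_mem (u • j) with h | h <;> omega

theorem len_lin_mul_tr (hP : P ⊆ D.simple) {u : D.R.Aut} (hu : u ∈ D.weyl P) (n : ℕ) :
    D.len D.simple (D.lin u * D.tr P n) = D.len D.simple (D.lin u) + D.len D.simple (D.tr P n) := by
  refine (len_mul_iff (lin_mem_aff (D.weyl_mono hP hu)) _).2 fun i _ => ?_
  rw [lin_right, cr_lin, cr_tr, pr_mu_smul hP (inv_mem hu)]
  by_cases hi : i ∈ D.sub P
  · rw [pr_mu_of_mem hP hi, mul_zero, mul_zero]
  · rw [eps_smul_of_not_mem hP (inv_mem hu) hi, sub_self, zero_mul]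

theorem Dominant.pr_nonneg {x : X} (hx : D.Dominant x) {i : ι} (hi : D.base.IsPos i) :
    0 ≤ D.pr x i := by
  have h1 : ∀ y ∈ AddSubmonoid.closure (D.R.coroot '' D.simple), 0 ≤ D.R.toLinearMap x y := by
    intro y hy
    induction hy using AddSubmonoid.closure_induction with
    | mem y hy => obtain ⟨j, hj, rfl⟩ := hy; exact hx j hj
    | zero => rw [map_zero]
    | add x y _ _ hx hy => rw [map_add]; exact add_nonneg hx hy
  exact h1 _ (coroot_mem_cone subset_rfl (by rw [sub_simple]; trivial) hi)

theorem len_trans_mul_tr (hP : P ⊆ D.simple) {x : X} (hx : D.Dominant x) (n : ℕ) :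
    D.len D.simple (D.trans x * D.tr P n) =
      D.len D.simple (D.trans x) + D.len D.simple (D.tr P n) := by
  refine (len_mul_iff (trans_mem_aff x) _).2 fun i _ => ?_
  have e : (D.trans x).right⁻¹ • i = i := by
    change (1 : D.R.Aut)⁻¹ • i = i
    rw [inv_one, one_smul]
  rw [e, cr_trans, cr_tr]
  by_cases hi : D.base.IsPos i
  · exact mul_nonneg (hx.pr_nonneg hi) (mul_nonneg (by positivity) (pr_mu_nonneg hP hi))
  · have hi' := (D.isPos_opp i).2 hi
    have h1 := hx.pr_nonneg hi'
    have h2 := pr_mu_nonneg hP hi'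
    rw [pr_opp] at h1 h2
    exact mul_nonneg_of_nonpos_of_nonpos (by omega)
      (mul_nonpos_of_nonneg_of_nonpos (by positivity) (by omega))

/-- A simple affine reflection of `W_P ⋉ X` need not be simple in `W ⋉ X`, but it raises the length
of a far away translation by one only: the counts over the positive roots outside `R_P` cancel,
because the reflection permutes these roots. -/
theorem len_aref_mul_tr (hP : P ⊆ D.simple) {i : ι} {k : ℤ} (hi : D.IsSimpleAff P i k) {n : ℕ}
    (hn : 2 * D.len D.simple (D.aref i k) ≤ n) :
    D.len D.simple (D.aref i k * D.tr P n) = D.len D.simple (D.tr P n) + 1 := by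
  classical
  have hr := hi.mem_aff
  have hW : D.refl i ∈ D.weyl P := D.refl_mem_weyl hi.mem_sub
  have split : ∀ w : D.Ext, D.len D.simple w = D.len P w +
      ∑ j with j ∉ D.sub P ∧ D.base.IsPos j, (cr w j).natAbs := by
    intro w
    rw [len_eq, len_eq, ← Finset.sum_filter_add_sum_filter_not _ (fun j => j ∈ D.sub P),
      Finset.filter_filter, Finset.filter_filter]
    congr 1
    · refine Finset.sum_congr (Finset.filter_congr fun j _ => ?_) fun _ _ => rfl
      simp only [sub_simple, Set.mem_univ, true_and]; tauto
    · refine Finset.sum_congr (Finset.filter_congr fun j _ => ?_) fun _ _ => rfl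
      simp only [sub_simple, Set.mem_univ, true_and]; tauto
  have h1 : D.len P (D.aref i k * D.tr P n) = 1 := by
    rw [← hi.len hP, len_eq, len_eq]
    refine Finset.sum_congr rfl fun j hj => ?_
    rw [cr_mul_tr_of_mem hP hr (Finset.mem_filter.1 hj).2.1]
  have h2 : D.len P (D.tr P n) = 0 := len_eq_zero_iff.2 fun j hj => by
    rw [cr_tr, pr_mu_of_mem hP hj, mul_zero]
  have h3 : ∑ j with j ∉ D.sub P ∧ D.base.IsPos j, (cr (D.aref i k * D.tr P n) j).natAbs =
      ∑ j with j ∉ D.sub P ∧ D.base.IsPos j, (cr (D.tr P n) j).natAbs := by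
    zify
    have e1 : ∀ j ∈ Finset.univ.filter (fun j => j ∉ D.sub P ∧ D.base.IsPos j),
        |cr (D.aref i k * D.tr P n) j| = k * D.pr (D.R.root i) j + |cr (D.tr P n) j| := by
      intro j hj
      obtain ⟨hj, hpos⟩ := (Finset.mem_filter.1 hj).2
      rw [abs_of_nonneg (cr_mul_tr_of_pos hP hr hj hpos hn), abs_of_nonneg (by
        rw [cr_tr]; exact mul_nonneg (by positivity) (pr_mu_nonneg hP hpos)), cr_mul_tr, cr_aref,
        eps_smul_of_not_mem hP hW hj, aref_right, refl_inv, pr_mu_smul hP hW, cr_tr]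
      ring
    rw [Finset.sum_congr rfl e1, Finset.sum_add_distrib, ← Finset.mul_sum]
    have e2 : ∑ j with j ∉ D.sub P ∧ D.base.IsPos j, D.pr (D.R.root i) j =
        -∑ j with j ∉ D.sub P ∧ D.base.IsPos j, D.pr (D.R.root i) j := by
      rw [← Finset.sum_neg_distrib]
      have hmem : ∀ j, j ∉ D.sub P ∧ D.base.IsPos j →
          D.refl i • j ∉ D.sub P ∧ D.base.IsPos (D.refl i • j) := fun j hj =>
        ⟨fun h' => hj.1 ((D.smul_mem_sub_iff hW).1 h'), (smul_isPos_of_not_mem hP hW hj.1).2 hj.2⟩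
      refine Finset.sum_nbij' (fun j => D.refl i • j) (fun j => D.refl i • j) ?_ ?_ ?_ ?_ ?_
      · intro j hj
        simp only [Finset.mem_filter, Finset.mem_univ, true_and] at hj ⊢
        exact hmem j hj
      · intro j hj
        simp only [Finset.mem_filter, Finset.mem_univ, true_and] at hj ⊢
        exact hmem j hj
      · intro j _; exact D.refl_refl i j
      · intro j _; exact D.refl_refl i j
      · intro j _
        rw [pr_refl, pr_self]; ring
    have e3 : ∑ j with j ∉ D.sub P ∧ D.base.IsPos j, D.pr (D.R.root i) j = 0 := by omega
    rw [e3, mul_zero, zero_add]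
  rw [split, split (D.tr P n), h1, h2, h3]
  omega

end HeckeDatum

namespace TwistedDatum

open HeckeDatum

variable {ι X Y Γ : Type*} [Fintype ι] [AddCommGroup X] [AddCommGroup Y] [Group Γ] [Fintype Γ]
  {D : TwistedDatum ι X Y Γ} {P : Set ι} {K : Subgroup Γ}

/-! ### The elements `N_w` and `N_g` as functions on the extended groups -/

theorem N_of_mem {w : D.Ext} (hw : w ∈ D.aff P) : D.N P K w = D.nW P K ⟨w, hw⟩ := dif_pos hw

theorem N_coe (w : D.aff P) : D.N P K (w : D.Ext) = D.nW P K w := N_of_mem w.2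

theorem NG_of_mem {g : Γ} (hg : g ∈ K) : D.NG P K g = D.nK P K ⟨g, hg⟩ := dif_pos hg

theorem NG_coe (g : K) : D.NG P K (g : Γ) = D.nK P K g := NG_of_mem g.2

theorem N_one : D.N P K 1 = 1 := by rw [N_of_mem (one_mem _)]; exact D.nW_one

theorem NG_one : D.NG P K 1 = 1 := by rw [NG_of_mem (one_mem _)]; exact D.nK_one

theorem N_mul {v w : D.Ext} (hv : v ∈ D.aff P) (hw : w ∈ D.aff P)
    (h : D.len P (v * w) = D.len P v + D.len P w) :
    D.N P K v * D.N P K w = D.N P K (v * w) := by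
  rw [N_of_mem hv, N_of_mem hw, N_of_mem (mul_mem hv hw)]
  exact D.nW_mul (v := ⟨v, hv⟩) (w := ⟨w, hw⟩) h

theorem NG_mul {g k : Γ} (hg : g ∈ K) (hk : k ∈ K) :
    D.NG P K g * D.NG P K k = (D.coc g k : ℂ) • D.NG P K (g * k) := by
  rw [NG_of_mem hg, NG_of_mem hk, NG_of_mem (mul_mem hg hk)]
  exact D.nK_mul ⟨g, hg⟩ ⟨k, hk⟩

theorem Admissible.NG_mul_N (h : D.Admissible P K) {g : Γ} (hg : g ∈ K) {w : D.Ext}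
    (hw : w ∈ D.aff P) :
    D.NG P K g * D.N P K w = (D.z g w.left : ℂ) •
      (D.N P K (D.lin (D.act g) * w * (D.lin (D.act g))⁻¹) * D.NG P K g) := by
  rw [NG_of_mem hg, N_of_mem hw, N_of_mem (aff_conj (h.smul_mem_iff hg) hw)]
  exact D.nK_mul_nW ⟨g, hg⟩ ⟨w, hw⟩ _ rfl

theorem star_N {w : D.Ext} (hw : w ∈ D.aff P) : star (D.N P K w) = D.N P K w⁻¹ := by
  rw [N_of_mem hw, N_of_mem (inv_mem hw)]
  exact D.star_nW ⟨w, hw⟩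

theorem star_NG {g : Γ} (hg : g ∈ K) : star (D.NG P K g) = D.starCoeff g • D.NG P K g⁻¹ := by
  rw [NG_of_mem hg, NG_of_mem (inv_mem hg)]
  exact D.star_nK ⟨g, hg⟩

theorem isUnit_N (hP : P ⊆ D.simple) {w : D.Ext} (hw : w ∈ D.aff P) : IsUnit (D.N P K w) := by
  rw [N_of_mem hw]; exact isUnit_nW hP _

open Classical in
theorem Admissible.tau_star_N (h : D.Admissible P K) {x y : D.Ext} (hx : x ∈ D.aff P)
    (hy : y ∈ D.aff P) {g k : Γ} (hg : g ∈ K) (hk : k ∈ K) :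
    h.tau (star (D.N P K x * D.NG P K g) * (D.N P K y * D.NG P K k)) =
      if x = y ∧ g = k then (D.absNorm g : ℂ) ^ 2 else 0 := by
  rw [N_of_mem hx, N_of_mem hy, NG_of_mem hg, NG_of_mem hk, h.tau_star_mul]
  simp only [Subtype.mk.injEq]

/-- Induction over linear combinations of the Iwahori--Matsumoto basis. -/
@[elab_as_elim]
theorem Admissible.basis_induction (h : D.Admissible P K) {p : D.Alg P K → Prop}
    (h1 : ∀ x ∈ D.aff P, ∀ g ∈ K, p (D.N P K x * D.NG P K g))
    (h0 : p 0) (hadd : ∀ a b, p a → p b → p (a + b)) (hsmul : ∀ (c : ℂ) a, p a → p (c • a))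
    (a : D.Alg P K) : p a := by
  have ha : a ∈ Submodule.span ℂ
      (Set.range fun p : D.aff P × K => D.nW P K p.1 * D.nK P K p.2) := by
    rw [h.span_eq_top]; trivial
  induction ha using Submodule.span_induction with
  | mem x hx =>
    obtain ⟨⟨w, g⟩, rfl⟩ := hx
    have := h1 w w.2 g g.2
    rwa [N_coe, NG_coe] at this
  | zero => exact h0
  | add x y _ _ hx hy => exact hadd x y hx hy
  | smul c x _ hx => exact hsmul c x hx

theorem Admissible.ext_of_tau (h : D.Admissible P K) {b c : D.Alg P K}
    (hbc : ∀ a, h.tau (star a * b) = h.tau (star a * c)) : b = c := by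
  rw [← sub_eq_zero]
  exact h.eq_zero_of_tau fun x g => by rw [mul_sub, map_sub, hbc, sub_self]

variable (D) in
theorem admissible_simple : D.Admissible D.simple ⊤ :=
  ⟨subset_rfl, fun g _ i hi => D.act_simple g i hi⟩

/-- If `r` is a reflection and `ℓ(r w) = ℓ(w) + 1`, then `N_{r w}` and `N_w` differ by a factor
that satisfies the quadratic relation for the parameter of `r`. This is clear if `r` is simple, and
conjugation by a simple affine reflection that shortens `w` reduces to shorter elements. -/
theorem exists_quadratic_factor (hP : P ⊆ D.simple) (n : ℕ) : ∀ {i : ι} (_ : i ∈ D.sub P) {k : ℤ}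
    {w : D.Ext} (_ : w ∈ D.aff P) (_ : D.len P w = n)
    (_ : D.len P (D.aref i k * w) = D.len P w + 1),
    ∃ a : D.Alg P K, D.N P K (D.aref i k * w) = a * D.N P K w ∧
      a * a = 1 + D.quad (D.par i k) • a := by
  induction n with
  | zero =>
    intro i hi k w hw hn h
    obtain ⟨j, l, hj, hd, hor⟩ := exists_simple_of_cover hP hi h
    rcases hor with hor | hor
    · let σ : D.SimpleAff P := ⟨(j, l), hj⟩
      refine ⟨D.nW P K σ.elt, ?_, ?_⟩
      · rw [hor, ← N_coe, N_mul σ.elt.2 hw]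
        · rfl
        · change D.len P (D.aref j l * w) = D.len P (D.aref j l) + _
          rw [hj.len hP, ← hor, h, add_comm]
      · rw [nW_elt_sq, SimpleAff.q, par_eq_of_aref_eq hor]
    · have := hj.len_mul_of_pos hP hor
      rw [hj.len hP] at this
      omega
  | succ n ih =>
    intro i hi k w hw hn h
    obtain ⟨j, l, hj, hd, hor⟩ := exists_simple_of_cover hP hi h
    let σ : D.SimpleAff P := ⟨(j, l), hj⟩
    rcases hor with hor | hor
    · refine ⟨D.nW P K σ.elt, ?_, ?_⟩
      · rw [hor, ← N_coe, N_mul σ.elt.2 hw]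
        · rfl
        · change D.len P (D.aref j l * w) = D.len P (D.aref j l) + _
          rw [hj.len hP, ← hor, h, add_comm]
      · rw [nW_elt_sq, SimpleAff.q, par_eq_of_aref_eq hor]
    -- `N_w = N_s N_{sw}` and `N_{rw} = N_s N_{srw}`, so the factor for `sw` is conjugated by `N_s`
    · have hσ : D.aref j l ∈ D.aff P := hj.mem_aff
      have e1 := hj.len_mul_of_pos hP hor
      have e2 := hj.len_mul_of_pos hP hd
      rw [hj.len hP] at e1 e2
      have hw' : D.aref j l * w ∈ D.aff P := mul_mem hσ hw
      have hr : D.aref i k * w ∈ D.aff P := mul_mem (aref_mem_aff hi k) hw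
      have hi' : (D.aref j l).right • i ∈ D.sub P := (D.smul_mem_sub_iff hσ).2 hi
      have e3 := simple_conj_aref i j k l w
      obtain ⟨a, ha, ha2⟩ := ih hi' hw' (by omega) (by rw [e3]; omega)
      rw [e3] at ha
      rw [par_conj (aff_mono hP hσ)] at ha2
      obtain ⟨s, hs⟩ := isUnit_N (K := K) hP hσ
      have f1 : (s : D.Alg P K) * D.N P K (D.aref j l * w) = D.N P K w := by
        rw [hs, N_mul hσ hw', aref_mul_aref_mul]
        rw [aref_mul_aref_mul, e1, hj.len hP]
      have f2 : (s : D.Alg P K) * D.N P K (D.aref j l * (D.aref i k * w)) =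
          D.N P K (D.aref i k * w) := by
        rw [hs, N_mul hσ (mul_mem hσ hr), aref_mul_aref_mul]
        rw [aref_mul_aref_mul, e2, hj.len hP]
      refine ⟨s * a * ↑s⁻¹, ?_, ?_⟩
      · rw [← f1, ← f2, ha]
        simp only [mul_assoc, Units.inv_mul_cancel_left]
      · have : (s * a * ↑s⁻¹ : D.Alg P K) * (s * a * ↑s⁻¹) = s * (a * a) * ↑s⁻¹ := by
          simp only [mul_assoc, Units.inv_mul_cancel_left]
        rw [this, ha2, mul_add, add_mul, mul_one, Units.mul_inv, mul_smul_comm, smul_mul_assoc]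

end TwistedDatum

namespace HeckeDatum

variable {ι X Y : Type*} [Fintype ι] [AddCommGroup X] [AddCommGroup Y] {D : HeckeDatum ι X Y}
  {P : Set ι}

/-! ### Minimal coset representatives -/

theorem one_mem_minReps (hP : P ⊆ D.simple) : (1 : D.R.Aut) ∈ D.minReps P :=
  ⟨one_mem _, fun i hi => by rw [one_smul]; exact isPos_simple (hP hi)⟩

theorem minReps_eq (hP : P ⊆ D.simple) {u v : D.R.Aut} (hu : u ∈ D.minReps P)
    (hv : v ∈ D.minReps P) (h : v⁻¹ * u ∈ D.weyl P) : u = v := by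
  have := eq_one_of_isPos hP h fun j hj => by
    have h1 : (v⁻¹ * u) • j ∈ D.sub P := D.smul_mem_sub h (D.mem_sub_of_mem hj)
    rw [← isPos_smul_of_minReps hP hv.2 h1, ← mul_smul, mul_inv_cancel_left]
    exact hu.2 j hj
  exact (inv_mul_eq_one.1 this).symm

theorem lin_mul_eq_lin_mul (hP : P ⊆ D.simple) {u v : D.R.Aut} (hu : u ∈ D.minReps P)
    (hv : v ∈ D.minReps P) {x y : D.Ext} (hx : x ∈ D.aff P) (hy : y ∈ D.aff P)
    (h : D.lin u * x = D.lin v * y) : u = v ∧ x = y := by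
  have h1 : u * x.right = v * y.right := congrArg (fun w : D.Ext => w.right) h
  have h2 : u = v := by
    refine minReps_eq hP hu hv ?_
    have : v⁻¹ * u = y.right * x.right⁻¹ := by
      rw [eq_mul_inv_iff_mul_eq, mul_assoc, h1, inv_mul_cancel_left]
    rw [this]
    exact mul_mem hy (inv_mem hx)
  subst h2
  exact ⟨rfl, mul_left_cancel h⟩

theorem exists_minReps (hP : P ⊆ D.simple) {v : D.R.Aut} (hv : v ∈ D.weyl D.simple) :
    ∃ u ∈ D.minReps P, u⁻¹ * v ∈ D.weyl P := by
  classical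
  have hex : ∃ n, ∃ u, u⁻¹ * v ∈ D.weyl P ∧ D.len D.simple (D.lin u⁻¹) = n :=
    ⟨_, v, by rw [inv_mul_cancel]; exact one_mem _, rfl⟩
  obtain ⟨u, hu, hn⟩ := Nat.find_spec hex
  refine ⟨u, ⟨?_, fun i hi => ?_⟩, hu⟩
  · have := mul_mem hv (inv_mem (D.weyl_mono hP hu))
    rwa [mul_inv_rev, inv_inv, mul_inv_cancel_left] at this
  · by_contra hneg
    have hi' : D.IsSimpleAff D.simple i 0 := .inl ⟨rfl, hP hi⟩
    have h1 : D.len D.simple (D.aref i 0 * D.lin u⁻¹) < D.len D.simple (D.lin u⁻¹) := by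
      rw [hi'.len_lt_iff subset_rfl, cr_lin, inv_inv, eps_neg hneg, eps_pos (isPos_simple (hP hi))]
      decide
    rw [hn] at h1
    refine Nat.find_min hex h1 ⟨u * D.refl i, ?_, ?_⟩
    · rw [mul_inv_rev, mul_assoc]
      exact mul_mem (inv_mem (D.refl_mem_weyl (D.mem_sub_of_mem hi))) hu
    · rw [aref_zero, ← lin_mul, mul_inv_rev, refl_inv]

theorem exists_minReps_mul (hP : P ⊆ D.simple) {y : D.Ext} (hy : y ∈ D.aff D.simple) :
    ∃ u ∈ D.minReps P, ∃ x ∈ D.aff P, y = D.lin u * x := by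
  obtain ⟨u, hu, h⟩ := exists_minReps hP (v := y.right) hy
  refine ⟨u, hu, (D.lin u)⁻¹ * y, ?_, (mul_inv_cancel_left _ _).symm⟩
  rw [lin_inv]
  exact h

end HeckeDatum

namespace TwistedDatum

open HeckeDatum Filter

variable {ι X Y Γ : Type*} [Fintype ι] [AddCommGroup X] [AddCommGroup Y] [Group Γ] [Fintype Γ]
  {D : TwistedDatum ι X Y Γ} {P : Set ι} {K : Subgroup Γ}

/-! ### The embedding of a parabolic subalgebra -/

theorem isUnit_tr (n : ℕ) : IsUnit (D.NFull (D.tr P n)) := isUnit_N subset_rfl (tr_mem_aff _ n)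

theorem N_mul_tr_mul_tr (hP : P ⊆ D.simple) {w : D.Ext} (hw : w ∈ D.aff D.simple) {n : ℕ}
    (hn : 2 * D.len D.simple w ≤ n) (m : ℕ) :
    D.NFull (w * D.tr P n) * D.NFull (D.tr P m) = D.NFull (w * D.tr P (n + m)) := by
  rw [NFull, NFull, N_mul (mul_mem hw (tr_mem_aff _ n)) (tr_mem_aff _ m)
    (len_mul_tr_tr hP hw hn m), mul_assoc, tr_mul_tr]

theorem N_tr_mul_tr (hP : P ⊆ D.simple) (m n : ℕ) :
    D.NFull (D.tr P m) * D.NFull (D.tr P n) = D.NFull (D.tr P (m + n)) := by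
  have := N_mul_tr_mul_tr (D := D) hP (one_mem _) (n := m) (by rw [len_one]; omega) n
  rwa [one_mul, one_mul] at this

variable (D) in
/-- The element `N_{y t} N_t⁻¹` of `H`, where `t` is the translation by a large multiple of the
sum of the positive roots outside `R_P`. It does not depend on the choice of that multiple, and for
`y ∈ W_P ⋉ X` it is the image of the element `N_y` of `H^P`. -/
def stab (P : Set ι) (y : D.Ext) : D.Full :=
  D.NFull (y * D.tr P (2 * D.len D.simple y)) *
    Ring.inverse (D.NFull (D.tr P (2 * D.len D.simple y)))

theorem stab_mul_tr (hP : P ⊆ D.simple) {y : D.Ext} (hy : y ∈ D.aff D.simple) {n : ℕ}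
    (hn : 2 * D.len D.simple y ≤ n) :
    D.stab P y * D.NFull (D.tr P n) = D.NFull (y * D.tr P n) := by
  obtain ⟨m, rfl⟩ := Nat.exists_eq_add_of_le hn
  rw [← N_tr_mul_tr hP, ← mul_assoc, stab, Ring.inverse_mul_cancel_right _ _ (isUnit_tr _),
    N_mul_tr_mul_tr hP hy le_rfl]

theorem stab_eq (hP : P ⊆ D.simple) {y : D.Ext} (hy : y ∈ D.aff D.simple) {n : ℕ}
    (hn : 2 * D.len D.simple y ≤ n) {a : D.Full}
    (ha : a * D.NFull (D.tr P n) = D.NFull (y * D.tr P n)) : D.stab P y = a :=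
  (isUnit_tr n).mul_right_cancel ((stab_mul_tr hP hy hn).trans ha.symm)

theorem stab_one (hP : P ⊆ D.simple) : D.stab P 1 = 1 :=
  stab_eq hP (one_mem _) le_rfl (by rw [one_mul, one_mul])

/-- Lengths that add in `W_P ⋉ X` also add in `W ⋉ X` after both factors are translated far away,
and the translations commute with `W_P ⋉ X`. -/
theorem stab_mul (hP : P ⊆ D.simple) {v w : D.Ext} (hv : v ∈ D.aff P) (hw : w ∈ D.aff P)
    (h : D.len P (v * w) = D.len P v + D.len P w) :
    D.stab P v * D.stab P w = D.stab P (v * w) := by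
  have hv' := aff_mono hP hv
  have hw' := aff_mono hP hw
  set m := 2 * D.len D.simple v with hm
  set n := 2 * D.len D.simple w + 2 * D.len D.simple (v * w) with hn
  -- the elements `N_{w t}` commute with `N_t`
  have h1 : D.NFull (D.tr P m) * D.NFull (w * D.tr P n) =
      D.NFull (w * D.tr P n) * D.NFull (D.tr P m) := by
    have := len_mul_tr_mul_tr hP (one_mem (D.aff P)) hw (by rw [one_mul, len_one, zero_add])
      (m := m) (n := n) (by rw [len_one]; omega) (by omega)
    rw [one_mul] at this
    rw [NFull, NFull, N_mul (tr_mem_aff _ m) (mul_mem hw' (tr_mem_aff _ n)) this,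
      N_mul_tr_mul_tr hP hw' (by omega), ← mul_assoc, ← mul_tr_comm hP hw, mul_assoc, tr_mul_tr,
      add_comm m]
  symm
  refine stab_eq hP (mul_mem hv' hw') (n := n + m) (by omega) ?_
  rw [← N_tr_mul_tr hP, mul_assoc, ← mul_assoc (D.stab P w), stab_mul_tr hP hw' (by omega), ← h1,
    ← mul_assoc, stab_mul_tr hP hv' le_rfl, NFull, NFull, N_mul (mul_mem hv' (tr_mem_aff _ m))
    (mul_mem hw' (tr_mem_aff _ n)) (len_mul_tr_mul_tr hP hv hw h le_rfl (by omega))]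
  congr 1
  rw [mul_assoc v, ← mul_assoc _ w, ← mul_tr_comm hP hw, mul_assoc w, tr_mul_tr, mul_assoc v,
    add_comm m]

/-- The quadratic relation, also for the affine reflections of `W_P ⋉ X` that are not simple in
`W ⋉ X`. -/
theorem stab_aref_sq (hP : P ⊆ D.simple) {i : ι} {k : ℤ} (hi : D.IsSimpleAff P i k) :
    D.stab P (D.aref i k) * D.stab P (D.aref i k) =
      1 + D.quad (D.par i k) • D.stab P (D.aref i k) := by
  obtain ⟨a, ha, ha2⟩ := exists_quadratic_factor (K := ⊤) subset_rfl _
    (D.sub_mono hP hi.mem_sub) (tr_mem_aff D.simple _) rfl (len_aref_mul_tr hP hi le_rfl)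
  rw [stab_eq hP (aff_mono hP hi.mem_aff) le_rfl ha.symm, ha2]

theorem stab_lin (hP : P ⊆ D.simple) {u : D.R.Aut} (hu : u ∈ D.weyl P) :
    D.stab P (D.lin u) = D.NFull (D.lin u) := by
  have hu' : D.lin u ∈ D.aff D.simple := lin_mem_aff (D.weyl_mono hP hu)
  exact stab_eq hP hu' le_rfl (N_mul hu' (tr_mem_aff _ _) (len_lin_mul_tr hP hu _))

theorem stab_trans (hP : P ⊆ D.simple) {x : X} (hx : D.Dominant x) :
    D.stab P (D.trans x) = D.NFull (D.trans x) :=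
  stab_eq hP (trans_mem_aff x) le_rfl
    (N_mul (trans_mem_aff x) (tr_mem_aff _ _) (len_trans_mul_tr hP hx _))

theorem Admissible.smul_mu (h : D.Admissible P K) {g : Γ} (hg : g ∈ K) :
    D.act g • D.mu P = D.mu P :=
  HeckeDatum.smul_mu fun i => by
    rw [isPos_act, smul_mem_sub_iff_of (h.smul_mem_iff hg)]

theorem Admissible.conj_tr (h : D.Admissible P K) {g : Γ} (hg : g ∈ K) (n : ℕ) :
    D.lin (D.act g) * D.tr P n * (D.lin (D.act g))⁻¹ = D.tr P n := by
  rw [tr, mul_trans, mul_inv_cancel_right, smul_nsmul_aut, lin_right, h.smul_mu hg]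

theorem z_left_mul (g : Γ) {v : D.Ext} (hv : v ∈ D.aff D.simple) (w : D.Ext) :
    (D.z g (v * w).left : ℂ) = D.z g v.left * D.z g w.left := z_mul_left g ⟨v, hv⟩ w

theorem norm_z (g : Γ) (w : D.Ext) : ‖(D.z g w.left : ℂ)‖ = 1 := D.z_norm g w.left.toAdd

theorem NG_mul_NFull (g : Γ) {w : D.Ext} (hw : w ∈ D.aff D.simple) :
    D.NGFull g * D.NFull w = (D.z g w.left : ℂ) •
      (D.NFull (D.lin (D.act g) * w * (D.lin (D.act g))⁻¹) * D.NGFull g) :=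
  D.admissible_simple.NG_mul_N (Subgroup.mem_top g) hw

theorem Admissible.NG_mul_tr (h : D.Admissible P K) {g : Γ} (hg : g ∈ K) (n : ℕ) :
    D.NGFull g * D.NFull (D.tr P n) =
      (D.z g (D.tr P n).left : ℂ) • (D.NFull (D.tr P n) * D.NGFull g) := by
  rw [NG_mul_NFull g (tr_mem_aff _ n), h.conj_tr hg]

theorem Admissible.NG_mul_stab (h : D.Admissible P K) {g : Γ} (hg : g ∈ K) {w w' : D.Ext}
    (hw : w ∈ D.aff P) (hw' : w' ∈ D.aff P)
    (e : w' = D.lin (D.act g) * w * (D.lin (D.act g))⁻¹) :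
    D.NGFull g * D.stab P w = (D.z g w.left : ℂ) • (D.stab P w' * D.NGFull g) := by
  have hΔ := aff_mono h.subset hw
  have hΔ' := aff_mono h.subset hw'
  set n := 2 * D.len D.simple w + 2 * D.len D.simple w' with hn
  refine (isUnit_tr (P := P) n).mul_right_cancel ?_
  rw [mul_assoc, stab_mul_tr h.subset hΔ (by omega), NG_mul_NFull g (mul_mem hΔ (tr_mem_aff _ _)),
    smul_mul_assoc, mul_assoc (D.stab P w'), h.NG_mul_tr hg, mul_smul_comm,
    ← mul_assoc (D.stab P w'), stab_mul_tr h.subset hΔ' (by omega), smul_smul, z_left_mul g hΔ]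
  congr 3
  conv_rhs => rw [e, ← h.conj_tr hg n]
  group

/-- The images of the generators under the embedding of `H^P ⋊ ℂ[K, ♮]` in `H ⋊ ℂ[Γ, ♮]`. -/
def embedGen (D : TwistedDatum ι X Y Γ) (P : Set ι) (K : Subgroup Γ) : D.Gen P K → D.Full
  | .inl w => D.stab P w
  | .inr g => D.NGFull g

theorem Admissible.embedGen_rel (h : D.Admissible P K) {a b : FreeAlgebra ℂ (D.Gen P K)}
    (hab : D.Rel P K a b) :
    FreeAlgebra.lift ℂ (D.embedGen P K) a = FreeAlgebra.lift ℂ (D.embedGen P K) b := by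
  induction hab with
  | one =>
    simp only [genW, FreeAlgebra.lift_ι_apply, map_one, embedGen, Subgroup.coe_one]
    exact stab_one h.subset
  | mul v w hvw =>
    simp only [genW, FreeAlgebra.lift_ι_apply, map_mul, embedGen]
    exact stab_mul h.subset v.2 w.2 hvw
  | simple i hi s hs =>
    simp only [genW, FreeAlgebra.lift_ι_apply, map_mul, map_add, map_one, map_smul, embedGen]
    have := stab_aref_sq (D := D) h.subset (i := i) (k := 0) (.inl ⟨rfl, hi⟩)
    rw [par, if_pos (by decide), aref_zero] at this
    rw [hs]
    exact this
  | affine i hi s hs =>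
    simp only [genW, FreeAlgebra.lift_ι_apply, map_mul, map_add, map_one, map_smul, embedGen]
    have := stab_aref_sq (D := D) h.subset (i := i) (k := 1) (.inr ⟨rfl, hi⟩)
    rw [par, if_neg (by decide), aref_one] at this
    rw [hs]
    exact this
  | group_one =>
    simp only [genK, FreeAlgebra.lift_ι_apply, map_one, embedGen, Subgroup.coe_one]
    exact NG_one
  | group_mul g g' =>
    simp only [genK, FreeAlgebra.lift_ι_apply, map_mul, map_smul, embedGen]
    exact NG_mul (Subgroup.mem_top _) (Subgroup.mem_top _)
  | cross g w w' hw =>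
    simp only [genK, genW, FreeAlgebra.lift_ι_apply, map_mul, map_smul, embedGen]
    exact h.NG_mul_stab g.2 w.2 w'.2 hw

/-- The embedding of `H^P ⋊ ℂ[K, ♮]` in `H ⋊ ℂ[Γ, ♮]`. It sends `N_w` to `N_w` if `w` lies in
`W_P` or is a dominant translation, but not in general, and in general it does not preserve the
involutions. -/
def Admissible.embed (h : D.Admissible P K) : D.Alg P K →ₐ[ℂ] D.Full :=
  RingQuot.liftAlgHom ℂ ⟨FreeAlgebra.lift ℂ (D.embedGen P K), fun _ _ hab => h.embedGen_rel hab⟩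

theorem Admissible.embed_toAlg (h : D.Admissible P K) (a : FreeAlgebra ℂ (D.Gen P K)) :
    h.embed (D.toAlg P K a) = FreeAlgebra.lift ℂ (D.embedGen P K) a :=
  RingQuot.liftAlgHom_mkAlgHom_apply ..

theorem Admissible.embed_N (h : D.Admissible P K) {w : D.Ext} (hw : w ∈ D.aff P) :
    h.embed (D.N P K w) = D.stab P w := by
  rw [N_of_mem hw, nW, embed_toAlg, genW, FreeAlgebra.lift_ι_apply]; rfl

theorem Admissible.embed_NG (h : D.Admissible P K) {g : Γ} (hg : g ∈ K) :
    h.embed (D.NG P K g) = D.NGFull g := by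
  rw [NG_of_mem hg, nK, embed_toAlg, genK, FreeAlgebra.lift_ι_apply]; rfl

/-! ### The cosets of a parabolic subalgebra -/

theorem stab_minReps_mul (hP : P ⊆ D.simple) {u : D.R.Aut} (hu : u ∈ D.minReps P) {x : D.Ext}
    (hx : x ∈ D.aff P) :
    D.stab P (D.lin u * x) = D.NFull (D.lin u) * D.stab P x := by
  have hu' : D.lin u ∈ D.aff D.simple := lin_mem_aff hu.1
  have hx' := aff_mono hP hx
  set n := 2 * D.len D.simple x + 2 * D.len D.simple (D.lin u * x) with hn
  refine stab_eq hP (mul_mem hu' hx') (n := n) (by omega) ?_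
  rw [mul_assoc, stab_mul_tr hP hx' (by omega), NFull, NFull,
    N_mul hu' (mul_mem hx' (tr_mem_aff _ _)) (len_minReps_mul hP hu hx (by omega)), mul_assoc]

/-- The elements `stab P y` span the affine Hecke algebra, because their span is a left ideal. -/
theorem N_mem_span_stab (hP : P ⊆ D.simple) {v : D.Ext} (hv : v ∈ D.aff D.simple) :
    D.NFull v ∈ Submodule.span ℂ (D.stab P '' (D.aff D.simple : Set D.Ext)) := by
  set S := Submodule.span ℂ (D.stab P '' (D.aff D.simple : Set D.Ext)) with hS
  have hmem : ∀ y ∈ D.aff D.simple, D.stab P y ∈ S := fun y hy =>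
    Submodule.subset_span ⟨y, hy, rfl⟩
  have left : ∀ a : D.Full, (∀ y ∈ D.aff D.simple, a * D.stab P y ∈ S) → ∀ s ∈ S, a * s ∈ S := by
    intro a ha s hs
    induction hs using Submodule.span_induction with
    | mem x hx => obtain ⟨y, hy, rfl⟩ := hx; exact ha y hy
    | zero => rw [mul_zero]; exact zero_mem _
    | add x y _ _ hx hy => rw [mul_add]; exact add_mem hx hy
    | smul c x _ hx => rw [mul_smul_comm]; exact Submodule.smul_mem _ _ hx
  have hN : ∀ y : D.aff D.simple, D.NFull y = D.nW D.simple ⊤ y := fun y => N_coe y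
  have key : ∀ v : D.aff D.simple, ∀ s ∈ S, D.nW D.simple ⊤ v * s ∈ S := by
    intro v
    refine aff_induction subset_rfl (p := fun v => ∀ s ∈ S, D.nW D.simple ⊤ v * s ∈ S)
      (fun ω hω => ?_) (fun σ w hd ih s hs => ?_) v
    · refine left _ fun y hy => ?_
      set n := 2 * D.len D.simple y + 2 * D.len D.simple ((ω : D.Ext) * y) with hn
      have hyn := mul_mem hy (tr_mem_aff (P := P) D.simple n)
      have : D.nW D.simple ⊤ ω * D.stab P y = D.stab P (ω * y) := by
        symm
        refine stab_eq hP (mul_mem ω.2 hy) (n := n) (by omega) ?_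
        rw [mul_assoc, stab_mul_tr hP hy (by omega), mul_assoc]
        have h1 := nW_len_zero_mul (K := ⊤) hω ⟨_, hyn⟩
        rw [← N_of_mem hyn, ← N_coe (ω * _)] at h1
        exact h1
      rw [this]
      exact hmem _ (mul_mem ω.2 hy)
    · have h1 : ∀ s ∈ S, D.nW D.simple ⊤ σ.elt * s ∈ S := by
        refine left _ fun y hy => ?_
        set n := 2 * D.len D.simple y + 2 * D.len D.simple ((σ.elt : D.Ext) * y) with hn
        have hyn := mul_mem hy (tr_mem_aff (P := P) D.simple n)
        have hy' : (σ.elt : D.Ext) * y ∈ D.aff D.simple := mul_mem σ.elt.2 hy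
        have : ∃ c : ℂ, D.nW D.simple ⊤ σ.elt * D.stab P y =
            D.stab P (σ.elt * y) + c • D.stab P y := by
          by_cases hd : σ.Desc (y * D.tr P n)
          · refine ⟨σ.q, (isUnit_tr (P := P) n).mul_right_cancel ?_⟩
            rw [add_mul, smul_mul_assoc, mul_assoc, stab_mul_tr hP hy (by omega),
              stab_mul_tr hP hy' (by omega), mul_assoc]
            have h1 := nW_elt_mul_of_desc (K := ⊤) subset_rfl σ (w := ⟨_, hyn⟩) hd
            rw [← N_of_mem hyn, ← N_coe (σ.elt * _)] at h1
            exact h1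
          · refine ⟨0, (isUnit_tr (P := P) n).mul_right_cancel ?_⟩
            rw [add_mul, smul_mul_assoc, mul_assoc, stab_mul_tr hP hy (by omega),
              stab_mul_tr hP hy' (by omega), mul_assoc, zero_smul, add_zero]
            have h1 := nW_elt_mul (K := ⊤) subset_rfl σ (w := ⟨_, hyn⟩) hd
            rw [← N_of_mem hyn, ← N_coe (σ.elt * _)] at h1
            exact h1
        obtain ⟨c, hc⟩ := this
        rw [hc]
        exact add_mem (hmem _ hy') (Submodule.smul_mem _ _ (hmem _ hy))
      rw [← nW_elt_mul subset_rfl σ hd, mul_assoc]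
      exact h1 _ (ih s hs)
  have := key ⟨v, hv⟩ 1 (by have := hmem 1 (one_mem _); rwa [stab_one hP] at this)
  rw [mul_one] at this
  rwa [NFull, N_of_mem hv]

/-- The algebra `H ⋊ ℂ[Γ, ♮]` is spanned by the cosets `N_g N_u B` of the parabolic subalgebra `B`,
where `g` runs through representatives of `Γ / K` and `u` through `W^P`. -/
theorem Admissible.coset_induction (h : D.Admissible P K) {GP : Set Γ}
    (hGP : Subgroup.IsComplement GP (K : Set Γ)) {p : D.Full → Prop}
    (h1 : ∀ g ∈ GP, ∀ u ∈ D.minReps P, ∀ a, p (D.NGFull g * D.NFull (D.lin u) * h.embed a))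
    (h0 : p 0) (hadd : ∀ a b, p a → p b → p (a + b)) (b : D.Full) : p b := by
  set T : Submodule ℂ D.Full := Submodule.span ℂ
    {x | ∃ g ∈ GP, ∃ u ∈ D.minReps P, ∃ a, x = D.NGFull g * D.NFull (D.lin u) * h.embed a} with hT
  have hTp : ∀ x ∈ T, p x := by
    intro x hx
    induction hx using Submodule.closure_induction with
    | zero => exact h0
    | add x y _ _ hx hy => exact hadd x y hx hy
    | smul_mem c x hx =>
      obtain ⟨g, hg, u, hu, a, rfl⟩ := hx
      rw [← mul_smul_comm, ← map_smul]
      exact h1 g hg u hu _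
  refine hTp b ?_
  have key : ∀ g ∈ GP, ∀ k ∈ K, ∀ v ∈ D.aff D.simple,
      D.NGFull g * (D.NFull v * D.NGFull k) ∈ T := by
    intro g hg k hk v hv
    have hv' := N_mem_span_stab (D := D) h.subset hv
    generalize D.NFull v = s at hv'
    induction hv' using Submodule.span_induction with
    | mem x hx =>
      obtain ⟨y, hy, rfl⟩ := hx
      obtain ⟨u, hu, x, hx, rfl⟩ := exists_minReps_mul h.subset hy
      refine Submodule.subset_span ⟨g, hg, u, hu, D.N P K x * D.NG P K k, ?_⟩
      rw [stab_minReps_mul h.subset hu hx, map_mul, h.embed_N hx, h.embed_NG hk]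
      simp only [mul_assoc]
    | zero => rw [zero_mul, mul_zero]; exact zero_mem _
    | add x y _ _ hx hy => rw [add_mul, mul_add]; exact add_mem hx hy
    | smul c x _ hx => rw [smul_mul_assoc, mul_smul_comm]; exact Submodule.smul_mem _ _ hx
  induction b using D.admissible_simple.basis_induction with
  | h1 x hx g _ =>
    obtain ⟨⟨⟨g', hg'⟩, ⟨k, hk⟩⟩, hgk, -⟩ := hGP.existsUnique g
    have hgk : g' * k = g := hgk
    have e1 := NG_mul (P := D.simple) (D := D) (Subgroup.mem_top g') (Subgroup.mem_top k)
    rw [hgk] at e1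
    have hx' : D.lin (D.act g)⁻¹ * x * (D.lin (D.act g)⁻¹)⁻¹ ∈ D.aff D.simple := by
      rw [← map_inv]
      exact aff_conj (D.admissible_simple.smul_mem_iff (Subgroup.mem_top g⁻¹)) hx
    set x' := D.lin (D.act g)⁻¹ * x * (D.lin (D.act g)⁻¹)⁻¹ with hx'def
    have e2 := NG_mul_NFull g hx'
    have e3 : D.lin (D.act g) * x' * (D.lin (D.act g))⁻¹ = x := by
      rw [hx'def, ← lin_inv]; group
    rw [e3] at e2
    have e4 := NG_mul_NFull k hx'
    have hx'' : D.lin (D.act k) * x' * (D.lin (D.act k))⁻¹ ∈ D.aff D.simple :=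
      aff_conj (D.admissible_simple.smul_mem_iff (Subgroup.mem_top k)) hx'
    have e5 : D.NFull x * D.NGFull g = ((D.z g x'.left : ℂ)⁻¹ * (D.coc g' k : ℂ)⁻¹ *
        D.z k x'.left) • (D.NGFull g' * (D.NFull (D.lin (D.act k) * x' * (D.lin (D.act k))⁻¹) *
          D.NGFull k)) := by
      rw [mul_smul, ← mul_smul_comm, ← e4, ← mul_assoc, e1, smul_mul_assoc, smul_smul, e2,
        smul_smul]
      have n1 := (D.z g x'.left).ne_zero
      have n2 := (D.coc g' k).ne_zero
      rw [show (D.z g x'.left : ℂ)⁻¹ * (D.coc g' k : ℂ)⁻¹ * (D.coc g' k : ℂ) * D.z g x'.left = 1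
        by field_simp, one_smul]
    rw [show D.N D.simple ⊤ x * D.NG D.simple ⊤ g = D.NFull x * D.NGFull g from rfl, e5]
    exact T.smul_mem _ (key g' hg' k hk _ hx'')
  | h0 => exact zero_mem _
  | hadd a b ha hb => exact add_mem ha hb
  | hsmul c a ha => exact Submodule.smul_mem _ _ ha

/-- Up to a scalar, `N_g N_u j(N_x N_k) N_t` is one basis element for a far away translation `t`. -/
theorem Admissible.coset_mul_tr (h : D.Admissible P K) (g : Γ) {u : D.R.Aut}
    (hu : u ∈ D.minReps P) {x : D.Ext} (hx : x ∈ D.aff P) {k : Γ} (hk : k ∈ K) {n : ℕ}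
    (hn : 2 * D.len D.simple x ≤ n) :
    ∃ ζ : ℂ, ‖ζ‖ * D.absNorm (g * k) = D.absNorm g * D.absNorm k ∧
      D.NGFull g * D.NFull (D.lin u) * h.embed (D.N P K x * D.NG P K k) * D.NFull (D.tr P n) =
        ζ • (D.NFull (D.lin (D.act g) * (D.lin u * (x * D.tr P n)) * (D.lin (D.act g))⁻¹) *
          D.NGFull (g * k)) := by
  have hu' : D.lin u ∈ D.aff D.simple := lin_mem_aff hu.1
  have hx' := aff_mono h.subset hx
  have hxn := mul_mem hx' (tr_mem_aff (P := P) D.simple n)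
  refine ⟨D.z k (D.tr P n).left * D.z g (D.lin u * (x * D.tr P n)).left * D.coc g k, ?_, ?_⟩
  · rw [norm_mul, norm_mul, norm_z, norm_z, one_mul, one_mul, D.absNorm_mul]
  · have e1 : D.stab P x * D.NGFull k * D.NFull (D.tr P n) =
        (D.z k (D.tr P n).left : ℂ) • (D.NFull (x * D.tr P n) * D.NGFull k) := by
      rw [mul_assoc, h.NG_mul_tr hk, mul_smul_comm, ← mul_assoc, stab_mul_tr h.subset hx' hn]
    have e2 : D.NFull (D.lin u) * D.NFull (x * D.tr P n) = D.NFull (D.lin u * (x * D.tr P n)) :=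
      N_mul hu' hxn (len_minReps_mul h.subset hu hx hn)
    have e3 := NG_mul (P := D.simple) (D := D) (Subgroup.mem_top g) (Subgroup.mem_top k)
    rw [map_mul, h.embed_N hx, h.embed_NG hk, mul_assoc, e1, mul_smul_comm, ← mul_assoc,
      mul_assoc (D.NGFull g), e2, NG_mul_NFull g (mul_mem hu' hxn), smul_mul_assoc, mul_assoc, e3,
      mul_smul_comm, smul_smul, smul_smul]

/-- Far away the pairing `τ(a^* b)` makes the cosets of the parabolic subalgebra orthogonal, and
it restricts to the pairing of the parabolic subalgebra on each of them. -/
theorem Admissible.tau_coset (h : D.Admissible P K) {g g' : Γ} (hg : g⁻¹ * g' ∈ K → g = g')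
    {u u' : D.R.Aut} (hu : u ∈ D.minReps P) (hu' : u' ∈ D.minReps P) (a a' : D.Alg P K) :
    ∀ᶠ n in atTop, D.admissible_simple.tau
      (star (D.NGFull g * D.NFull (D.lin u) * h.embed a * D.NFull (D.tr P n)) *
        (D.NGFull g' * D.NFull (D.lin u') * h.embed a' * D.NFull (D.tr P n))) =
      open Classical in
      (if g = g' ∧ u = u' then (D.absNorm g : ℂ) ^ 2 else 0) * h.tau (star a * a') := by
  classical
  induction a using h.basis_induction with
  | h0 => exact Eventually.of_forall fun n => by simp
  | hadd a b ha hb =>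
    filter_upwards [ha, hb] with n h1 h2
    rw [map_add, mul_add, add_mul, star_add, add_mul, map_add, h1, h2, star_add, add_mul, map_add]
    ring
  | hsmul c a ha =>
    filter_upwards [ha] with n h1
    rw [map_smul, mul_smul_comm, smul_mul_assoc, star_smul, smul_mul_assoc, map_smul, h1,
      star_smul, smul_mul_assoc, map_smul, smul_eq_mul, smul_eq_mul]
    ring
  | h1 x hx k hk =>
    induction a' using h.basis_induction with
    | h0 => exact Eventually.of_forall fun n => by simp
    | hadd a b ha hb =>
      filter_upwards [ha, hb] with n h1 h2
      rw [map_add, mul_add, add_mul, mul_add, map_add, h1, h2, mul_add, map_add]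
      ring
    | hsmul c a ha =>
      filter_upwards [ha] with n h1
      rw [map_smul, mul_smul_comm, smul_mul_assoc, mul_smul_comm, map_smul, h1,
        mul_smul_comm, map_smul, smul_eq_mul, smul_eq_mul]
      ring
    | h1 x' hx' k' hk' =>
      filter_upwards [eventually_ge_atTop (2 * D.len D.simple x),
        eventually_ge_atTop (2 * D.len D.simple x')] with n hn hn'
      have hmem : ∀ (g : Γ) {u : D.R.Aut} (_ : u ∈ D.minReps P) {x : D.Ext} (_ : x ∈ D.aff P),
          D.lin (D.act g) * (D.lin u * (x * D.tr P n)) * (D.lin (D.act g))⁻¹ ∈ D.aff D.simple :=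
        fun g u hu x hx => aff_conj (D.admissible_simple.smul_mem_iff (Subgroup.mem_top g))
          (mul_mem (lin_mem_aff hu.1) (mul_mem (aff_mono h.subset hx) (tr_mem_aff _ _)))
      obtain ⟨ζ, hζ, e⟩ := h.coset_mul_tr g hu hx hk hn
      by_cases heq : (g = g' ∧ u = u') ∧ x = x' ∧ k = k'
      · obtain ⟨⟨rfl, rfl⟩, rfl, rfl⟩ := heq
        rw [e, star_smul, smul_mul_assoc, mul_smul_comm, map_smul, map_smul,
          D.admissible_simple.tau_star_N (hmem g hu hx) (hmem g hu hx) (Subgroup.mem_top _)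
          (Subgroup.mem_top _), h.tau_star_N hx hx hk hk]
        simp only [and_self, if_true, smul_eq_mul]
        rw [← mul_assoc, mul_comm (star ζ)]
        change ζ * conj ζ * _ = _
        rw [Complex.mul_conj, Complex.normSq_eq_norm_sq]
        norm_cast
        rw [← mul_pow, hζ, mul_pow]
      · obtain ⟨ζ', hζ', e'⟩ := h.coset_mul_tr g' hu' hx' hk' hn'
        rw [e, e', star_smul, smul_mul_assoc, mul_smul_comm, map_smul, map_smul,
          D.admissible_simple.tau_star_N (hmem g hu hx) (hmem g' hu' hx') (Subgroup.mem_top _)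
          (Subgroup.mem_top _), h.tau_star_N hx hx' hk hk', if_neg, smul_zero, smul_zero]
        · by_cases h1 : g = g' ∧ u = u'
          · rw [if_neg (fun h2 => heq ⟨h1, h2⟩), mul_zero]
          · rw [if_neg h1, zero_mul]
        · rintro ⟨h1, h2⟩
          obtain rfl : g = g' := hg (by
            have : g⁻¹ * g' = k * k'⁻¹ := by
              rw [eq_mul_inv_iff_mul_eq, mul_assoc, ← h2, inv_mul_cancel_left]
            rw [this]; exact mul_mem hk (inv_mem hk'))
          have h3 := mul_left_cancel (mul_right_cancel h1)
          rw [← mul_assoc, ← mul_assoc] at h3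
          obtain ⟨h4, h5⟩ := lin_mul_eq_lin_mul h.subset hu hu' hx hx' (mul_right_cancel h3)
          exact heq ⟨⟨rfl, h4⟩, h5, mul_left_cancel h2⟩

theorem absNorm_one : D.absNorm 1 = 1 := by
  have h1 := D.absNorm_mul 1 1
  rw [D.coc_one, mul_one, Units.val_one, norm_one, one_mul] at h1
  exact (mul_eq_left₀ (D.absNorm_pos 1).ne').1 h1.symm

theorem Admissible.tau_embed (h : D.Admissible P K) (a a' : D.Alg P K) :
    ∀ᶠ n in atTop, D.admissible_simple.tau
      (star (h.embed a * D.NFull (D.tr P n)) * (h.embed a' * D.NFull (D.tr P n))) =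
      h.tau (star a * a') := by
  have h1 := one_mem_minReps h.subset
  filter_upwards [h.tau_coset (g := 1) (g' := 1) (fun _ => rfl) h1 h1 a a'] with n hn
  rw [if_pos ⟨rfl, rfl⟩, absNorm_one, NGFull, NG_one, lin_one, NFull, N_one] at hn
  simpa using hn

/-- The pairing of `H^P ⋊ ℂ[K, ♮]` is nondegenerate, and by `tau_embed` it can be read off from the
image. -/
theorem Admissible.embed_injective (h : D.Admissible P K) : Function.Injective h.embed := by
  refine (injective_iff_map_eq_zero _).2 fun a ha => h.ext_of_tau fun b => ?_
  obtain ⟨n, hn⟩ := (h.tau_embed b a).exists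
  rw [← hn, ha, zero_mul, mul_zero, mul_zero, map_zero, map_zero]

end TwistedDatum

namespace HeckeDatum

variable {ι X Y : Type*} [Fintype ι] [AddCommGroup X] [AddCommGroup Y] {D : HeckeDatum ι X Y}
  {P Q : Set ι}

/-! ### Longest elements and opposite sets of simple roots -/

theorem isPos_smul_of_neg (hP : P ⊆ D.simple) {u : D.R.Aut} (hu : ∀ i ∈ P, ¬ D.base.IsPos (u • i))
    {i : ι} (hi : i ∈ D.sub P) : D.base.IsPos (u • i) ↔ ¬ D.base.IsPos i := by
  have key : ∀ i ∈ D.sub P, D.base.IsPos i → ¬ D.base.IsPos (u • i) := by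
    intro i hi hpos
    have h1 : ∀ y ∈ AddSubmonoid.closure (D.R.coroot '' P),
        D.R.toLinearMap (u⁻¹ • D.mu ∅) y ≤ 0 := by
      intro y hy
      induction hy using AddSubmonoid.closure_induction with
      | mem y hy =>
        obtain ⟨j, hj, rfl⟩ := hy
        change D.pr (u⁻¹ • D.mu ∅) j ≤ 0
        rw [pr_smul_left, inv_inv]
        exact not_lt.1 fun h => hu j hj ((isPos_iff_pr _).2 h)
      | zero => rw [map_zero]
      | add x y _ _ hx hy => rw [map_add]; exact add_nonpos hx hy
    have h2 : D.pr (D.mu ∅) (u • i) ≤ 0 := by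
      have := h1 _ (coroot_mem_cone hP hi hpos)
      change D.pr (u⁻¹ • D.mu ∅) i ≤ 0 at this
      rwa [pr_smul_left, inv_inv] at this
    rw [isPos_iff_pr]
    omega
  refine ⟨fun h hpos => key i hi hpos h, fun hneg => ?_⟩
  have := key _ (D.opp_mem_sub.2 hi) ((D.isPos_opp i).2 hneg)
  rwa [smul_opp, isPos_opp, not_not] at this

theorem longest_mem (P : Set ι) : D.longest P ∈ D.weyl P := (D.exists_longest P).choose_spec.1

theorem len_le_longest {u : D.R.Aut} (hu : u ∈ D.weyl P) :
    D.len P (D.lin u) ≤ D.len P (D.lin (D.longest P)) := (D.exists_longest P).choose_spec.2 u hu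

theorem longest_smul_neg (hP : P ⊆ D.simple) {j : ι} (hj : j ∈ P) :
    ¬ D.base.IsPos (D.longest P • j) := by
  intro hpos
  have hj' : D.IsSimpleAff P j 0 := .inl ⟨rfl, hj⟩
  have hW := D.longest_mem P
  have hW' := mul_mem hW (D.refl_mem_weyl (D.mem_sub_of_mem hj))
  have h1 := hj'.len_mul_of_nonpos hP (w := D.lin (D.longest P)⁻¹) (by
    rw [cr_lin, inv_inv, eps_pos hpos]
    rcases D.eps_mem j with h | h <;> omega)
  rw [hj'.len hP] at h1
  have h2 := len_le_longest hW'
  have h3 := D.len_inv P (lin_mem_aff hW)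
  have h4 := D.len_inv P (lin_mem_aff hW')
  rw [lin_inv] at h3 h4
  rw [mul_inv_rev, refl_inv, lin_mul, ← aref_zero] at h4
  omega

theorem longest_isPos_iff (hP : P ⊆ D.simple) {i : ι} (hi : i ∈ D.sub P) :
    D.base.IsPos (D.longest P • i) ↔ ¬ D.base.IsPos i :=
  isPos_smul_of_neg hP (fun _ hj => longest_smul_neg hP hj) hi

theorem longest_simple_isPos_iff (i : ι) :
    D.base.IsPos (D.longest D.simple • i) ↔ ¬ D.base.IsPos i :=
  longest_isPos_iff subset_rfl (by rw [sub_simple]; trivial)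

theorem eq_of_neg (hP : P ⊆ D.simple) {u v : D.R.Aut} (hu : u ∈ D.weyl P) (hv : v ∈ D.weyl P)
    (hu' : ∀ i ∈ P, ¬ D.base.IsPos (u • i)) (hv' : ∀ i ∈ P, ¬ D.base.IsPos (v • i)) : u = v := by
  have := eq_one_of_isPos hP (mul_mem (inv_mem hv) hu) fun j hj => by
    have h1 : (v⁻¹ * u) • j ∈ D.sub P :=
      D.smul_mem_sub (mul_mem (inv_mem hv) hu) (D.mem_sub_of_mem hj)
    by_contra hneg
    refine hu' j hj ?_
    have := (isPos_smul_of_neg hP hv' h1).2 hneg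
    rwa [← mul_smul, mul_inv_cancel_left] at this
  exact (inv_mul_eq_one.1 this).symm

theorem eq_longest (hP : P ⊆ D.simple) {u : D.R.Aut} (hu : u ∈ D.weyl P)
    (hu' : ∀ i ∈ P, ¬ D.base.IsPos (u • i)) : u = D.longest P :=
  eq_of_neg hP hu (longest_mem P) hu' fun _ hj => longest_smul_neg hP hj

theorem longest_inv (hP : P ⊆ D.simple) : (D.longest P)⁻¹ = D.longest P := by
  refine eq_longest hP (inv_mem (longest_mem P)) fun j hj h => ?_
  have h1 : (D.longest P)⁻¹ • j ∈ D.sub P :=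
    D.smul_mem_sub (inv_mem (longest_mem P)) (D.mem_sub_of_mem hj)
  refine (longest_isPos_iff hP h1).1 ?_ h
  rw [smul_inv_smul]
  exact isPos_simple (hP hj)

theorem longest_smul_longest_smul (hP : P ⊆ D.simple) (i : ι) :
    D.longest P • D.longest P • i = i := by
  rw [← mul_smul]
  nth_rw 1 [← longest_inv hP]
  rw [inv_mul_cancel, one_smul]

open Classical in
theorem smul_sum_root {p p' : ι → Prop} (hp : ∀ i, p (D.opp i) ↔ p i) {u : D.R.Aut}
    (hu : ∀ i, (D.base.IsPos (u • i) ∧ p' (u • i)) ↔ (¬ D.base.IsPos i ∧ p i)) :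
    u • ∑ i with D.base.IsPos i ∧ p i, D.R.root i =
      -∑ i with D.base.IsPos i ∧ p' i, D.R.root i := by
  rw [Finset.smul_sum, ← Finset.sum_neg_distrib]
  refine Finset.sum_nbij' (fun i => D.opp (u • i)) (fun i => D.opp (u⁻¹ • i)) ?_ ?_ ?_ ?_ ?_
  · intro i hi
    simp only [Finset.mem_filter, Finset.mem_univ, true_and] at hi ⊢
    rw [← smul_opp, hu, D.isPos_opp, not_not, hp]
    exact hi
  · intro i hi
    simp only [Finset.mem_filter, Finset.mem_univ, true_and] at hi ⊢
    rw [D.isPos_opp, hp, ← hu, smul_inv_smul]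
    exact hi
  · intro i _; rw [smul_opp, inv_smul_smul, opp_opp]
  · intro i _; rw [smul_opp, smul_inv_smul, opp_opp]
  · intro i _; rw [root_opp, neg_neg, root_smul]

theorem longest_smul_sub (hP : P ⊆ D.simple) :
    D.longest P • (D.mu ∅ - D.mu P) = -(D.mu ∅ - D.mu P) := by
  classical
  rw [mu_empty_eq P, add_sub_cancel_left]
  refine smul_sum_root (fun i => D.opp_mem_sub) fun i => ?_
  rw [D.smul_mem_sub_iff (longest_mem P)]
  constructor
  · rintro ⟨h1, h2⟩; exact ⟨(longest_isPos_iff hP h2).1 h1, h2⟩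
  · rintro ⟨h1, h2⟩; exact ⟨(longest_isPos_iff hP h2).2 h1, h2⟩

theorem pr_sub_mu (hP : P ⊆ D.simple) {j : ι} (hj : j ∈ P) : D.pr (D.mu ∅ - D.mu P) j = 2 := by
  rw [pr_sub, pr_mu_empty (hP hj), pr_mu_of_mem hP (D.mem_sub_of_mem hj), sub_zero]

/-- The longest element of `W_P` maps `P` to `-P`: simple coroots are distinguished among the
positive coroots in `R_P^∨` by their height. -/
theorem opp_longest_smul_mem (hP : P ⊆ D.simple) {j : ι} (hj : j ∈ P) :
    D.opp (D.longest P • j) ∈ P := by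
  have key : ∀ y ∈ AddSubmonoid.closure (D.R.coroot '' P), y = 0 ∨
      (y ∈ D.R.coroot '' P ∧ D.R.toLinearMap (D.mu ∅ - D.mu P) y = 2) ∨
        4 ≤ D.R.toLinearMap (D.mu ∅ - D.mu P) y := by
    intro y hy
    induction hy using AddSubmonoid.closure_induction with
    | mem y hy =>
      obtain ⟨k, hk, rfl⟩ := hy
      exact .inr (.inl ⟨⟨k, hk, rfl⟩, pr_sub_mu hP hk⟩)
    | zero => exact .inl rfl
    | add x y _ _ hx hy =>
      rcases hx with rfl | hx
      · rwa [zero_add]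
      rcases hy with rfl | hy
      · rw [add_zero]; exact .inr hx
      right; right
      rw [map_add]
      rcases hx with ⟨_, hx⟩ | hx <;> rcases hy with ⟨_, hy⟩ | hy <;> omega
  have hsub : D.longest P • j ∈ D.sub P := D.smul_mem_sub (longest_mem P) (D.mem_sub_of_mem hj)
  have hpr : D.pr (D.mu ∅ - D.mu P) (D.opp (D.longest P • j)) = 2 := by
    have h1 := D.pr_smul (D.longest P) (D.mu ∅ - D.mu P) j
    rw [longest_smul_sub hP, pr_neg, pr_sub_mu hP hj] at h1
    rw [pr_opp]; exact h1
  rcases key _ (coroot_mem_cone hP (D.opp_mem_sub.2 hsub)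
    ((D.isPos_opp _).2 (longest_smul_neg hP hj))) with h | ⟨⟨k, hk, h⟩, _⟩ | h
  · change D.R.toLinearMap _ (D.R.coroot _) = 2 at hpr
    rw [h, map_zero] at hpr
    omega
  · rw [← D.R.coroot.injective h]; exact hk
  · change D.R.toLinearMap _ (D.R.coroot _) = 2 at hpr
    omega

theorem mem_op {i : ι} : i ∈ D.op P ↔ ∃ j ∈ P, i = D.opp (D.longest D.simple • j) := by
  refine exists_congr fun j => and_congr_right fun _ => ?_
  rw [← root_opp, D.R.root.injective.eq_iff]

theorem op_subset (hP : P ⊆ D.simple) : D.op P ⊆ D.simple := by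
  intro i hi
  obtain ⟨j, hj, rfl⟩ := mem_op.1 hi
  exact opp_longest_smul_mem subset_rfl (hP hj)

variable (D) in
/-- The element `w_Δ w_P`, which maps `P` to `P^op`. -/
def toOp (P : Set ι) : D.R.Aut := D.longest D.simple * D.longest P

theorem toOp_mem (hP : P ⊆ D.simple) : D.toOp P ∈ D.weyl D.simple :=
  mul_mem (longest_mem _) (D.weyl_mono hP (longest_mem P))

theorem toOp_inv (hP : P ⊆ D.simple) :
    (D.toOp P)⁻¹ = D.longest P * D.longest D.simple := by
  rw [toOp, mul_inv_rev, longest_inv hP, longest_inv subset_rfl]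

theorem toOp_smul_mem (hP : P ⊆ D.simple) (i : ι) : D.toOp P • i ∈ D.op P ↔ i ∈ P := by
  rw [mem_op, toOp, mul_smul]
  constructor
  · rintro ⟨j, hj, h⟩
    rw [← smul_opp] at h
    have h1 := MulAction.injective _ h
    rw [← longest_smul_longest_smul hP i, h1, smul_opp]
    exact opp_longest_smul_mem hP hj
  · intro hi
    refine ⟨_, opp_longest_smul_mem hP hi, ?_⟩
    rw [smul_opp, opp_opp]

theorem toOp_isPos (hP : P ⊆ D.simple) {i : ι} (hi : i ∈ D.sub P) :
    D.base.IsPos (D.toOp P • i) ↔ D.base.IsPos i := by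
  rw [toOp, mul_smul, longest_simple_isPos_iff, longest_isPos_iff hP hi, not_not]

theorem toOp_isPos_of_not_mem (hP : P ⊆ D.simple) {i : ι} (hi : i ∉ D.sub P) :
    D.base.IsPos (D.toOp P • i) ↔ ¬ D.base.IsPos i := by
  rw [toOp, mul_smul, longest_simple_isPos_iff, smul_isPos_of_not_mem hP (longest_mem P) hi]

theorem toOp_smul_mem_sub (hP : P ⊆ D.simple) {i : ι} :
    D.toOp P • i ∈ D.sub (D.op P) ↔ i ∈ D.sub P := smul_mem_sub_iff_of (toOp_smul_mem hP)

theorem toOp_smul_mu (hP : P ⊆ D.simple) : D.toOp P • D.mu P = -D.mu (D.op P) := by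
  have key := smul_sum_root (u := D.toOp P) (p := fun i => i ∉ D.sub P)
    (p' := fun i => i ∉ D.sub (D.op P)) (fun i => not_congr D.opp_mem_sub) fun i => ?_
  · rw [mu, mu]
    convert key
  rw [toOp_smul_mem_sub hP]
  constructor
  · rintro ⟨h1, h2⟩; exact ⟨(toOp_isPos_of_not_mem hP h2).1 h1, h2⟩
  · rintro ⟨h1, h2⟩; exact ⟨(toOp_isPos_of_not_mem hP h2).2 h1, h2⟩

theorem conj_longest (hP : P ⊆ D.simple) {u : D.R.Aut} (hu : ∀ i, u • i ∈ P ↔ i ∈ P)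
    (hpos : ∀ i, D.base.IsPos (u • i) ↔ D.base.IsPos i) :
    u * D.longest P * u⁻¹ = D.longest P := by
  refine eq_longest hP (weyl_conj hu (longest_mem P)) fun j hj => ?_
  rw [mul_smul, mul_smul, hpos]
  exact longest_smul_neg hP ((hu _).1 (by rwa [smul_inv_smul]))

theorem toOp_inv_mem_minReps (hP : P ⊆ D.simple) : (D.toOp P)⁻¹ ∈ D.minReps (D.op P) := by
  refine ⟨inv_mem (toOp_mem hP), fun i hi => ?_⟩
  have hi' : (D.toOp P)⁻¹ • i ∈ P := (toOp_smul_mem hP _).1 (by rwa [smul_inv_smul])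
  exact isPos_simple (hP hi')

/-- Lengths add up for the product of an element of `W_P ⋉ X`, translated far away in the
antidominant direction, and the element `w_P w_Δ`. -/
theorem len_tr_inv_mul_toOp_inv (hP : P ⊆ D.simple) {x : D.Ext} (hx : x ∈ D.aff P) {n : ℕ}
    (hn : 2 * D.len D.simple x ≤ n) :
    D.len D.simple ((D.tr P n)⁻¹ * x * D.lin (D.toOp P)⁻¹) =
      D.len D.simple ((D.tr P n)⁻¹ * x) + D.len D.simple (D.lin (D.toOp P)⁻¹) := by
  have hx' : x.right ∈ D.weyl P := hx
  have e0 : (D.tr P n)⁻¹ = D.trans (-(n • D.mu P)) := (map_inv SemidirectProduct.inl _).symm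
  refine (len_mul_iff (mul_mem (inv_mem (tr_mem_aff _ n)) (aff_mono hP hx)) _).2 fun i _ => ?_
  have e1 : ((D.tr P n)⁻¹ * x).right = x.right := by
    rw [e0]; exact one_mul x.right
  have e2 : cr ((D.tr P n)⁻¹ * x) i = cr x i - n * D.pr (D.mu P) i := by
    rw [e0, cr_mul, cr_trans, pr_neg, pr_nsmul]
    change _ + cr x ((1 : D.R.Aut)⁻¹ • i) = _
    rw [inv_one, one_smul]; ring
  rw [e1, cr_lin, inv_inv]
  set j := x.right⁻¹ • i with hj
  by_cases hi : i ∈ D.sub P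
  · have hjP : j ∈ D.sub P := D.smul_mem_sub (inv_mem hx') hi
    have : D.eps (D.toOp P • j) = D.eps j := by
      by_cases h : D.base.IsPos j
      · rw [eps_pos h, eps_pos ((toOp_isPos hP hjP).2 h)]
      · rw [eps_neg h, eps_neg fun h' => h ((toOp_isPos hP hjP).1 h')]
    rw [this, sub_self, mul_zero]
  · have hjP : j ∉ D.sub P := fun h => hi ((D.smul_mem_sub_iff (inv_mem hx')).1 h)
    have hji := smul_isPos_of_not_mem hP (inv_mem hx') hi
    have hb := abs_cr_le x i hn
    rw [e2]
    by_cases h : D.base.IsPos i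
    · have h1 : D.base.IsPos j := hji.2 h
      have h2 := pr_mu_pos hP h hi
      rw [eps_pos h1, eps_neg fun h' => (toOp_isPos_of_not_mem hP hjP).1 h' h1]
      nlinarith
    · have h1 : ¬ D.base.IsPos j := fun h' => h (hji.1 h')
      have h2 := pr_mu_neg hP h hi
      rw [eps_neg h1, eps_pos ((toOp_isPos_of_not_mem hP hjP).2 h1)]
      nlinarith

/-- Since `w_Δ w_P` sends the weight for `P` to minus the weight for `P^op`, it exchanges the
antidominant translations for `P` and the dominant translations for `P^op`. -/
theorem tr_inv_mul_toOp_inv (hP : P ⊆ D.simple) (x : D.Ext) (hx : x ∈ D.aff P) (n : ℕ) :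
    (D.tr P n)⁻¹ * x * D.lin (D.toOp P)⁻¹ = D.lin (D.toOp P)⁻¹ *
      (D.lin (D.toOp P) * x * (D.lin (D.toOp P))⁻¹ * D.tr (D.op P) n) := by
  have e0 : (D.tr P n)⁻¹ = D.trans (-(n • D.mu P)) := (map_inv SemidirectProduct.inl _).symm
  have e1 : D.lin (D.toOp P) * (D.tr P n)⁻¹ * (D.lin (D.toOp P))⁻¹ = D.tr (D.op P) n := by
    rw [e0, mul_trans, mul_inv_cancel_right, lin_right, smul_neg, smul_nsmul_aut,
      toOp_smul_mu hP, smul_neg, neg_neg, tr]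
  have hx' : (D.tr P n)⁻¹ * x = x * (D.tr P n)⁻¹ := by
    rw [inv_mul_eq_iff_eq_mul, ← mul_assoc, ← mul_tr_comm hP hx, mul_inv_cancel_right]
  rw [← e1, hx', ← lin_inv]
  group

end HeckeDatum

namespace TwistedDatum

open HeckeDatum

variable {ι X Y Γ : Type*} [Fintype ι] [AddCommGroup X] [AddCommGroup Y] [Group Γ] [Fintype Γ]
  {D : TwistedDatum ι X Y Γ} {P Q : Set ι} {K : Subgroup Γ}

/-! ### Isomorphisms between parabolic subalgebras -/

variable (D) in
/-- An element `u ∈ W` that maps `P` to `Q` and commutes with `K`, so that conjugation by `u` gives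
an isomorphism from `H^P ⋊ ℂ[K, ♮]` to `H^Q ⋊ ℂ[K, ♮]`. -/
structure Conjugates (P Q : Set ι) (K : Subgroup Γ) (u : D.R.Aut) : Prop where
  weyl : u ∈ D.weyl D.simple
  mem_iff : ∀ i, u • i ∈ Q ↔ i ∈ P
  isPos_iff : ∀ i ∈ D.sub P, D.base.IsPos (u • i) ↔ D.base.IsPos i
  comm : ∀ g ∈ K, u * D.act g = D.act g * u

theorem Conjugates.inv {u : D.R.Aut} (h : D.Conjugates P Q K u) : D.Conjugates Q P K u⁻¹ where
  weyl := inv_mem h.weyl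
  mem_iff i := by rw [← h.mem_iff, smul_inv_smul]
  isPos_iff i hi := by
    have : u⁻¹ • i ∈ D.sub P := by rw [← smul_mem_sub_iff_of h.mem_iff, smul_inv_smul]; exact hi
    rw [← h.isPos_iff _ this, smul_inv_smul]
  comm g hg := by rw [inv_mul_eq_iff_eq_mul, ← mul_assoc, h.comm g hg, mul_inv_cancel_right]

/-- Conjugation by `u` as a map from `W_P ⋉ X` to `W_Q ⋉ X`. -/
def Conjugates.aff {u : D.R.Aut} (h : D.Conjugates P Q K u) : D.aff P →* D.aff Q :=
  ((MulAut.conj (D.lin u)).toMonoidHom.comp (D.aff P).subtype).codRestrict (D.aff Q)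
    fun w => aff_conj h.mem_iff w.2

theorem Conjugates.coe_aff {u : D.R.Aut} (h : D.Conjugates P Q K u) (w : D.aff P) :
    (h.aff w : D.Ext) = D.lin u * w * (D.lin u)⁻¹ := rfl

theorem Conjugates.len_aff {u : D.R.Aut} (h : D.Conjugates P Q K u) (w : D.aff P) :
    D.len Q (h.aff w : D.Ext) = D.len P (w : D.Ext) := len_conj h.mem_iff h.isPos_iff w.2

/-- The images of the generators under the isomorphism given by conjugation with `u`. -/
def Conjugates.gen {u : D.R.Aut} (h : D.Conjugates P Q K u) : D.Gen P K → D.Alg Q K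
  | .inl w => D.nW Q K (h.aff w)
  | .inr g => D.nK Q K g

theorem Conjugates.gen_rel {u : D.R.Aut} (h : D.Conjugates P Q K u)
    {a b : FreeAlgebra ℂ (D.Gen P K)} (hab : D.Rel P K a b) :
    FreeAlgebra.lift ℂ h.gen a = FreeAlgebra.lift ℂ h.gen b := by
  induction hab with
  | one => simp only [genW, FreeAlgebra.lift_ι_apply, map_one, gen, nW_one]
  | mul v w hvw =>
    simp only [genW, FreeAlgebra.lift_ι_apply, map_mul, gen]
    rw [D.nW_mul]
    rw [← Subgroup.coe_mul, ← map_mul, h.len_aff, h.len_aff, h.len_aff]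
    exact hvw
  | simple i hi s hs =>
    have e : (h.aff s : D.Ext) = D.lin (D.refl (u • i)) := by
      rw [h.coe_aff, hs, ← aref_zero, ← aref_zero, conj_aref]
    simp only [genW, FreeAlgebra.lift_ι_apply, map_mul, map_add, map_smul, map_one, gen]
    rw [nW, ← map_mul, D.toAlg_rel (.simple (u • i) ((h.mem_iff i).2 hi) _ e), map_add, map_smul,
      map_one, (lam_weyl h.weyl i).1]
  | affine i hi s hs =>
    have e : (h.aff s : D.Ext) = D.affRefl (u • i) := by
      rw [h.coe_aff, hs, ← aref_one, ← aref_one, conj_aref]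
    simp only [genW, FreeAlgebra.lift_ι_apply, map_mul, map_add, map_smul, map_one, gen]
    rw [nW, ← map_mul, D.toAlg_rel (.affine (u • i) (hi.smul h.mem_iff) _ e), map_add, map_smul,
      map_one, (lam_weyl h.weyl i).2]
  | group_one => simp only [genK, FreeAlgebra.lift_ι_apply, map_one, gen, nK_one]
  | group_mul g g' =>
    simp only [genK, FreeAlgebra.lift_ι_apply, map_mul, map_smul, gen]
    exact D.nK_mul g g'
  | cross g w w' hw =>
    simp only [genK, genW, FreeAlgebra.lift_ι_apply, map_mul, map_smul, gen]
    rw [D.nK_mul_nW g (h.aff w) (h.aff w')]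
    · congr 2
      have e : (h.aff w : D.Ext).left = Multiplicative.ofAdd (u • (w : D.Ext).left.toAdd : X) :=
        Multiplicative.toAdd.injective (conj_left _ _)
      rw [e, D.z_weyl _ h.weyl, ofAdd_toAdd]
    · rw [h.coe_aff, h.coe_aff, hw]
      have e := congrArg D.lin (h.comm g g.2)
      rw [lin_mul, lin_mul] at e
      calc _ = (D.lin u * D.lin (D.act g)) * w * (D.lin u * D.lin (D.act g))⁻¹ := by group
        _ = _ := by rw [e]; group

/-- The homomorphism given by conjugation with `u`. -/
def Conjugates.hom {u : D.R.Aut} (h : D.Conjugates P Q K u) : D.Alg P K →ₐ[ℂ] D.Alg Q K :=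
  RingQuot.liftAlgHom ℂ ⟨FreeAlgebra.lift ℂ h.gen, fun _ _ hab => h.gen_rel hab⟩

theorem Conjugates.hom_toAlg {u : D.R.Aut} (h : D.Conjugates P Q K u)
    (a : FreeAlgebra ℂ (D.Gen P K)) :
    h.hom (D.toAlg P K a) = FreeAlgebra.lift ℂ h.gen a := RingQuot.liftAlgHom_mkAlgHom_apply ..

theorem Conjugates.hom_nW {u : D.R.Aut} (h : D.Conjugates P Q K u) (w : D.aff P) :
    h.hom (D.nW P K w) = D.nW Q K (h.aff w) := by
  rw [nW, hom_toAlg, genW, FreeAlgebra.lift_ι_apply]; rfl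

theorem Conjugates.hom_nK {u : D.R.Aut} (h : D.Conjugates P Q K u) (g : K) :
    h.hom (D.nK P K g) = D.nK Q K g := by
  rw [nK, hom_toAlg, genK, FreeAlgebra.lift_ι_apply]; rfl

theorem Conjugates.hom_star {u : D.R.Aut} (h : D.Conjugates P Q K u) (a : D.Alg P K) :
    h.hom (star a) = star (h.hom a) := by
  refine alg_induction (p := fun a => h.hom (star a) = star (h.hom a)) (fun w => ?_) (fun g => ?_)
    (fun a b ha hb => ?_) (fun a b ha hb => ?_) (fun c => ?_) a
  · rw [star_nW, h.hom_nW, h.hom_nW, star_nW, map_inv]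
  · rw [star_nK, map_smul, h.hom_nK, h.hom_nK, star_nK]
  · rw [star_add, map_add, map_add, star_add, ha, hb]
  · rw [star_mul, map_mul, map_mul, star_mul, ha, hb]
  · rw [Algebra.algebraMap_eq_smul_one, star_smul, star_one, map_smul, map_smul, map_one,
      star_smul, star_one]

theorem Conjugates.inv_hom_hom {u : D.R.Aut} (h : D.Conjugates P Q K u) (a : D.Alg P K) :
    h.inv.hom (h.hom a) = a := by
  refine alg_induction (p := fun a => h.inv.hom (h.hom a) = a) (fun w => ?_) (fun g => ?_)
    (fun a b ha hb => ?_) (fun a b ha hb => ?_) (fun c => ?_) a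
  · rw [h.hom_nW, hom_nW]
    congr 1
    apply Subtype.ext
    rw [coe_aff, coe_aff, ← lin_inv]
    group
  · rw [h.hom_nK, hom_nK]
  · rw [map_add, map_add, ha, hb]
  · rw [map_mul, map_mul, ha, hb]
  · rw [AlgHom.commutes, AlgHom.commutes]

theorem Conjugates.hom_inv_hom {u : D.R.Aut} (h : D.Conjugates P Q K u) (a : D.Alg Q K) :
    h.hom (h.inv.hom a) = a := by
  have h1 := h.inv.inv_hom_hom a
  have h2 : ∀ b, h.inv.inv.hom b = h.hom b := by
    have key : ∀ {v : D.R.Aut} (h' : D.Conjugates P Q K v), v = u → ∀ b, h'.hom b = h.hom b := by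
      intro v h' e; subst e; exact fun b => rfl
    exact key _ (inv_inv u)
  rwa [h2] at h1

/-- The `*`-isomorphism given by conjugation with `u`. -/
def Conjugates.equiv {u : D.R.Aut} (h : D.Conjugates P Q K u) : D.Alg P K ≃⋆ₐ[ℂ] D.Alg Q K :=
  StarAlgEquiv.ofAlgEquiv
    (AlgEquiv.ofAlgHom h.hom h.inv.hom (AlgHom.ext h.hom_inv_hom) (AlgHom.ext h.inv_hom_hom))
    h.hom_star

theorem Conjugates.equiv_N {u : D.R.Aut} (h : D.Conjugates P Q K u) {w : D.Ext}
    (hw : w ∈ D.aff P) :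
    h.equiv (D.N P K w) = D.N Q K (D.lin u * w * (D.lin u)⁻¹) := by
  rw [N_of_mem hw, N_of_mem (aff_conj h.mem_iff hw)]
  exact h.hom_nW _

theorem Conjugates.equiv_NG {u : D.R.Aut} (h : D.Conjugates P Q K u) {g : Γ} (hg : g ∈ K) :
    h.equiv (D.NG P K g) = D.NG Q K g := by
  rw [NG_of_mem hg, NG_of_mem hg]
  exact h.hom_nK _

theorem Admissible.act_comm_longest (h : D.Admissible P K) {g : Γ} (hg : g ∈ K) :
    D.act g * D.longest P = D.longest P * D.act g := by
  have := conj_longest h.subset (h.smul_mem_iff hg) (isPos_act g)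
  rwa [mul_inv_eq_iff_eq_mul] at this

/-- The group `K` commutes with `w_Δ w_P`, because it permutes the simple roots and `P`. -/
theorem Admissible.conjugates_toOp (h : D.Admissible P K) :
    D.Conjugates P (D.op P) K (D.toOp P) where
  weyl := toOp_mem h.subset
  mem_iff := toOp_smul_mem h.subset
  isPos_iff i hi := toOp_isPos h.subset hi
  comm g hg := by
    rw [toOp, mul_assoc, ← h.act_comm_longest hg, ← mul_assoc,
      ← D.admissible_simple.act_comm_longest (Subgroup.mem_top g), mul_assoc]

theorem stab_comm_tr (hP : P ⊆ D.simple) {x : D.Ext} (hx : x ∈ D.aff P) (n : ℕ) :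
    D.NFull (D.tr P n) * D.stab P x = D.stab P x * D.NFull (D.tr P n) := by
  have hx' := aff_mono hP hx
  set m := 2 * D.len D.simple x with hm
  have := len_mul_tr_mul_tr hP (one_mem (D.aff P)) hx (by rw [one_mul, len_one, zero_add])
    (m := n) (n := m) (by rw [len_one]; omega) le_rfl
  rw [one_mul] at this
  refine (isUnit_tr (P := P) m).mul_right_cancel ?_
  rw [mul_assoc, stab_mul_tr hP hx' le_rfl, mul_assoc, N_tr_mul_tr hP,
    stab_mul_tr hP hx' (by omega), NFull, NFull,
    N_mul (tr_mem_aff _ n) (mul_mem hx' (tr_mem_aff _ m)) this, ← mul_assoc,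
    ← mul_tr_comm hP hx, mul_assoc, tr_mul_tr]

/-- The element `N_{w_P w_Δ}` intertwines the embedding of a parabolic subalgebra, conjugated by
the two involutions, and the embedding of the opposite parabolic subalgebra. -/
theorem Admissible.star_embed_star_mul (h : D.Admissible P K) (h' : D.Admissible (D.op P) K)
    (a : D.Alg P K) :
    star (h.embed (star a)) * D.NFull (D.lin (D.toOp P)⁻¹) =
      D.NFull (D.lin (D.toOp P)⁻¹) * h'.embed (h.conjugates_toOp.equiv a) := by
  have hu := toOp_inv_mem_minReps (D := D.toHeckeDatum) h.subset
  have hu' : D.lin (D.toOp P)⁻¹ ∈ D.aff D.simple := lin_mem_aff hu.1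
  refine alg_induction (p := fun a => star (h.embed (star a)) * D.NFull (D.lin (D.toOp P)⁻¹) =
      D.NFull (D.lin (D.toOp P)⁻¹) * h'.embed (h.conjugates_toOp.equiv a))
    (fun w => ?_) (fun g => ?_) (fun a b ha hb => ?_) (fun a b ha hb => ?_) (fun c => ?_) a
  · obtain ⟨x, hx⟩ := w
    rw [← N_of_mem hx, star_N hx, h.embed_N (inv_mem hx), h.conjugates_toOp.equiv_N hx,
      h'.embed_N (aff_conj h.conjugates_toOp.mem_iff hx)]
    set x' := D.lin (D.toOp P) * x * (D.lin (D.toOp P))⁻¹ with hx'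
    have hxQ : x' ∈ D.aff (D.op P) := aff_conj h.conjugates_toOp.mem_iff hx
    have hxΔ := aff_mono h.subset hx
    have hxQΔ := aff_mono h'.subset hxQ
    set n := 2 * D.len D.simple x + 2 * D.len D.simple x⁻¹ + 2 * D.len D.simple x' with hn
    have ht : (D.tr P n)⁻¹ ∈ D.aff D.simple := inv_mem (tr_mem_aff _ n)
    refine (isUnit_N (K := ⊤) subset_rfl ht).mul_left_cancel ?_
    have e1 : D.N D.simple ⊤ (D.tr P n)⁻¹ * star (D.stab P x⁻¹) =
        D.NFull ((D.tr P n)⁻¹ * x) := by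
      rw [← star_N (tr_mem_aff _ n), ← star_mul, stab_mul_tr h.subset (inv_mem hxΔ) (by omega),
        star_N (mul_mem (inv_mem hxΔ) (tr_mem_aff _ n)), mul_inv_rev, inv_inv]
    -- both sides are `N_z` with `z = t⁻¹ y w_P w_Δ`, in two factorizations along which lengths add
    have e2 : ∀ y ∈ D.aff P, 2 * D.len D.simple y ≤ n →
        2 * D.len D.simple (D.lin (D.toOp P) * y * (D.lin (D.toOp P))⁻¹) ≤ n →
        D.NFull ((D.tr P n)⁻¹ * y) * D.NFull (D.lin (D.toOp P)⁻¹) =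
          D.NFull (D.lin (D.toOp P)⁻¹) *
            (D.stab (D.op P) (D.lin (D.toOp P) * y * (D.lin (D.toOp P))⁻¹) *
              D.NFull (D.tr (D.op P) n)) := by
      intro y hy hn hn'
      have hyQ := aff_conj h.conjugates_toOp.mem_iff hy
      have hyQΔ := aff_mono h'.subset hyQ
      rw [stab_mul_tr h'.subset hyQΔ hn', NFull, NFull, N_mul (mul_mem ht (aff_mono h.subset hy))
        hu' (len_tr_inv_mul_toOp_inv h.subset hy hn), tr_inv_mul_toOp_inv h.subset y hy, NFull,
        N_mul hu' (mul_mem hyQΔ (tr_mem_aff _ n)) (len_minReps_mul h'.subset hu hyQ hn')]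
    -- the case `y = 1` moves `N_{t⁻¹}` past `N_{w_P w_Δ}`
    have e3 := e2 1 (one_mem _) (by rw [len_one]; omega)
      (by rw [mul_one, mul_inv_cancel, len_one]; omega)
    rw [mul_one, mul_one, mul_inv_cancel, stab_one h'.subset, one_mul] at e3
    have e4 := e2 x hx (by omega) (by rw [← hx']; omega)
    rw [← hx', ← stab_comm_tr h'.subset hxQ, ← mul_assoc, ← e3] at e4
    rw [← mul_assoc, e1, e4, mul_assoc]
  · rw [← NG_coe, star_NG g.2, map_smul, h.embed_NG (inv_mem g.2), h.conjugates_toOp.equiv_NG g.2,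
      h'.embed_NG g.2, NGFull, ← star_NG (Subgroup.mem_top (g : Γ)), star_star,
      D.admissible_simple.NG_mul_N (Subgroup.mem_top _) hu', z_lin_left, one_smul]
    congr 2
    have e := congrArg D.lin (h.conjugates_toOp.inv.comm g g.2)
    rw [lin_mul, lin_mul] at e
    rw [← e, mul_inv_cancel_right]
  · rw [star_add, map_add, star_add, add_mul, ha, hb, map_add, map_add, mul_add]
  · rw [star_mul, map_mul, star_mul, mul_assoc, hb, ← mul_assoc, ha, map_mul, map_mul, mul_assoc]
  · rw [Algebra.algebraMap_eq_smul_one, star_smul, star_one, map_smul, map_one, star_smul,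
      star_one, star_star, smul_mul_assoc, one_mul, map_smul, map_one, map_smul, map_one,
      mul_smul_comm, mul_one]

end TwistedDatum

/-! ### Induced modules and Hermitian duals -/

section InducedModules

variable {S A : Type*} [Ring S] [Algebra ℂ S] [Ring A] [Algebra ℂ A]

namespace Induced

variable {f : S →ₐ[ℂ] A} {V : Type*} [AddCommGroup V] [Module ℂ V] [Module S V]

theorem mul_tmul (a : A) (s : S) (v : V) : tmul f V (a * f s) v = tmul f V a (s • v) :=
  (Submodule.Quotient.eq _).2 (Submodule.subset_span ⟨a, s, v, rfl⟩)

theorem smul_tmul (b a : A) (v : V) : b • tmul f V a v = tmul f V (b * a) v := rfl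

theorem tmul_add (a : A) (v w : V) : tmul f V a (v + w) = tmul f V a v + tmul f V a w := by
  rw [tmul, TensorProduct.tmul_add]; rfl

theorem add_tmul (a b : A) (v : V) : tmul f V (a + b) v = tmul f V a v + tmul f V b v := by
  rw [tmul, TensorProduct.add_tmul]; rfl

theorem tmul_zero (a : A) : tmul f V a 0 = 0 := by rw [tmul, TensorProduct.tmul_zero]; rfl

theorem zero_tmul (v : V) : tmul f V 0 v = 0 := by rw [tmul, TensorProduct.zero_tmul]; rfl

@[elab_as_elim]
theorem induction {p : Induced f V → Prop} (h0 : p 0) (ht : ∀ a v, p (tmul f V a v))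
    (hadd : ∀ x y, p x → p y → p (x + y)) (x : Induced f V) : p x := by
  obtain ⟨t, rfl⟩ := Submodule.Quotient.mk_surjective (balancedRelations f V) x
  induction t using TensorProduct.induction_on with
  | zero => exact h0
  | tmul a v => exact ht a v
  | add x y hx hy => exact hadd _ _ hx hy

/-- The universal property of `A ⊗[S] V` for linear maps to complex vector spaces. The quotient that
defines `A ⊗[S] V` is one of `A`-modules, so that the map is built on additive groups first. -/
def lift {M : Type*} [AddCommGroup M] [Module ℂ M] (g : A →ₗ[ℂ] V →ₗ[ℂ] M)
    (hg : ∀ a s v, g (a * f s) v = g a (s • v)) : Induced f V →ₗ[ℂ] M :=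
  let F : Induced f V →+ M :=
    QuotientAddGroup.lift (balancedRelations f V).toAddSubgroup
      (TensorProduct.lift g).toAddMonoidHom (by
        intro t ht
        have ht' : t ∈ balancedRelations f V := ht
        change TensorProduct.lift g t = 0
        induction ht' using Submodule.closure_induction with
        | zero => exact map_zero _
        | add x y hx hy h1 h2 => rw [map_add, h1 hx, h2 hy, add_zero]
        | smul_mem b x hx =>
          obtain ⟨a, s, v, rfl⟩ := hx
          rw [smul_sub, TensorProduct.smul_tmul', TensorProduct.smul_tmul', smul_eq_mul,
            smul_eq_mul, ← mul_assoc, map_sub, TensorProduct.lift.tmul, TensorProduct.lift.tmul,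
            hg, sub_self])
  { toFun := F
    map_add' := map_add F
    map_smul' := fun c x => by
      obtain ⟨t, rfl⟩ := Submodule.Quotient.mk_surjective (balancedRelations f V) x
      exact map_smul (TensorProduct.lift g) c t }

/-- The universal property of `A ⊗[S] V` for homomorphisms of `A`-modules. -/
def liftModule {M : Type*} [AddCommGroup M] [Module ℂ M] [Module A M] [IsScalarTower ℂ A M]
    (g : V →ₗ[ℂ] M) (hg : ∀ s v, f s • g v = g (s • v)) : Induced f V →ₗ[A] M :=
  (balancedRelations f V).liftQ
    (TensorProduct.AlgebraTensorModule.lift (LinearMap.toSpanSingleton A (V →ₗ[ℂ] M) g)) (by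
      refine Submodule.span_le.2 ?_
      rintro _ ⟨a, s, v, rfl⟩
      change TensorProduct.AlgebraTensorModule.lift _ _ = 0
      rw [map_sub, TensorProduct.AlgebraTensorModule.lift_tmul,
        TensorProduct.AlgebraTensorModule.lift_tmul]
      change (a * f s) • g v - a • g (s • v) = 0
      rw [mul_smul, hg, sub_self])

end Induced

namespace HermitianDual

variable {V W : Type*} [AddCommGroup V] [Module ℂ V] [Module A V] [AddCommGroup W] [Module ℂ W]
  [Module S W]

/-- Composition of a conjugate-linear function with a linear map. -/
def comp (l : HermitianDual A V) (T : W →ₗ[ℂ] V) : HermitianDual S W :=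
  LinearMap.comp (show V →ₛₗ[starRingEnd ℂ] ℂ from l) T

end HermitianDual

variable [StarRing A] [StarModule ℂ A] [StarRing S] [StarModule ℂ S]
  {S' : Type*} [Ring S'] [Algebra ℂ S'] [StarRing S'] [StarModule ℂ S']

/-- Precomposition with an invertible element `u` of a `*`-algebra `A` gives an isomorphism
between the restrictions of `V†` and the Hermitian dual of a restriction of `V`, if `u`
intertwines the two ways to map `S` to `A`. -/
theorem exists_dual_restrict_equiv (f : S →ₐ[ℂ] A) (f' : S' →ₐ[ℂ] A) (ψ : S →ₐ[ℂ] S') {u : A}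
    (hu : IsUnit u) (h : ∀ s, star (f s) * u = u * f' (star (ψ s)))
    (V : Type*) [AddCommGroup V] [Module ℂ V] [Module A V] [IsScalarTower ℂ A V] :
    ∃ Φ : Restricted f (HermitianDual A V) ≃ₗ[S]
        Restricted ψ (HermitianDual S' (Restricted f' V)),
      ∀ (l : HermitianDual A V) (v : V),
        (Restricted.of _ _).symm (Φ (Restricted.of f _ l)) (Restricted.of f' V v) =
          l (u • v) := by
  obtain ⟨u, rfl⟩ := hu
  let T : Restricted f' V →ₗ[ℂ] V := (Algebra.lsmul ℂ ℂ V (u : A) : V →ₗ[ℂ] V)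
  let T' : V →ₗ[ℂ] Restricted f' V := (Algebra.lsmul ℂ ℂ V (↑u⁻¹ : A) : V →ₗ[ℂ] V)
  refine ⟨{ toFun := fun l => Restricted.of ψ _ (HermitianDual.comp (S := S')
              ((Restricted.of f _).symm l) T)
            invFun := fun l => Restricted.of f _ (HermitianDual.comp (S := A)
              ((Restricted.of ψ _).symm l) T')
            map_add' := fun l m => rfl
            map_smul' := fun s l => ?_
            left_inv := fun l => ?_
            right_inv := fun l => ?_ }, fun l v => rfl⟩
  · refine HermitianDual.ext (A := S') (V := Restricted f' V) fun v => ?_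
    change (show HermitianDual A V from l) (star (f s) • (u : A) • (show V from v)) =
      (show HermitianDual A V from l) ((u : A) • f' (star (ψ s)) • (show V from v))
    rw [← mul_smul, ← mul_smul, h]
  · refine HermitianDual.ext (A := A) (V := V) fun v => ?_
    change (show HermitianDual A V from l) ((u : A) • (↑u⁻¹ : A) • v) = _
    rw [← mul_smul, Units.mul_inv, one_smul]
  · refine HermitianDual.ext (A := S') (V := Restricted f' V) fun v => ?_
    change (show HermitianDual S' (Restricted f' V) from l)
      ((↑u⁻¹ : A) • (u : A) • (show V from v)) = _
    rw [← mul_smul, Units.inv_mul, one_smul]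

/-- The variant of `exists_dual_restrict_equiv` in which `ψ` twists the restriction of `V†` instead
of the dual of the restriction. -/
theorem exists_restrict_dual_equiv (f : S →ₐ[ℂ] A) (f' : S' →ₐ[ℂ] A) (ψ : S →ₐ[ℂ] S') {u : A}
    (hu : IsUnit u) (h : ∀ s, star (f' (ψ s)) * u = u * f (star s))
    (V : Type*) [AddCommGroup V] [Module ℂ V] [Module A V] [IsScalarTower ℂ A V] :
    ∃ Φ : Restricted ψ (Restricted f' (HermitianDual A V)) ≃ₗ[S]
        HermitianDual S (Restricted f V),
      ∀ (l : HermitianDual A V) (v : V),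
        Φ (Restricted.of _ _ (Restricted.of f' _ l)) (Restricted.of f V v) = l (u • v) := by
  obtain ⟨u, rfl⟩ := hu
  let T : Restricted f V →ₗ[ℂ] V := (Algebra.lsmul ℂ ℂ V (u : A) : V →ₗ[ℂ] V)
  let T' : V →ₗ[ℂ] Restricted f V := (Algebra.lsmul ℂ ℂ V (↑u⁻¹ : A) : V →ₗ[ℂ] V)
  refine ⟨{ toFun := fun l => HermitianDual.comp (S := S)
              ((Restricted.of f' _).symm ((Restricted.of ψ _).symm l)) T
            invFun := fun l => Restricted.of ψ _ (Restricted.of f' _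
              (HermitianDual.comp (S := A) l T'))
            map_add' := fun l m => rfl
            map_smul' := fun s l => ?_
            left_inv := fun l => ?_
            right_inv := fun l => ?_ }, fun l v => rfl⟩
  · refine HermitianDual.ext (A := S) (V := Restricted f V) fun v => ?_
    change (show HermitianDual A V from l) (star (f' (ψ s)) • (u : A) • (show V from v)) =
      (show HermitianDual A V from l) ((u : A) • f (star s) • (show V from v))
    rw [← mul_smul, ← mul_smul, h]
  · refine HermitianDual.ext (A := A) (V := V) fun v => ?_
    change (show HermitianDual A V from l) ((u : A) • (↑u⁻¹ : A) • v) = _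
    rw [← mul_smul, Units.mul_inv, one_smul]
  · refine HermitianDual.ext (A := S) (V := Restricted f V) fun v => ?_
    change l ((↑u⁻¹ : A) • (u : A) • (show V from v)) = _
    rw [← mul_smul, Units.inv_mul, one_smul]

/-- Suppose that `E : A → S` is a conditional expectation for `f : S → A` and the involutions, and
that `A` is a free right `S`-module with a finite basis that is orthogonal for the `S`-valued
pairing `E(a^* b)`. Then induction commutes with Hermitian duals. -/
theorem exists_induced_dual_equiv (f : S →ₐ[ℂ] A) (E : A →ₗ[ℂ] S)
    (hE : ∀ a s, E (a * f s) = E a * s) (hE' : ∀ s a, E (star (f (star s)) * a) = s * E a)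
    {R : Type*} [Finite R] (e : R → A) (c : R → ℂ) (hc : ∀ r, c r ≠ 0)
    (he : ∀ r s, E (star (e r) * e s) = open Classical in if r = s then c r • 1 else 0)
    (hspan : ∀ a, a ∈ AddSubmonoid.closure {x | ∃ r s, x = e r * f s})
    (V : Type*) [AddCommGroup V] [Module ℂ V] [Module S V] [IsScalarTower ℂ S V] :
    ∃ Φ : Induced f (HermitianDual S V) ≃ₗ[A] HermitianDual A (Induced f V),
      ∀ (a : A) (l : HermitianDual S V) (b : A) (v : V),
        Φ (Induced.tmul f _ a l) (Induced.tmul f V b v) = l (E (star a * b) • v) := by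
  classical
  cases nonempty_fintype R
  let T : Induced f V →ₗ[ℂ] V := Induced.lift ((Algebra.lsmul ℂ ℂ V).toLinearMap ∘ₗ E)
    fun a s v => by
      change E (a * f s) • v = E a • s • v
      rw [hE, mul_smul]
  have hT : ∀ a v, T (Induced.tmul f V a v) = E a • v := fun a v => rfl
  let Ψ : HermitianDual S V →ₗ[ℂ] HermitianDual A (Induced f V) :=
    { toFun := fun l => l.comp T
      map_add' := fun l m => rfl
      map_smul' := fun z l => rfl }
  let Φ : Induced f (HermitianDual S V) →ₗ[A] HermitianDual A (Induced f V) :=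
    Induced.liftModule Ψ fun s l => by
      refine HermitianDual.ext fun x => ?_
      change l (T (star (f s) • x)) = l (star s • T x)
      congr 1
      induction x using Induced.induction with
      | h0 => rw [smul_zero, map_zero, smul_zero]
      | ht a v =>
        rw [Induced.smul_tmul, hT, hT, ← mul_smul, ← hE', star_star]
      | hadd x y hx hy => rw [smul_add, map_add, map_add, smul_add, hx, hy]
  have hΦ : ∀ (a : A) (l : HermitianDual S V) (b : A) (v : V),
      Φ (Induced.tmul f _ a l) (Induced.tmul f V b v) = l (E (star a * b) • v) :=
    fun a l b v => rfl
  -- every element of an induced module is a combination of the given basis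
  have hsum : ∀ (W : Type _) [AddCommGroup W] [Module ℂ W] [Module S W] (x : Induced f W),
      ∃ w : R → W, x = ∑ r, Induced.tmul f W (e r) (w r) := by
    intro W _ _ _ x
    have hadd : ∀ x y : Induced f W, (∃ w : R → W, x = ∑ r, Induced.tmul f W (e r) (w r)) →
        (∃ w : R → W, y = ∑ r, Induced.tmul f W (e r) (w r)) →
        ∃ w : R → W, x + y = ∑ r, Induced.tmul f W (e r) (w r) := by
      rintro _ _ ⟨w, rfl⟩ ⟨w', rfl⟩
      refine ⟨w + w', ?_⟩
      rw [← Finset.sum_add_distrib]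
      exact Finset.sum_congr rfl fun r _ => (Induced.tmul_add _ _ _).symm
    have hzero : ∃ w : R → W, (0 : Induced f W) = ∑ r, Induced.tmul f W (e r) (w r) :=
      ⟨0, (Finset.sum_eq_zero fun r _ => Induced.tmul_zero _).symm⟩
    induction x using Induced.induction with
    | h0 => exact hzero
    | ht a v =>
      have ha := hspan a
      induction ha using AddSubmonoid.closure_induction with
      | mem x hx =>
        obtain ⟨r, s, rfl⟩ := hx
        refine ⟨Pi.single r (s • v), ?_⟩
        rw [Finset.sum_eq_single r (fun r' _ hr => by
            rw [Pi.single_eq_of_ne hr, Induced.tmul_zero])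
          (fun h => absurd (Finset.mem_univ r) h), Pi.single_eq_same, Induced.mul_tmul]
      | zero => rw [Induced.zero_tmul]; exact hzero
      | add a b _ _ ha hb => rw [Induced.add_tmul]; exact hadd _ _ ha hb
    | hadd x y hx hy => exact hadd x y hx hy
  have heval : ∀ (l : R → HermitianDual S V) (r : R) (v : V),
      Φ (∑ r, Induced.tmul f _ (e r) (l r)) (Induced.tmul f V (e r) v) = conj (c r) * l r v := by
    intro l r v
    have h1 : ∀ (t : Finset R), Φ (∑ r ∈ t, Induced.tmul f _ (e r) (l r))
        (Induced.tmul f V (e r) v) =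
          ∑ s ∈ t, Φ (Induced.tmul f _ (e s) (l s)) (Induced.tmul f V (e r) v) := by
      intro t
      induction t using Finset.induction_on with
      | empty => rw [Finset.sum_empty, Finset.sum_empty, map_zero]; rfl
      | insert s t hs ih =>
        rw [Finset.sum_insert hs, Finset.sum_insert hs, map_add, HermitianDual.add_apply, ih]
    rw [h1, Finset.sum_eq_single r]
    · rw [hΦ, he, if_pos rfl, smul_assoc, one_smul, map_smulₛₗ, smul_eq_mul]
    · intro s _ hs
      rw [hΦ, he, if_neg hs, zero_smul, map_zero]
    · exact fun h => absurd (Finset.mem_univ r) h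
  have hc' : ∀ r, conj (c r) ≠ 0 := fun r => (map_ne_zero _).2 (hc r)
  refine ⟨LinearEquiv.ofBijective Φ ⟨?_, ?_⟩, hΦ⟩
  · refine (injective_iff_map_eq_zero Φ).2 fun x hx => ?_
    obtain ⟨l, rfl⟩ := hsum _ x
    refine Finset.sum_eq_zero fun r _ => ?_
    have : l r = 0 := HermitianDual.ext fun v => by
      have h1 := heval l r v
      rw [hx] at h1
      exact (mul_eq_zero.1 h1.symm).resolve_left (hc' r)
    rw [this, Induced.tmul_zero]
  · intro L
    let J : R → V →ₗ[ℂ] Induced f V := fun r =>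
      { toFun := fun v => Induced.tmul f V (e r) v
        map_add' := Induced.tmul_add _
        map_smul' := fun z v => by
          rw [Induced.tmul, TensorProduct.tmul_smul]; rfl }
    refine ⟨∑ r, Induced.tmul f _ (e r) ((conj (c r))⁻¹ • L.comp (J r)), ?_⟩
    refine HermitianDual.ext fun x => ?_
    obtain ⟨w, rfl⟩ := hsum _ x
    have hs : ∀ M : HermitianDual A (Induced f V), M (∑ r, Induced.tmul f V (e r) (w r)) =
        ∑ r, M (Induced.tmul f V (e r) (w r)) := fun M => map_sum M _ _
    rw [hs, hs]
    refine Finset.sum_congr rfl fun r _ => ?_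
    rw [heval, HermitianDual.smul_apply, mul_inv_cancel_left₀ (hc' r)]
    rfl

end InducedModules

namespace HeckeDatum

variable {ι X Y : Type*} [Fintype ι] [AddCommGroup X] [AddCommGroup Y] {D : HeckeDatum ι X Y}

theorem finite_weyl {P : Set ι} (hP : P ⊆ D.simple) : (D.weyl P : Set D.R.Aut).Finite := by
  have hf : Set.InjOn (fun (u : D.R.Aut) (i : ι) => u • i) (D.weyl P) := by
    intro u hu v hv h
    have := eq_one_of_isPos hP (mul_mem (inv_mem hv) hu) fun j hj => by
      have hj' : u • j = v • j := congrFun h j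
      rw [mul_smul, hj', inv_smul_smul]
      exact isPos_simple (hP hj)
    exact (inv_mul_eq_one.1 this).symm
  exact Set.Finite.of_finite_image (Set.toFinite _) hf

end HeckeDatum

namespace TwistedDatum

open HeckeDatum Filter

variable {ι X Y Γ : Type*} [Fintype ι] [AddCommGroup X] [AddCommGroup Y] [Group Γ] [Fintype Γ]
  {D : TwistedDatum ι X Y Γ} {P Q : Set ι} {K : Subgroup Γ}

/-! ### The conditional expectation onto a parabolic subalgebra -/

/-- `e` represents the functional `a ↦ τ(a^* b)` on the parabolic subalgebra, in the limit of far
away translations. -/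
def Admissible.Represents (h : D.Admissible P K) (b : D.Full) (e : D.Alg P K) : Prop :=
  ∀ a, ∀ᶠ n in atTop, D.admissible_simple.tau
    (star (h.embed a * D.NFull (D.tr P n)) * (b * D.NFull (D.tr P n))) = h.tau (star a * e)

/-- Uniqueness comes from the nondegeneracy of the pairing of the parabolic subalgebra. -/
theorem Admissible.Represents.unique {h : D.Admissible P K} {b : D.Full} {e e' : D.Alg P K}
    (he : h.Represents b e) (he' : h.Represents b e') : e = e' :=
  h.ext_of_tau fun a => by
    obtain ⟨n, h1, h2⟩ := ((he a).and (he' a)).exists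
    rw [← h1, h2]

theorem Admissible.Represents.add {h : D.Admissible P K} {b b' : D.Full} {e e' : D.Alg P K}
    (he : h.Represents b e) (he' : h.Represents b' e') : h.Represents (b + b') (e + e') :=
  fun a => by
    filter_upwards [he a, he' a] with n h1 h2
    rw [add_mul, mul_add, map_add, h1, h2, mul_add, map_add]

theorem Admissible.Represents.smul {h : D.Admissible P K} {b : D.Full} {e : D.Alg P K}
    (he : h.Represents b e) (c : ℂ) : h.Represents (c • b) (c • e) :=
  fun a => by
    filter_upwards [he a] with n h1
    rw [smul_mul_assoc, mul_smul_comm, map_smul, h1, mul_smul_comm, map_smul]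

theorem Admissible.Represents.star_mul {h : D.Admissible P K} {b : D.Full} {e : D.Alg P K}
    (he : h.Represents b e) (a : D.Alg P K) :
    h.Represents (star (h.embed (star a)) * b) (a * e) := fun a' => by
  filter_upwards [he (star a * a')] with n h1
  have e1 : star (h.embed a' * D.NFull (D.tr P n)) *
      (star (h.embed (star a)) * b * D.NFull (D.tr P n)) =
      star (h.embed (star a * a') * D.NFull (D.tr P n)) * (b * D.NFull (D.tr P n)) := by
    rw [map_mul]
    simp only [StarMul.star_mul, mul_assoc]
  rw [e1, h1, StarMul.star_mul, star_star, mul_assoc]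

theorem Admissible.represents_coset (h : D.Admissible P K) {g g' : Γ}
    (hg : g⁻¹ * g' ∈ K → g = g') {u u' : D.R.Aut} (hu : u ∈ D.minReps P) (hu' : u' ∈ D.minReps P)
    (a : D.Alg P K) :
    h.Represents (star (D.NGFull g * D.NFull (D.lin u)) *
        (D.NGFull g' * D.NFull (D.lin u') * h.embed a))
      ((open Classical in if g = g' ∧ u = u' then (D.absNorm g : ℂ) ^ 2 else 0) • a) := fun a' => by
  filter_upwards [h.tau_coset hg hu hu' a' a] with n hn
  rw [mul_smul_comm, map_smul, smul_eq_mul, ← hn]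
  simp only [StarMul.star_mul, mul_assoc]

theorem isComplement_eq {GP : Set Γ} (hGP : Subgroup.IsComplement GP (K : Set Γ)) {g g' : Γ}
    (hg : g ∈ GP) (hg' : g' ∈ GP) (h : g⁻¹ * g' ∈ K) : g = g' := by
  obtain ⟨x, -, hx⟩ := (Subgroup.isComplement_iff_existsUnique_inv_mul_mem.1 hGP) g'
  exact Subtype.ext_iff.1 ((hx ⟨g, hg⟩ h).trans (hx ⟨g', hg'⟩ (by simp [one_mem])).symm)

/-- Existence is checked on the cosets `N_g N_u B`. The representing element is right linear over
the parabolic subalgebra. -/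
theorem Admissible.exists_represents (h : D.Admissible P K) (b : D.Full) :
    ∃ e, ∀ a, h.Represents (b * h.embed a) (e * a) := by
  classical
  obtain ⟨GP, hGP, h1⟩ := K.exists_isComplement_left 1
  induction b using h.coset_induction hGP with
  | h1 g hg u hu a =>
    refine ⟨(if 1 = g ∧ 1 = u then (D.absNorm (1 : Γ) : ℂ) ^ 2 else 0) • a, fun a' => ?_⟩
    have := h.represents_coset (g := 1) (g' := g) (isComplement_eq hGP h1 hg)
      (one_mem_minReps h.subset) hu (a * a')
    rw [NGFull, NG_one, lin_one, NFull, N_one, one_mul, star_one, one_mul, map_mul,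
      ← mul_assoc, ← smul_mul_assoc] at this
    convert this
  | h0 => exact ⟨0, fun a a' => Eventually.of_forall fun n => by simp⟩
  | hadd b b' hb hb' =>
    obtain ⟨e, he⟩ := hb
    obtain ⟨e', he'⟩ := hb'
    exact ⟨e + e', fun a => by rw [add_mul, add_mul]; exact (he a).add (he' a)⟩

/-- The conditional expectation from `H ⋊ ℂ[Γ, ♮]` to a parabolic subalgebra: the adjoint of the
embedding for the pairings `τ(a^* b)`, in the limit of far away translations. -/
def Admissible.expect (h : D.Admissible P K) : D.Full →ₗ[ℂ] D.Alg P K where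
  toFun b := (h.exists_represents b).choose
  map_add' b b' := by
    have h1 := (h.exists_represents b).choose_spec 1
    have h2 := (h.exists_represents b').choose_spec 1
    have h3 := (h.exists_represents (b + b')).choose_spec 1
    rw [map_one, mul_one, mul_one] at h1 h2 h3
    exact h3.unique (h1.add h2)
  map_smul' c b := by
    have h1 := (h.exists_represents b).choose_spec 1
    have h3 := (h.exists_represents (c • b)).choose_spec 1
    rw [map_one, mul_one, mul_one] at h1 h3
    exact h3.unique (h1.smul c)

theorem Admissible.represents_expect (h : D.Admissible P K) (b : D.Full) :
    h.Represents b (h.expect b) := by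
  have h1 := (h.exists_represents b).choose_spec 1
  rwa [map_one, mul_one, mul_one] at h1

theorem Admissible.expect_mul (h : D.Admissible P K) (b : D.Full) (a : D.Alg P K) :
    h.expect (b * h.embed a) = h.expect b * a :=
  (h.represents_expect _).unique ((h.exists_represents b).choose_spec a)

theorem Admissible.expect_star_mul (h : D.Admissible P K) (a : D.Alg P K) (b : D.Full) :
    h.expect (star (h.embed (star a)) * b) = a * h.expect b :=
  (h.represents_expect _).unique ((h.represents_expect b).star_mul a)

open Classical in
/-- The elements `N_g N_u` are orthogonal for the pairing with values in the parabolic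
subalgebra. -/
theorem Admissible.expect_coset (h : D.Admissible P K) {g g' : Γ}
    (hg : g⁻¹ * g' ∈ K → g = g') {u u' : D.R.Aut} (hu : u ∈ D.minReps P)
    (hu' : u' ∈ D.minReps P) :
    h.expect (star (D.NGFull g * D.NFull (D.lin u)) * (D.NGFull g' * D.NFull (D.lin u'))) =
      if g = g' ∧ u = u' then (D.absNorm g : ℂ) ^ 2 • 1 else 0 := by
  have := h.represents_coset hg hu hu' 1
  rw [map_one, mul_one] at this
  rw [(h.represents_expect _).unique this]
  split_ifs
  · rfl
  · rw [zero_smul]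

theorem norm_starCoeff (g : Γ) : ‖D.starCoeff g‖ * D.absNorm g⁻¹ = D.absNorm g := by
  have h1 := D.absNorm_mul g g⁻¹
  rw [mul_inv_cancel, absNorm_one, mul_one] at h1
  have h2 : ‖D.starCoeff g‖ = D.absNorm g ^ 2 * ‖(D.coc g g⁻¹ : ℂ)‖⁻¹ := by
    rw [starCoeff, norm_mul, norm_inv, norm_pow, Complex.norm_real, Real.norm_of_nonneg
      (D.absNorm_pos g).le]
  have h3 := (D.absNorm_pos g).ne'
  have h4 := (D.absNorm_pos g⁻¹).ne'
  rw [h2, h1]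
  field_simp

open Classical in
theorem tau_mul_star (g g' : Γ) {u u' : D.R.Aut} (hu : u ∈ D.weyl D.simple)
    (hu' : u' ∈ D.weyl D.simple) :
    D.admissible_simple.tau (D.NGFull g * D.NFull (D.lin u) *
      star (D.NGFull g' * D.NFull (D.lin u'))) =
      if g = g' ∧ u = u' then (D.absNorm g : ℂ) ^ 2 else 0 := by
  have hm := lin_mem_aff hu
  have hm' := lin_mem_aff hu'
  have e : ∀ (g : Γ) {u : D.R.Aut} (_ : D.lin u ∈ D.aff D.simple),
      star (D.NGFull g * D.NFull (D.lin u)) =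
        D.starCoeff g • (D.NFull (D.lin u)⁻¹ * D.NGFull g⁻¹) := by
    intro g u hu
    rw [StarMul.star_mul, NFull, star_N hu, NGFull, star_NG (Subgroup.mem_top g), mul_smul_comm]
  rw [← star_star (D.NGFull g * D.NFull (D.lin u)), e g hm, e g' hm', star_smul, smul_mul_assoc,
    mul_smul_comm, map_smul, map_smul, D.admissible_simple.tau_star_N (inv_mem hm) (inv_mem hm')
    (Subgroup.mem_top _) (Subgroup.mem_top _)]
  have hiff : (D.lin u)⁻¹ = (D.lin u')⁻¹ ∧ g⁻¹ = g'⁻¹ ↔ g = g' ∧ u = u' := by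
    rw [inv_inj, inv_inj, and_comm]
    exact and_congr_right fun _ =>
      ⟨fun h => congrArg (fun w : D.Ext => w.right) h, fun h => h ▸ rfl⟩
  by_cases h : g = g' ∧ u = u'
  · rw [if_pos h, if_pos (hiff.2 h)]
    obtain ⟨rfl, rfl⟩ := h
    rw [smul_eq_mul, smul_eq_mul, ← mul_assoc, mul_comm (star _)]
    change D.starCoeff g * conj (D.starCoeff g) * _ = _
    rw [Complex.mul_conj, Complex.normSq_eq_norm_sq]
    norm_cast
    rw [← mul_pow, norm_starCoeff]
  · rw [if_neg h, if_neg fun h' => h (hiff.1 h'), smul_zero, smul_zero]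

/-- On the span of the `N_g N_u` the conditional expectation is the trace, up to the order of the
factors: both pairings have the `N_g N_u` as an orthogonal basis, with the same norms. -/
theorem Admissible.expect_repSpan (h : D.Admissible P K) {GP : Set Γ}
    (hGP : Subgroup.IsComplement GP (K : Set Γ)) {b b' : D.Full} (hb : b ∈ D.repSpan P GP)
    (hb' : b' ∈ D.repSpan P GP) :
    h.expect (star b' * b) = conj (D.admissible_simple.tau (b' * star b)) • 1 := by
  induction hb using Submodule.span_induction with
  | mem b hb =>
    obtain ⟨g, hg, u, hu, rfl⟩ := hb
    induction hb' using Submodule.span_induction with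
    | mem b' hb' =>
      obtain ⟨g', hg', u', hu', rfl⟩ := hb'
      rw [h.expect_coset (isComplement_eq hGP hg' hg) hu' hu, tau_mul_star g' g hu'.1 hu.1]
      split_ifs
      · rw [map_pow, Complex.conj_ofReal]
      · rw [map_zero, zero_smul]
    | zero => simp
    | add x y _ _ hx hy =>
      rw [star_add, add_mul, map_add, hx, hy, add_mul, map_add, map_add, add_smul]
    | smul c x _ hx =>
      rw [star_smul, smul_mul_assoc, map_smul, hx, smul_mul_assoc, map_smul, smul_eq_mul,
        map_mul (starRingEnd ℂ), mul_smul]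
      rfl
  | zero => simp
  | add x y _ _ hx hy =>
    rw [star_add, mul_add, map_add, hx, hy, mul_add, map_add, map_add, add_smul]
  | smul c x _ hx =>
    rw [star_smul, mul_smul_comm, map_smul, hx, mul_smul_comm, map_smul, smul_eq_mul,
      map_mul (starRingEnd ℂ), mul_smul]
    congr 1
    exact (Complex.conj_conj c).symm

/-! ### Hermitian duals of parabolically induced modules -/

/-- The pairing is `⟨b' ⊗ λ, b ⊗ v⟩ = λ(E(b'^* b) v)`, with the conditional expectation `E`. On the
span of the `N_g N_u` the element `E(b'^* b)` is a scalar. -/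
theorem Admissible.exists_induced_equiv (h : D.Admissible P K) (V : Type*) [AddCommGroup V]
    [Module ℂ V] [Module (D.Alg P K) V] [IsScalarTower ℂ (D.Alg P K) V] :
    ∃ Φ : Induced h.embed (HermitianDual (D.Alg P K) V) ≃ₗ[D.Full]
        HermitianDual D.Full (Induced h.embed V),
      ∀ GP : Set Γ, Subgroup.IsComplement GP (K : Set Γ) →
        ∀ b' ∈ D.repSpan P GP, ∀ b ∈ D.repSpan P GP,
          ∀ (l : HermitianDual (D.Alg P K) V) (v : V),
            Φ (Induced.tmul h.embed _ b' l) (Induced.tmul h.embed V b v) =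
              D.admissible_simple.tau (b' * star b) * l v := by
  classical
  obtain ⟨GP, hGP, -⟩ := K.exists_isComplement_left 1
  have hfin : Finite (D.minReps P) := ((finite_weyl (D := D.toHeckeDatum) subset_rfl).subset
    fun u hu => hu.1).to_subtype
  obtain ⟨Φ, hΦ⟩ := exists_induced_dual_equiv h.embed h.expect h.expect_mul h.expect_star_mul
    (R := GP × D.minReps P) (fun r => D.NGFull r.1 * D.NFull (D.lin r.2))
    (fun r => (D.absNorm r.1 : ℂ) ^ 2)
    (fun r => pow_ne_zero 2 (by exact_mod_cast (D.absNorm_pos _).ne'))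
    (fun r s => by
      rw [h.expect_coset (isComplement_eq hGP r.1.2 s.1.2) r.2.2 s.2.2]
      have hiff : r = s ↔ (r.1 : Γ) = s.1 ∧ (r.2 : D.R.Aut) = s.2 := by
        rw [Prod.ext_iff, Subtype.ext_iff, Subtype.ext_iff]
      by_cases hrs : r = s
      · rw [if_pos hrs, if_pos (hiff.1 hrs)]
      · rw [if_neg hrs, if_neg fun h' => hrs (hiff.2 h')])
    (fun b => by
      induction b using h.coset_induction hGP with
      | h1 g hg u hu a =>
        exact AddSubmonoid.subset_closure ⟨(⟨g, hg⟩, ⟨u, hu⟩), a, rfl⟩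
      | h0 => exact zero_mem _
      | hadd a b ha hb => exact add_mem ha hb) V
  refine ⟨Φ, fun GP' hGP' b' hb' b hb l v => ?_⟩
  rw [hΦ, h.expect_repSpan hGP' hb hb', smul_assoc, one_smul, map_smulₛₗ, Complex.conj_conj,
    smul_eq_mul]

theorem isTrace_tau : D.IsTrace D.admissible_simple.tau := by
  classical
  have h1 : ∀ w ∈ D.aff D.simple, ∀ g : Γ, D.admissible_simple.tau (D.NFull w * D.NGFull g) =
      if w = 1 ∧ g = 1 then 1 else 0 := by
    intro w hw g
    rw [NFull, N_of_mem hw, NGFull, NG_of_mem (Subgroup.mem_top g),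
      D.admissible_simple.tau_nW_mul_nK]
    refine if_congr ?_ rfl rfl
    rw [Subtype.ext_iff, Subtype.ext_iff]
    rfl
  refine ⟨?_, fun w hw g hwg => ?_⟩
  · have := h1 1 (one_mem _) 1
    rwa [NFull, N_one, NGFull, NG_one, one_mul, if_pos ⟨rfl, rfl⟩] at this
  · rw [h1 w hw g, if_neg]
    rintro ⟨rfl, rfl⟩
    simp at hwg

theorem Admissible.isParabolicEmbedding {G : Set ι → Subgroup Γ} (h : D.Admissible P (G P)) :
    D.IsParabolicEmbedding G P h.embed where
  injective := h.embed_injective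
  theta y hy := by rw [h.embed_N (trans_mem_aff y), stab_trans h.subset hy]
  weyl u hu := by rw [h.embed_N (lin_mem_aff hu), stab_lin h.subset hu]
  group g hg := h.embed_NG hg

theorem ParabolicCondition.admissible {G : Set ι → Subgroup Γ} (hG : D.ParabolicCondition G)
    (hP : P ⊆ D.simple) : D.Admissible P (G P) := ⟨hP, hG.stab P hP⟩

/-- Conjugation by `w_Δ w_P` maps `Γ_P` to the group of `P^op`, and does not change its image
in `Γ`. -/
theorem ParabolicCondition.op_eq {G : Set ι → Subgroup Γ} (hG : D.ParabolicCondition G)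
    (hP : P ⊆ D.simple) : G (D.op P) = G P := by
  have himage : (fun i => (D.toOp P * D.act 1) • i) '' P = D.op P := by
    rw [map_one, mul_one]
    ext i
    refine ⟨?_, fun hi => ⟨(D.toOp P)⁻¹ • i, ?_, smul_inv_smul _ _⟩⟩
    · rintro ⟨j, hj, rfl⟩; exact (toOp_smul_mem hP j).2 hj
    · exact (toOp_smul_mem hP _).1 (by rwa [smul_inv_smul])
  have h1 := hG.conjugate (D.toOp P) (toOp_mem hP) 1 P hP (D.op P) (op_subset hP) himage
  ext g
  constructor
  · intro hg
    have : D.emb g ∈ (G (D.op P)).map D.emb := ⟨g, hg, rfl⟩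
    rw [← h1] at this
    obtain ⟨_, ⟨k, hk, rfl⟩, e⟩ := this
    have e2 : 1 * k * 1⁻¹ = g := congrArg Prod.snd e
    rw [one_mul, inv_one, mul_one] at e2
    rwa [← e2]
  · intro hg
    have : MulAut.conj (D.toOp P * D.act 1, (1 : Γ)) (D.emb g) ∈ (G (D.op P)).map D.emb := by
      rw [← h1]
      exact ⟨_, ⟨g, hg, rfl⟩, rfl⟩
    obtain ⟨k, hk, e⟩ := this
    have e2 : k = 1 * g * 1⁻¹ := congrArg Prod.snd e
    rw [one_mul, inv_one, mul_one] at e2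
    rwa [← e2]

/-- The isomorphism `ψ_{ΔP}` and its relation to the embeddings. The subgroup `K'` is `K` itself. -/
theorem Admissible.exists_psi (h : D.Admissible P K) {K' : Subgroup Γ} (hK : K' = K)
    (h' : D.Admissible (D.op P) K') :
    ∃ ψ : D.Alg P K ≃⋆ₐ[ℂ] D.Alg (D.op P) K',
      (∀ w ∈ D.aff P, ψ (D.N P K w) =
        D.N (D.op P) K' (D.lin (D.toOp P) * w * (D.lin (D.toOp P))⁻¹)) ∧
      (∀ g ∈ K, ψ (D.NG P K g) = D.NG (D.op P) K' g) ∧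
      ∀ a, star (h.embed (star a)) * D.NFull (D.lin (D.toOp P)⁻¹) =
        D.NFull (D.lin (D.toOp P)⁻¹) * h'.embed (ψ a) := by
  subst hK
  exact ⟨h.conjugates_toOp.equiv, fun w hw => h.conjugates_toOp.equiv_N hw,
    fun g hg => h.conjugates_toOp.equiv_NG hg, h.star_embed_star_mul h'⟩

end TwistedDatum

end

theorem theoremB {ι X Y Γ : Type*} [Fintype ι] [AddCommGroup X] [AddCommGroup Y]
    [Module.Finite ℤ X] [Module.Finite ℤ Y] [Group Γ] [Fintype Γ]
    (D : TwistedDatum ι X Y Γ) (G : Set ι → Subgroup Γ) (hG : D.ParabolicCondition G)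
    (P : Set ι) (hP : P ⊆ D.simple) :
    D.op P ⊆ D.simple ∧
    ∃ (τ : D.Full →ₗ[ℂ] ℂ) (jP : D.Par G P →ₐ[ℂ] D.Full) (jQ : D.Par G (D.op P) →ₐ[ℂ] D.Full)
      (ψ : D.Par G P ≃⋆ₐ[ℂ] D.Par G (D.op P)),
      D.IsTrace τ ∧ D.IsParabolicEmbedding G P jP ∧ D.IsParabolicEmbedding G (D.op P) jQ ∧
      D.IsPsi G P ψ ∧
      -- parabolic induction
      (∀ (V : Type*) [AddCommGroup V] [Module ℂ V] [Module (D.Par G P) V]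
          [IsScalarTower ℂ (D.Par G P) V],
        ∃ Φ : Induced jP (HermitianDual (D.Par G P) V) ≃ₗ[D.Full]
            HermitianDual D.Full (Induced jP V),
          ∀ GP : Set Γ, Subgroup.IsComplement GP (G P : Set Γ) →
            ∀ h' ∈ D.repSpan P GP, ∀ h ∈ D.repSpan P GP,
              ∀ (l : HermitianDual (D.Par G P) V) (v : V),
                Φ (Induced.tmul jP _ h' l) (Induced.tmul jP V h v) = τ (h' * star h) * l v) ∧
      -- parabolic restriction
      (∀ (V : Type*) [AddCommGroup V] [Module ℂ V] [Module D.Full V] [IsScalarTower ℂ D.Full V],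
        (∃ Φ : Restricted jP (HermitianDual D.Full V) ≃ₗ[D.Par G P]
            Restricted (AlgHomClass.toAlgHom ψ)
              (HermitianDual (D.Par G (D.op P)) (Restricted jQ V)),
          ∀ (l : HermitianDual D.Full V) (v : V),
            (Restricted.of _ _).symm (Φ (Restricted.of jP _ l)) (Restricted.of jQ V v) =
              l (D.NFull (D.lin (D.longest P * D.longest D.simple)) • v)) ∧
        ∃ Φ : Restricted (AlgHomClass.toAlgHom ψ) (Restricted jQ (HermitianDual D.Full V))
            ≃ₗ[D.Par G P] HermitianDual (D.Par G P) (Restricted jP V),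
          ∀ (l : HermitianDual D.Full V) (v : V),
            Φ (Restricted.of _ _ (Restricted.of jQ _ l)) (Restricted.of jP V v) =
              l (D.NFull (D.lin (D.longest D.simple * D.longest P)) • v)) := by
  have h : D.Admissible P (G P) := hG.admissible hP
  have hP' : D.op P ⊆ D.simple := HeckeDatum.op_subset hP
  have h' : D.Admissible (D.op P) (G (D.op P)) := hG.admissible hP'
  have hinv : (D.toOp P)⁻¹ = D.longest P * D.longest D.simple := HeckeDatum.toOp_inv hP
  have hlin : (D.lin (D.toOp P))⁻¹ = D.lin (D.longest P) * D.lin (D.longest D.simple) := by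
    rw [HeckeDatum.lin_inv, hinv, HeckeDatum.lin_mul]
  have hmem : D.lin (D.toOp P) ∈ D.aff D.simple :=
    HeckeDatum.lin_mem_aff (HeckeDatum.toOp_mem hP)
  obtain ⟨ψ, hψN, hψG, hψ⟩ := h.exists_psi (hG.op_eq hP) h'
  refine ⟨hP', D.admissible_simple.tau, h.embed, h'.embed, ψ, TwistedDatum.isTrace_tau,
    h.isParabolicEmbedding, h'.isParabolicEmbedding, ⟨fun w hw => ?_, hψG⟩,
    fun V _ _ _ _ => h.exists_induced_equiv V, fun V _ _ _ _ => ⟨?_, ?_⟩⟩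
  · rw [hψN w hw, hlin, HeckeDatum.toOp, HeckeDatum.lin_mul]
    simp only [mul_assoc]
  · rw [← hinv]
    refine exists_dual_restrict_equiv h.embed h'.embed (AlgHomClass.toAlgHom ψ)
      (TwistedDatum.isUnit_N subset_rfl (HeckeDatum.lin_inv (D.toOp P) ▸ inv_mem hmem))
      (fun a => ?_) V
    have := hψ (star a)
    rw [star_star, map_star] at this
    exact this
  · refine exists_restrict_dual_equiv h.embed h'.embed (AlgHomClass.toAlgHom ψ)
      (TwistedDatum.isUnit_N subset_rfl hmem) (fun a => ?_) V
    -- this is the adjoint of the first intertwining relation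
    have := congrArg star (hψ a)
    rw [star_mul, star_mul, star_star, TwistedDatum.NFull, ← HeckeDatum.lin_inv,
      TwistedDatum.star_N (inv_mem hmem), inv_inv] at this
    exact this.symm
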